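/- Let $\mathbb{K}$ be a commutative ring and let $A$ and $B$ be (associative unital, not necessarily commutative) $\mathbb{K}$-algebras that are flat as $\mathbb{K}$-modules. A $B$-$A$-bimodule relative to $\mathbb{K}$ is a left $B\otimes_{\mathbb{K}}A^{\mathrm{op}}$-module, and $\mathrm{D}^{\mathrm{b}}$, $\mathrm{D}^{-}$ denote the full subcategories of the derived category on the complexes with bounded, respectively bounded above, cohomology. For $M\in \mathrm{D}^{-}(\mathrm{Mod}\,B\otimes_{\mathbb{K}}A^{\mathrm{op}})$ and $N\in \mathrm{D}^{-}(\mathrm{Mod}\,A\otimes_{\mathbb{K}}C^{\mathrm{op}})$, where $C$ is a further flat $\mathbb{K}$-algebra, the derived tensor product $M\otimes^{\mathrm{L}}_A N$ in $\mathrm{D}^{-}(\mathrm{Mod}\,B\otimes_{\mathbb{K}}C^{\mathrm{op}})$ is computed from bounded above complexes of projective bimodules. A complex $T\in \mathrm{D}^{\mathrm{b}}(\mathrm{Mod}\,B\otimes_{\mathbb{K}}A^{\mathrm{op}})$ is a two-sided tilting complex over $B$-$A$ relative to $\mathbb{K}$ if there is a complex $S\in \mathrm{D}^{\mathrm{b}}(\mathrm{Mod}\,A\otimes_{\mathbb{K}}B^{\mathrm{op}})$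 with isomorphisms $S\otimes^{\mathrm{L}}_B T\cong A$ in $\mathrm{D}^{\mathrm{b}}(\mathrm{Mod}\,A\otimes_{\mathbb{K}}A^{\mathrm{op}})$ and $T\otimes^{\mathrm{L}}_A S\cong B$ in $\mathrm{D}^{\mathrm{b}}(\mathrm{Mod}\,B\otimes_{\mathbb{K}}B^{\mathrm{op}})$; such an $S$ is called an inverse of $T$. Let $\mathbb{K}'$ be any commutative $\mathbb{K}$-algebra and put $A':=\mathbb{K}'\otimes_{\mathbb{K}}A$ and $B':=\mathbb{K}'\otimes_{\mathbb{K}}B$. Suppose that $T$ is a two-sided tilting complex over $B$-$A$ relative to $\mathbb{K}$, with inverse $S$. Define $$T':=\mathbb{K}'\otimes^{\mathrm{L}}_{\mathbb{K}}T,\qquad S':=\mathbb{K}'\otimes^{\mathrm{L}}_{\mathbb{K}}S ,$$ which are a priori objects of $\mathrm{D}^{-}(\mathrm{Mod}\,B'\otimes_{\mathbb{K}'}A'^{\mathrm{op}})$ and $\mathrm{D}^{-}(\mathrm{Mod}\,A'\otimes_{\mathbb{K}'}B'^{\mathrm{op}})$. Then $T'\in\mathrm{D}^{\mathrm{b}}(\mathrm{Mod}\,B'\otimes_{\mathbb{K}'}A'^{\mathrm{op}})$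 and $S'\in\mathrm{D}^{\mathrm{b}}(\mathrm{Mod}\,A'\otimes_{\mathbb{K}'}B'^{\mathrm{op}})$, and $T'$ is a two-sided tilting complex over $B'$-$A'$ relative to $\mathbb{K}'$, with inverse $S'$. -/

import Mathlib

open CategoryTheory Limits
open scoped TensorProduct MulOpposite

universe u

noncomputable section

namespace TwoSidedTilting

section Bimodules

variable {K B A C : Type u} [CommRing K] [Ring B] [Algebra K B] [Ring A] [Algebra K A]
  [Ring C] [Algebra K C]

section Unbundled

variable (M : Type u) [AddCommGroup M] [Module K M] [Module (B ⊗[K] Aᵐᵒᵖ) M]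
  [IsScalarTower K (B ⊗[K] Aᵐᵒᵖ) M]

variable (K B A) in
/-- The left `B`-action on a `K`-central `B`-`A`-bimodule: `b` acts as `b ⊗ 1`. -/
def leftAct : B →ₐ[K] Module.End K M :=
  (Algebra.lsmul K K M).comp
    (Algebra.TensorProduct.includeLeft : B →ₐ[K] B ⊗[K] Aᵐᵒᵖ)

variable (K B A) in
/-- The right `A`-action on a `K`-central `B`-`A`-bimodule, as a left action of the opposite
algebra: `a` acts as `1 ⊗ a`. -/
def rightAct : Aᵐᵒᵖ →ₐ[K] Module.End K M :=
  (Algebra.lsmul K K M).comp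
    (Algebra.TensorProduct.includeRight : Aᵐᵒᵖ →ₐ[K] B ⊗[K] Aᵐᵒᵖ)

variable (N : Type u) [AddCommGroup N] [Module K N] [Module (A ⊗[K] Cᵐᵒᵖ) N]
  [IsScalarTower K (A ⊗[K] Cᵐᵒᵖ) N]

variable (K B A C) in
/-- The submodule of `M ⊗[K] N` generated by the elements `(m a) ⊗ n - m ⊗ (a n)`, `a ∈ A`. -/
def balancedRel : Submodule K (M ⊗[K] N) :=
  Submodule.span K {x | ∃ (m : M) (a : A) (n : N),
    x = (rightAct K B A M (MulOpposite.op a) m) ⊗ₜ[K] n - m ⊗ₜ[K] (leftAct K A C N a n)}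

variable (K B A C) in
/-- The tensor product `M ⊗_A N` of a `B`-`A`-bimodule and an `A`-`C`-bimodule
(`A` need not be commutative). -/
def BimodTensor : Type u := (M ⊗[K] N) ⧸ balancedRel K B A C M N

instance : AddCommGroup (BimodTensor K B A C M N) :=
  inferInstanceAs (AddCommGroup ((M ⊗[K] N) ⧸ balancedRel K B A C M N))

instance : Module K (BimodTensor K B A C M N) :=
  inferInstanceAs (Module K ((M ⊗[K] N) ⧸ balancedRel K B A C M N))

variable (K B A C) in
/-- The projection `M ⊗[K] N → M ⊗_A N`. -/
def BimodTensor.proj : M ⊗[K] N →ₗ[K] BimodTensor K B A C M N :=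
  (balancedRel K B A C M N).mkQ

variable {M N} in
lemma BimodTensor.proj_surjective : Function.Surjective (BimodTensor.proj K B A C M N) :=
  Submodule.mkQ_surjective _

lemma leftAct_rightAct (b : B) (a : Aᵐᵒᵖ) (m : M) :
    leftAct K B A M b (rightAct K B A M a m) = rightAct K B A M a (leftAct K B A M b m) := by
  simp [leftAct, rightAct, smul_smul]

section map

variable {M N}
variable {M' : Type u} [AddCommGroup M'] [Module K M'] [Module (B ⊗[K] Aᵐᵒᵖ) M']
  [IsScalarTower K (B ⊗[K] Aᵐᵒᵖ) M']
  {N' : Type u} [AddCommGroup N'] [Module K N'] [Module (A ⊗[K] Cᵐᵒᵖ) N']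
  [IsScalarTower K (A ⊗[K] Cᵐᵒᵖ) N']

/-- The map `f ⊗ g : M ⊗_A N → M' ⊗_A N'` for `K`-linear maps `f` and `g` that commute with the
actions of `A`. -/
def BimodTensor.mapAux (f : M →ₗ[K] M') (g : N →ₗ[K] N')
    (hf : ∀ (a : A) (m : M), f (rightAct K B A M (MulOpposite.op a) m) =
      rightAct K B A M' (MulOpposite.op a) (f m))
    (hg : ∀ (a : A) (n : N), g (leftAct K A C N a n) = leftAct K A C N' a (g n)) :
    BimodTensor K B A C M N →ₗ[K] BimodTensor K B A C M' N' :=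
  Submodule.mapQ _ _ (TensorProduct.map f g) (by
    rw [balancedRel, Submodule.span_le]
    rintro _ ⟨m, a, n, rfl⟩
    simp only [SetLike.mem_coe, Submodule.mem_comap, map_sub, TensorProduct.map_tmul, hf, hg]
    exact Submodule.subset_span ⟨f m, a, g n, rfl⟩)

@[simp]
lemma BimodTensor.mapAux_proj (f : M →ₗ[K] M') (g : N →ₗ[K] N') (hf) (hg) (x : M ⊗[K] N) :
    BimodTensor.mapAux (B := B) (A := A) (C := C) f g hf hg (BimodTensor.proj K B A C M N x) =
      BimodTensor.proj K B A C M' N' (TensorProduct.map f g x) := rfl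

end map

lemma BimodTensor.hom_ext {P : Type u} [AddCommGroup P] [Module K P]
    {f g : BimodTensor K B A C M N →ₗ[K] P}
    (h : ∀ (m : M) (n : N), f (proj K B A C M N (m ⊗ₜ n)) = g (proj K B A C M N (m ⊗ₜ n))) :
    f = g := by
  refine Submodule.linearMap_qext _ (TensorProduct.ext' ?_)
  exact h

variable (K B A C) in
/-- The left `B`-action on `M ⊗_A N`. -/
def BimodTensor.leftHom : B →ₐ[K] Module.End K (BimodTensor K B A C M N) :=
  AlgHom.ofLinearMap
    { toFun := fun b ↦ BimodTensor.mapAux (leftAct K B A M b) LinearMap.id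
        (fun a m ↦ leftAct_rightAct M b _ m) (fun _ _ ↦ rfl)
      map_add' := fun b b' ↦ BimodTensor.hom_ext M N fun m n ↦ by
        simp [TensorProduct.add_tmul]
      map_smul' := fun r b ↦ BimodTensor.hom_ext M N fun m n ↦ by
        simp [← TensorProduct.smul_tmul'] }
    (BimodTensor.hom_ext M N fun m n ↦ by simp)
    (fun b b' ↦ BimodTensor.hom_ext M N fun m n ↦ by simp)

variable (K B A C) in
/-- The right `C`-action on `M ⊗_A N`. -/
def BimodTensor.rightHom : Cᵐᵒᵖ →ₐ[K] Module.End K (BimodTensor K B A C M N) :=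
  AlgHom.ofLinearMap
    { toFun := fun c ↦ BimodTensor.mapAux LinearMap.id (rightAct K A C N c)
        (fun _ _ ↦ rfl) (fun a n ↦ (leftAct_rightAct N a c n).symm)
      map_add' := fun b b' ↦ BimodTensor.hom_ext M N fun m n ↦ by
        simp [TensorProduct.tmul_add]
      map_smul' := fun r b ↦ BimodTensor.hom_ext M N fun m n ↦ by
        simp }
    (BimodTensor.hom_ext M N fun m n ↦ by simp)
    (fun b b' ↦ BimodTensor.hom_ext M N fun m n ↦ by simp)

variable (K B A C) in
/-- The action of `B ⊗[K] Cᵐᵒᵖ` on `M ⊗_A N`: `(b ⊗ c) (m ⊗ n) = (b m) ⊗ (n c)`. -/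
def BimodTensor.actHom : B ⊗[K] Cᵐᵒᵖ →ₐ[K] Module.End K (BimodTensor K B A C M N) :=
  Algebra.TensorProduct.lift (leftHom K B A C M N) (rightHom K B A C M N)
    (fun b c ↦ BimodTensor.hom_ext M N fun m n ↦ by simp [leftHom, rightHom])

instance : Module (B ⊗[K] Cᵐᵒᵖ) (BimodTensor K B A C M N) :=
  Module.compHom _ (BimodTensor.actHom K B A C M N).toRingHom

lemma BimodTensor.actHom_tmul (b : B) (c : Cᵐᵒᵖ) (m : M) (n : N) :
    actHom K B A C M N (b ⊗ₜ[K] c) (proj K B A C M N (m ⊗ₜ n)) =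
      proj K B A C M N ((leftAct K B A M b m) ⊗ₜ (rightAct K A C N c n)) := by
  simp [actHom, leftHom, rightHom]

section

variable {M N}
variable {M' : Type u} [AddCommGroup M'] [Module K M'] [Module (B ⊗[K] Aᵐᵒᵖ) M']
  [IsScalarTower K (B ⊗[K] Aᵐᵒᵖ) M']
  {N' : Type u} [AddCommGroup N'] [Module K N'] [Module (A ⊗[K] Cᵐᵒᵖ) N']
  [IsScalarTower K (A ⊗[K] Cᵐᵒᵖ) N']

lemma BimodTensor.mapAux_smul (f : M →ₗ[K] M') (g : N →ₗ[K] N') (hf) (hg)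
    (hf' : ∀ (b : B) (m : M), f (leftAct K B A M b m) = leftAct K B A M' b (f m))
    (hg' : ∀ (c : Cᵐᵒᵖ) (n : N), g (rightAct K A C N c n) = rightAct K A C N' c (g n))
    (r : B ⊗[K] Cᵐᵒᵖ) (x : BimodTensor K B A C M N) :
    BimodTensor.mapAux f g hf hg (r • x) =
      r • BimodTensor.mapAux (B := B) (A := A) (C := C) f g hf hg x := by
  change mapAux f g hf hg (actHom K B A C M N r x) =
    actHom K B A C M' N' r (mapAux (B := B) (A := A) (C := C) f g hf hg x)
  obtain ⟨x, rfl⟩ := proj_surjective x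
  induction x using TensorProduct.induction_on with
  | zero => simp
  | add x y hx hy => simp only [map_add, hx, hy]
  | tmul m n =>
    induction r using TensorProduct.induction_on with
    | zero => simp
    | add r s hr hs => simp only [map_add, LinearMap.add_apply, hr, hs]
    | tmul b c => simp [actHom_tmul, hf', hg']

end

end Unbundled

variable (K B A) in
/-- The category of `K`-central `B`-`A`-bimodules, i.e. of left `B ⊗[K] Aᵐᵒᵖ`-modules. -/
abbrev Bimod := ModuleCat.{u} (B ⊗[K] Aᵐᵒᵖ)

instance (M : Bimod K B A) : Module K M := Module.restrictScalars K (B ⊗[K] Aᵐᵒᵖ) M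

instance (M : Bimod K B A) : IsScalarTower K (B ⊗[K] Aᵐᵒᵖ) M :=
  IsScalarTower.restrictScalars K (B ⊗[K] Aᵐᵒᵖ) M

/-- A morphism of bimodules as a `K`-linear map. -/
def kHom {M N : Bimod K B A} (f : M ⟶ N) : M →ₗ[K] N := f.hom.restrictScalars K

lemma kHom_leftAct {M N : Bimod K B A} (f : M ⟶ N) (b : B) (m : M) :
    kHom f (leftAct K B A M b m) = leftAct K B A N b (kHom f m) :=
  f.hom.map_smul _ _

lemma kHom_rightAct {M N : Bimod K B A} (f : M ⟶ N) (a : Aᵐᵒᵖ) (m : M) :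
    kHom f (rightAct K B A M a m) = rightAct K B A N a (kHom f m) :=
  f.hom.map_smul _ _

/-- The morphism `f ⊗ g : M ⊗_A N ⟶ M' ⊗_A N'` of `B`-`C`-bimodules. -/
def bimodTensorMap {M M' : Bimod K B A} {N N' : Bimod K A C} (f : M ⟶ M') (g : N ⟶ N') :
    ModuleCat.of (B ⊗[K] Cᵐᵒᵖ) (BimodTensor K B A C M N) ⟶
      ModuleCat.of (B ⊗[K] Cᵐᵒᵖ) (BimodTensor K B A C M' N') :=
  ModuleCat.ofHom
    { toFun := BimodTensor.mapAux (kHom f) (kHom g) (fun _ ↦ kHom_rightAct f _) (kHom_leftAct g)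
      map_add' := map_add _
      map_smul' := fun r x ↦ BimodTensor.mapAux_smul (kHom f) (kHom g) _ _
        (kHom_leftAct f) (kHom_rightAct g) r x }

lemma bimodTensorMap_proj {M M' : Bimod K B A} {N N' : Bimod K A C} (f : M ⟶ M') (g : N ⟶ N')
    (m : M) (n : N) :
    (bimodTensorMap f g).hom (BimodTensor.proj K B A C M N (m ⊗ₜ n)) =
      BimodTensor.proj K B A C M' N' ((f.hom m) ⊗ₜ (g.hom n)) := rfl

lemma bimodTensor_hom_ext {M : Bimod K B A} {N : Bimod K A C} {P : Bimod K B C}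
    {f g : ModuleCat.of (B ⊗[K] Cᵐᵒᵖ) (BimodTensor K B A C M N) ⟶ P}
    (h : ∀ (m : M) (n : N), f.hom (BimodTensor.proj K B A C M N (m ⊗ₜ n)) =
      g.hom (BimodTensor.proj K B A C M N (m ⊗ₜ n))) : f = g := by
  ext x
  obtain ⟨x, rfl⟩ := BimodTensor.proj_surjective x
  induction x using TensorProduct.induction_on with
  | zero => simp
  | add x y hx hy => simp only [map_add, hx, hy]
  | tmul m n => exact h m n

variable (K B A C) in
/-- The bifunctor `(M, N) ↦ M ⊗_A N` on bimodules. -/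
def tensorFunctor : Bimod K B A ⥤ Bimod K A C ⥤ Bimod K B C where
  obj M :=
    { obj := fun N ↦ ModuleCat.of (B ⊗[K] Cᵐᵒᵖ) (BimodTensor K B A C M N)
      map := fun g ↦ bimodTensorMap (𝟙 M) g
      map_id := fun N ↦ bimodTensor_hom_ext fun m n ↦ rfl
      map_comp := fun f g ↦ bimodTensor_hom_ext fun m n ↦ rfl }
  map f :=
    { app := fun N ↦ bimodTensorMap f (𝟙 N)
      naturality := fun N N' g ↦ bimodTensor_hom_ext fun m n ↦ rfl }
  map_id M := by ext N : 2; exact bimodTensor_hom_ext fun m n ↦ rfl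
  map_comp f g := by ext N : 2; exact bimodTensor_hom_ext fun m n ↦ rfl

instance : (tensorFunctor K B A C).Additive where
  map_add {M M' f g} := by
    ext N : 2
    refine bimodTensor_hom_ext fun m n ↦ ?_
    change BimodTensor.proj K B A C M' N ((f.hom m + g.hom m) ⊗ₜ n) = _ + _
    rw [TensorProduct.add_tmul, map_add]
    rfl

instance (M : Bimod K B A) : ((tensorFunctor K B A C).obj M).Additive where
  map_add {N N' f g} := by
    refine bimodTensor_hom_ext fun m n ↦ ?_
    change BimodTensor.proj K B A C M N' (m ⊗ₜ (f.hom n + g.hom n)) = _ + _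
    rw [TensorProduct.tmul_add, map_add]
    rfl

/-- The tensor product over `A` of a complex of `B`-`A`-bimodules and a complex of
`A`-`C`-bimodules (the total complex of the double complex of the `P^i ⊗_A Q^j`). -/
abbrev tensorComplex (P : CochainComplex (Bimod K B A) ℤ) (Q : CochainComplex (Bimod K A C) ℤ) :
    CochainComplex (Bimod K B C) ℤ :=
  HomologicalComplex.mapBifunctor P Q (tensorFunctor K B A C) (ComplexShape.up ℤ)

variable (K A) in
/-- `A` as an `A`-`A`-bimodule: `a ⊗ a'` acts by `x ↦ a x a'`. -/
def diagonal : Bimod K A A :=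
  @ModuleCat.of (A ⊗[K] Aᵐᵒᵖ) _ A _ (Module.compHom A (AlgHom.mulLeftRight K A).toRingHom)

end Bimodules

section BaseChange

variable {K : Type u} [CommRing K] (K' : Type u) [CommRing K'] [Algebra K K']
  {B A : Type u} [Ring B] [Algebra K B] [Ring A] [Algebra K A]

section Unbundled

variable (M : Type u) [AddCommGroup M] [Module K M] [Module (B ⊗[K] Aᵐᵒᵖ) M]
  [IsScalarTower K (B ⊗[K] Aᵐᵒᵖ) M]

variable (K B A) in
/-- The left action of `K' ⊗[K] B` on `K' ⊗[K] M`: `(s ⊗ b) (t ⊗ m) = (s t) ⊗ (b m)`. -/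
def baseChangeLeft : K' ⊗[K] B →ₐ[K'] Module.End K' (K' ⊗[K] M) :=
  (LinearMap.tensorProductEnd K K' M).comp
    (Algebra.TensorProduct.map (AlgHom.id K' K') (leftAct K B A M))

variable (K B A) in
/-- The right action of `K' ⊗[K] A` on `K' ⊗[K] M`: `(t ⊗ m) (s ⊗ a) = (t s) ⊗ (m a)`. -/
def baseChangeRight : (K' ⊗[K] A)ᵐᵒᵖ →ₐ[K'] Module.End K' (K' ⊗[K] M) :=
  (LinearMap.tensorProductEnd K K' M).comp
    ((Algebra.TensorProduct.map (AlgEquiv.toOpposite K' K').symm.toAlgHom (rightAct K B A M)).comp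
      (Algebra.TensorProduct.opAlgEquiv K K' K' A).symm.toAlgHom)

lemma baseChangeLeft_tmul (s t : K') (b : B) (m : M) :
    baseChangeLeft K K' B A M (s ⊗ₜ b) (t ⊗ₜ m) = (s * t) ⊗ₜ (leftAct K B A M b m) := by
  change (s • (LinearMap.baseChange K' (leftAct K B A M b))) (t ⊗ₜ[K] m) = _
  simp [TensorProduct.smul_tmul']

lemma baseChangeRight_tmul (s t : K') (a : A) (m : M) :
    baseChangeRight K K' B A M (MulOpposite.op (s ⊗ₜ a)) (t ⊗ₜ m) =
      (s * t) ⊗ₜ (rightAct K B A M (MulOpposite.op a) m) := by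
  change (s • (LinearMap.baseChange K' (rightAct K B A M (MulOpposite.op a)))) (t ⊗ₜ[K] m) = _
  simp [TensorProduct.smul_tmul']

variable (K B A) in
/-- The action of `B' ⊗[K'] A'ᵐᵒᵖ` on `K' ⊗[K] M`, where `B' = K' ⊗[K] B`, `A' = K' ⊗[K] A`. -/
def baseChangeAct :
    (K' ⊗[K] B) ⊗[K'] (K' ⊗[K] A)ᵐᵒᵖ →ₐ[K'] Module.End K' (K' ⊗[K] M) :=
  Algebra.TensorProduct.lift (baseChangeLeft K K' B A M) (baseChangeRight K K' B A M) (by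
    intro b a
    obtain ⟨a, rfl⟩ := MulOpposite.op_surjective a
    refine LinearMap.ext fun x ↦ ?_
    simp only [Module.End.mul_apply]
    induction x using TensorProduct.induction_on with
    | zero => simp
    | add x y hx hy => simp only [map_add, hx, hy]
    | tmul t m =>
      induction b using TensorProduct.induction_on with
      | zero => simp
      | add x y hx hy => simp only [map_add, LinearMap.add_apply, hx, hy]
      | tmul s b =>
        induction a using TensorProduct.induction_on with
        | zero => simp
        | add x y hx hy =>
          simp only [MulOpposite.op_add, map_add, LinearMap.add_apply, hx, hy]
        | tmul s' a =>
          simp only [baseChangeLeft_tmul, baseChangeRight_tmul, leftAct_rightAct]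
          rw [mul_left_comm])

variable (K) in
/-- The `K'`-module `K' ⊗[K] M`. When `M` is a `B`-`A`-bimodule it is regarded as a bimodule over
`K' ⊗[K] B` and `K' ⊗[K] A`. -/
def BaseChange (M : Type u) [AddCommGroup M] [Module K M] : Type u := K' ⊗[K] M

instance (M : Type u) [AddCommGroup M] [Module K M] : AddCommGroup (BaseChange K K' M) :=
  inferInstanceAs (AddCommGroup (K' ⊗[K] M))

instance : Module ((K' ⊗[K] B) ⊗[K'] (K' ⊗[K] A)ᵐᵒᵖ) (BaseChange K K' M) :=
  letI : Module (Module.End K' (K' ⊗[K] M)) (BaseChange K K' M) :=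
    inferInstanceAs (Module (Module.End K' (K' ⊗[K] M)) (K' ⊗[K] M))
  Module.compHom _ (baseChangeAct K K' B A M).toRingHom

variable (K) in
/-- The map `K' ⊗[K] f`. -/
def BaseChange.map {M N : Type u} [AddCommGroup M] [Module K M] [AddCommGroup N] [Module K N]
    (f : M →ₗ[K] N) : BaseChange K K' M →+ BaseChange K K' N :=
  (LinearMap.baseChange K' f).toAddMonoidHom

lemma baseChangeAct_tmul (s s' t : K') (b : B) (a : A) (m : M) :
    baseChangeAct K K' B A M ((s ⊗ₜ[K] b) ⊗ₜ[K'] (MulOpposite.op (s' ⊗ₜ[K] a))) (t ⊗ₜ[K] m) =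
      (s * (s' * t)) ⊗ₜ[K] (leftAct K B A M b (rightAct K B A M (MulOpposite.op a) m)) := by
  rw [baseChangeAct, Algebra.TensorProduct.lift_tmul, Module.End.mul_apply,
    baseChangeRight_tmul, baseChangeLeft_tmul]

variable {M} in
lemma BaseChange.map_smul {N : Type u} [AddCommGroup N] [Module K N] [Module (B ⊗[K] Aᵐᵒᵖ) N]
    [IsScalarTower K (B ⊗[K] Aᵐᵒᵖ) N] (f : M →ₗ[K] N)
    (hl : ∀ (b : B) (m : M), f (leftAct K B A M b m) = leftAct K B A N b (f m))
    (hr : ∀ (a : Aᵐᵒᵖ) (m : M), f (rightAct K B A M a m) = rightAct K B A N a (f m))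
    (r : (K' ⊗[K] B) ⊗[K'] (K' ⊗[K] A)ᵐᵒᵖ) (x : BaseChange K K' M) :
    BaseChange.map K K' f (r • x) = r • BaseChange.map K K' f x := by
  change LinearMap.baseChange K' f (baseChangeAct K K' B A M r x) =
    baseChangeAct K K' B A N r (LinearMap.baseChange K' f x)
  change K' ⊗[K] M at x
  induction x using TensorProduct.induction_on with
  | zero => simp
  | add x y hx hy => simp only [map_add, hx, hy]
  | tmul t m =>
    induction r using TensorProduct.induction_on with
    | zero => simp
    | add r s hr hs => simp only [map_add, LinearMap.add_apply, hr, hs]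
    | tmul b a =>
      obtain ⟨a, rfl⟩ := MulOpposite.op_surjective a
      induction b using TensorProduct.induction_on with
      | zero => simp
      | add x y hx hy => simp only [TensorProduct.add_tmul, map_add, LinearMap.add_apply, hx, hy]
      | tmul s b =>
        induction a using TensorProduct.induction_on with
        | zero => simp
        | add x y hx hy =>
          simp only [MulOpposite.op_add, TensorProduct.tmul_add, map_add, LinearMap.add_apply,
            hx, hy]
        | tmul s' a =>
          simp only [baseChangeAct_tmul, LinearMap.baseChange_tmul, hl, hr]

end Unbundled

variable (K B A) in
/-- The base change functor `M ↦ K' ⊗[K] M` from `B`-`A`-bimodules relative to `K` to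
`(K' ⊗[K] B)`-`(K' ⊗[K] A)`-bimodules relative to `K'`. -/
def baseChangeFunctor : Bimod K B A ⥤ Bimod K' (K' ⊗[K] B) (K' ⊗[K] A) where
  obj M := ModuleCat.of _ (BaseChange K K' M)
  map f := ModuleCat.ofHom
    { toFun := BaseChange.map K K' (kHom f)
      map_add' := map_add _
      map_smul' := BaseChange.map_smul K' (kHom f) (kHom_leftAct f) (kHom_rightAct f) }
  map_id M := by
    ext x
    exact congrArg (fun g : K' ⊗[K] M →ₗ[K'] K' ⊗[K] M ↦ g x) LinearMap.baseChange_id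
  map_comp f g := by
    ext x
    exact LinearMap.congr_fun (LinearMap.baseChange_comp (A := K') (kHom f) (kHom g)) x

instance : (baseChangeFunctor K K' B A).Additive where
  map_add {M N f g} := by
    ext x
    exact LinearMap.congr_fun (LinearMap.baseChange_add (A := K') (kHom f) (kHom g)) x

end BaseChange

section Derived

universe v w

variable {𝒞 : Type w} [Category.{v} 𝒞] [Abelian 𝒞]

lemma quasiIso_of_opEquivalence {X Y : CochainComplex 𝒞 ℤ} (f : X ⟶ Y)
    (hf : QuasiIso ((CochainComplex.opEquivalence 𝒞).functor.map f.op)) : QuasiIso f where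
  quasiIsoAt n := by
    obtain ⟨m, rfl⟩ : ∃ m : ℤ, n = -m := ⟨-n, by simp⟩
    have h := hf.quasiIsoAt m
    rw [quasiIsoAt_iff' _ (m - 1) m (m + 1) (by simp) (by simp)] at h
    rw [quasiIsoAt_iff' _ (-(m + 1)) (-m) (-(m - 1)) (by grind [CochainComplex.prev])
      (by grind [CochainComplex.next]), ← ShortComplex.quasiIso_opMap_iff]
    exact h

lemma exists_projective_resolution [EnoughProjectives 𝒞] (X : CochainComplex 𝒞 ℤ) (n : ℤ)
    [X.IsStrictlyLE n] :
    ∃ (P : CochainComplex 𝒞 ℤ) (f : P ⟶ X), QuasiIso f ∧ (∀ i, Projective (P.X i)) ∧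
      P.IsStrictlyLE n := by
  let e := CochainComplex.opEquivalence 𝒞
  let Y := e.functor.obj (Opposite.op X)
  have : Y.IsStrictlyGE (-n) := by
    rw [CochainComplex.isStrictlyGE_iff]
    intro i hi
    exact (X.isZero_of_isStrictlyLE n (-i) (by lia)).op
  obtain ⟨I, f, hf, hI, hI'⟩ :=
    CochainComplex.Plus.modelCategoryQuillen.exists_quasiIso_injective Y (-n)
  let g : Opposite.op X ⟶ e.inverse.obj I := e.unit.app _ ≫ e.inverse.map f
  refine ⟨(e.inverse.obj I).unop, g.unop, ?_, fun i ↦ ?_, ?_⟩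
  · apply quasiIso_of_opEquivalence
    have : e.functor.map g = f ≫ e.counitInv.app I := by
      simp [g]
    change QuasiIso (e.functor.map g)
    rw [this]
    infer_instance
  · have := hI (-i)
    change Projective (I.X (-i)).unop
    infer_instance
  · rw [CochainComplex.isStrictlyLE_iff]
    intro i hi
    exact (I.isZero_of_isStrictlyGE (-n) (-i) (by lia)).unop

/-- A resolution of an object of the derived category by a bounded above complex of projective
objects. -/
structure ProjRes [HasDerivedCategory 𝒞] (M : DerivedCategory 𝒞) where
  /-- the resolving complex -/
  complex : CochainComplex 𝒞 ℤ
  /-- an upper bound for the complex -/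
  bound : ℤ
  isStrictlyLE : complex.IsStrictlyLE bound
  projective : ∀ i, Projective (complex.X i)
  /-- the isomorphism in the derived category with the given object -/
  iso : DerivedCategory.Q.obj complex ≅ M

lemma ProjRes.nonempty [HasDerivedCategory 𝒞] [EnoughProjectives 𝒞]
    (M : DerivedCategory.Minus 𝒞) : Nonempty (ProjRes M.obj) := by
  obtain ⟨n, hn⟩ := M.property
  obtain ⟨X, _, ⟨e⟩⟩ := M.obj.exists_iso_Q_obj_of_isLE n
  obtain ⟨P, f, hf, hP, hP'⟩ := exists_projective_resolution X n
  exact ⟨⟨P, n, hP', hP, asIso (DerivedCategory.Q.map f) ≪≫ e.symm⟩⟩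

/-- A chosen projective resolution of an object of the bounded above derived category. -/
def projRes [HasDerivedCategory 𝒞] [EnoughProjectives 𝒞] (M : DerivedCategory.Minus 𝒞) :
    ProjRes M.obj :=
  (ProjRes.nonempty M).some

end Derived

section Tilting

instance (R : Type u) [Ring R] : HasDerivedCategory.{u + 1} (ModuleCat.{u} R) :=
  HasDerivedCategory.standard _

variable {K B A C : Type u} [CommRing K] [Ring B] [Algebra K B] [Ring A] [Algebra K A]
  [Ring C] [Algebra K C]

lemma tensorComplex_isStrictlyLE (P : CochainComplex (Bimod K B A) ℤ)
    (Q : CochainComplex (Bimod K A C) ℤ) (p q : ℤ) [P.IsStrictlyLE p] [Q.IsStrictlyLE q] :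
    (tensorComplex P Q).IsStrictlyLE (p + q) := by
  rw [CochainComplex.isStrictlyLE_iff]
  intro i hi
  rw [IsZero.iff_id_eq_zero]
  refine HomologicalComplex.mapBifunctor.hom_ext fun a b h ↦ ?_
  have h' : a + b = i := h
  have h0 : IsZero (((tensorFunctor K B A C).obj (P.X a)).obj (Q.X b)) := by
    by_cases ha : p < a
    · exact ((tensorFunctor K B A C).map_isZero (P.isZero_of_isStrictlyLE p a ha)).obj _
    · exact ((tensorFunctor K B A C).obj (P.X a)).map_isZero
        (Q.isZero_of_isStrictlyLE q b (by lia))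
  exact h0.eq_of_src _ _

/-- The derived tensor product `M ⊗ᴸ_A N` of objects of the bounded above derived categories of
`B`-`A`-bimodules and of `A`-`C`-bimodules: it is represented by `P ⊗_A Q`, where `P` and `Q` are
bounded above complexes of projective bimodules that represent `M` and `N`. (When `B` is flat over
`K`, a projective bimodule `P^i` is flat over `Aᵐᵒᵖ`, so that `P ⊗_A Q` is independent of the
choice of the bounded above complex `Q` that represents `N`.) -/
def derivedTensor (M : DerivedCategory.Minus (Bimod K B A))
    (N : DerivedCategory.Minus (Bimod K A C)) : DerivedCategory.Minus (Bimod K B C) where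
  obj := DerivedCategory.Q.obj (tensorComplex (projRes M).complex (projRes N).complex)
  property := by
    have := (projRes M).isStrictlyLE
    have := (projRes N).isStrictlyLE
    have := tensorComplex_isStrictlyLE (projRes M).complex (projRes N).complex
      (projRes M).bound (projRes N).bound
    exact ⟨(projRes M).bound + (projRes N).bound, inferInstance⟩

/-- The derived base change `K' ⊗ᴸ_K M` of an object of the bounded above derived category of
`B`-`A`-bimodules: it is represented by `K' ⊗_K P`, where `P` is a bounded above complex of
projective bimodules that represents `M`. (When `A` and `B` are flat over `K`, each `P^i` is flat
over `K`.) -/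
def derivedBaseChange (K' : Type u) [CommRing K'] [Algebra K K']
    (M : DerivedCategory.Minus (Bimod K B A)) :
    DerivedCategory.Minus (Bimod K' (K' ⊗[K] B) (K' ⊗[K] A)) where
  obj := DerivedCategory.Q.obj
    (((baseChangeFunctor K K' B A).mapHomologicalComplex (ComplexShape.up ℤ)).obj
      (projRes M).complex)
  property := by
    have := (projRes M).isStrictlyLE
    have : CochainComplex.IsStrictlyLE
        (((baseChangeFunctor K K' B A).mapHomologicalComplex (ComplexShape.up ℤ)).obj
          (projRes M).complex) (projRes M).bound := by
      rw [CochainComplex.isStrictlyLE_iff]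
      intro i hi
      exact (baseChangeFunctor K K' B A).map_isZero
        (CochainComplex.isZero_of_isStrictlyLE _ (projRes M).bound i hi)
    exact ⟨(projRes M).bound, inferInstance⟩

variable (K B A) in
/-- The bounded derived category of `B`-`A`-bimodules relative to `K`. -/
abbrev DBounded := DerivedCategory.Bounded (Bimod K B A)

/-- An object of the bounded derived category as an object of the bounded above one. -/
abbrev toMinus (T : DBounded K B A) : DerivedCategory.Minus (Bimod K B A) :=
  ⟨T.obj, T.property.2⟩

variable (K A) in
/-- `A`, as a complex of `A`-`A`-bimodules concentrated in degree `0`. -/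
def diagonalD : DBounded K A A where
  obj := (DerivedCategory.singleFunctor (Bimod K A A) 0).obj (diagonal K A)
  property := ⟨⟨0, inferInstance⟩, ⟨0, inferInstance⟩⟩

/-- `S` is an inverse of `T`: there are isomorphisms `S ⊗ᴸ_B T ≅ A` and `T ⊗ᴸ_A S ≅ B` in the
derived categories of `A`-`A`-bimodules and of `B`-`B`-bimodules. -/
structure IsInverse (T : DBounded K B A) (S : DBounded K A B) : Prop where
  inverse_tensor : Nonempty ((derivedTensor (toMinus S) (toMinus T)).obj ≅ (diagonalD K A).obj)
  tensor_inverse : Nonempty ((derivedTensor (toMinus T) (toMinus S)).obj ≅ (diagonalD K B).obj)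

/-- Two-sided tilting complexes over `B`-`A` relative to `K`, for flat `K`-algebras
`A` and `B`. -/
def IsTwoSidedTilting [Module.Flat K B] [Module.Flat K A] (T : DBounded K B A) : Prop :=
  ∃ S : DBounded K A B, IsInverse T S

end Tilting

end TwoSidedTilting
end

/-! Represent `T` and `S` by bounded above complexes `P` and `Q` of projective bimodules. Base
change is left adjoint to a restriction of scalars that preserves epimorphisms, so `P' = K' ⊗ P` and
`Q' = K' ⊗ Q` are again termwise projective. They represent `T'` and `S'` and can be used to compute
the derived tensor products of these.

Inverses. On bimodules, `K' ⊗ (M ⊗_A N) ≅ (K' ⊗ M) ⊗_{A'} (K' ⊗ N)`, hence `P' ⊗ Q' ≅ K' ⊗ (P ⊗ Q)`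
for total complexes. Both `P ⊗ Q` and `B` are bounded above with `K`-flat terms, and an isomorphism
between them in the derived category is a zigzag of quasi-isomorphisms out of a third complex of
this kind. Base change preserves quasi-isomorphisms between such complexes
(`quasiIso_bcComplex_map`), so `P' ⊗ Q' ≅ B'`; likewise `Q' ⊗ P' ≅ A'`. This is
`nonempty_Q_bc_tensorComplex_iso`.

Boundedness. `K'` may have infinite Tor-dimension over `K`, so boundedness of `T` alone says nothing
about `T'`. Invertibility does (`exists_exactAt_of_tensorComplex_iso`). Suppose `Q'` lives in
degrees `≤ q`, let `n < -q`, and let `g` be a morphism to `P'` from a projective `M` placed in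
degree `n`. Then `Q' ⊗ M` lives in negative degrees, whereas `Q' ⊗ P' ≅ A'` has cohomology only in
degree `0`; so `Q' ⊗ g` vanishes after truncation, which is a quasi-isomorphism. Tensoring with `P'`
and using `P' ⊗ Q' ≅ B'`, the map `g` vanishes on cohomology. As `M` and `g` are arbitrary, `P'` is
exact in degree `n`.

Both arguments rest on the fact that a bounded above complex of projective bimodules preserves
quasi-isomorphisms under tensor product. For a single projective bimodule, exactness follows by
retraction from `(B ⊗ Aᵐᵒᵖ) ⊗_A N ≅ B ⊗ N` and flatness of `B` (`exact_map_tensorFunctor_obj`). The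
passage to total complexes is `acyclic_mapBifunctor_right`. -/

noncomputable section

namespace TwoSidedTilting

/-! ### Acyclicity of total complexes -/

section Abstract

universe v₁ v₂ v₃ w₁ w₂ w₃

/-- Embed the cokernel of `S.f` in an injective object; factoring this embedding through `S.g`
forces the map from the cokernel to `S.X₃` to be a monomorphism. The criterion suits total
complexes, since a morphism out of a coproduct can be built component by component. -/
lemma exact_of_forall_injective {𝒟 : Type w₁} [Category.{v₁} 𝒟] [Abelian 𝒟] [EnoughInjectives 𝒟]
    (S : ShortComplex 𝒟)
    (h : ∀ (I : 𝒟) [Injective I] (φ : S.X₂ ⟶ I), S.f ≫ φ = 0 → ∃ ψ : S.X₃ ⟶ I, S.g ≫ ψ = φ) :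
    S.Exact := by
  rw [S.exact_iff_mono_cokernel_desc]
  obtain ⟨ψ, hψ⟩ := h (Injective.under (cokernel S.f)) (cokernel.π S.f ≫ Injective.ι _) (by simp)
  have : cokernel.desc S.f S.g S.zero ≫ ψ = Injective.ι (cokernel S.f) := by
    ext; simpa using hψ
  have : Mono (cokernel.desc S.f S.g S.zero ≫ ψ) := by rw [this]; infer_instance
  exact mono_of_mono _ ψ

/-- Descending recursion on `ℤ`: a family of elements, each of which is related to the next one,
can be built starting from an index above which a constant family is admissible. -/
lemma exists_family_of_descending {α : ℤ → Type*} (R : ∀ i, α i → α (i + 1) → Prop) (p : ℤ)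
    (z : ∀ i, α i) (hz : ∀ i, p ≤ i → R i (z i) (z (i + 1)))
    (step : ∀ i (x : α (i + 1)) (y : α (i + 1 + 1)), R (i + 1) x y → ∃ w : α i, R i w x) :
    ∃ x : ∀ i, α i, ∀ i, R i (x i) (x (i + 1)) := by
  classical
  -- Stage `k` consists of families that are correct from the index `p - k` upwards. The next stage
  -- changes only the entry at `p - k - 1`.
  let St (k : ℕ) := {x : ∀ i, α i // ∀ i, p - k ≤ i → R i (x i) (x (i + 1))}
  have next : ∀ k (x : St k), ∃ y : St (k + 1), ∀ i, p - k ≤ i → y.1 i = x.1 i := by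
    rintro k ⟨x, hx⟩
    obtain ⟨w, hw⟩ := step (p - k - 1) (x _) (x _) (hx (p - k - 1 + 1) (by lia))
    refine ⟨⟨Function.update x (p - k - 1) w, fun i hi ↦ ?_⟩, fun i hi ↦ ?_⟩
    · obtain rfl | hi' := eq_or_ne i (p - k - 1)
      · rw [Function.update_self, Function.update_of_ne (by lia)]
        exact hw
      · rw [Function.update_of_ne hi', Function.update_of_ne (by push_cast at hi; lia)]
        exact hx i (by push_cast at hi; lia)
    · exact Function.update_of_ne (by lia) _ _
  choose nx hnx using next
  let s : ∀ k, St k := fun k ↦ Nat.rec ⟨z, fun i hi ↦ hz i (by simpa using hi)⟩ nx k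
  have hs : ∀ k, s (k + 1) = nx k (s k) := fun _ ↦ rfl
  have stable : ∀ (m k : ℕ) (i : ℤ), p - k ≤ i → (s (k + m)).1 i = (s k).1 i := by
    intro m
    induction m with
    | zero => intros; rfl
    | succ m ih =>
      intro k i hi
      rw [← add_assoc, hs, hnx _ _ _ (by push_cast; lia), ih k i hi]
  -- The entry at `i` no longer changes from stage `(p - i).toNat` on, so the diagonal family is
  -- well behaved.
  refine ⟨fun i ↦ (s (p - i).toNat).1 i, fun i ↦ ?_⟩
  obtain ⟨m, hm⟩ : ∃ m, (p - i).toNat = (p - (i + 1)).toNat + m := ⟨_, (Nat.add_sub_of_le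
    (by lia)).symm⟩
  have := stable m (p - (i + 1)).toNat (i + 1) (by lia)
  rw [← hm] at this
  change R i _ ((s (p - (i + 1)).toNat).1 (i + 1))
  rw [← this]
  exact (s (p - i).toNat).2 i (by lia)

variable {C₁ : Type w₁} {C₂ : Type w₂} {D : Type w₃} [Category.{v₁} C₁] [Category.{v₂} C₂]
  [Category.{v₃} D] [Abelian C₁] [Abelian C₂] [Abelian D]
  (F : C₁ ⥤ C₂ ⥤ D) [F.Additive] [∀ X, (F.obj X).Additive]

open HomologicalComplex ComplexShape

lemma ι_mapBifunctor_d (X : CochainComplex C₁ ℤ) (Y : CochainComplex C₂ ℤ)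
    [CochainComplex.HasMapBifunctor X Y F] (i j n : ℤ) (h : i + j = n) (n' : ℤ) (hn : n + 1 = n') :
    ιMapBifunctor X Y F (up ℤ) i j n h ≫ (mapBifunctor X Y F (up ℤ)).d n n' =
      (F.map (X.d i (i + 1))).app (Y.X j) ≫ ιMapBifunctor X Y F (up ℤ) (i + 1) j n'
        (show i + 1 + j = n' by lia) +
      i.negOnePow • ((F.obj (X.X i)).map (Y.d j (j + 1)) ≫
        ιMapBifunctor X Y F (up ℤ) i (j + 1) n' (show i + (j + 1) = n' by lia)) := by
  rw [mapBifunctor.d_eq, Preadditive.comp_add, mapBifunctor.ι_D₁, mapBifunctor.ι_D₂,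
    mapBifunctor.d₁_eq X Y F (up ℤ) (i₁ := i) (i₁' := i + 1) rfl j n'
      (show i + 1 + j = n' by lia),
    mapBifunctor.d₂_eq X Y F (up ℤ) i (i₂ := j) (i₂' := j + 1) rfl n'
      (show i + (j + 1) = n' by lia)]
  congr 1
  exact one_smul _ _

variable [∀ (X : CochainComplex C₁ ℤ) (Y : CochainComplex C₂ ℤ),
  CochainComplex.HasMapBifunctor X Y F]

/-- The components of `ψ` are found by descending recursion on the column index `i`. Once `ψ` is
known on column `i + 1`, the equation on column `i` asks to extend a morphism along `F(X^i, d_Y)`.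
This is possible because `F(X^i, Y)` is exact and `I` is injective, provided that the morphism kills
the preceding differential. -/
lemma exists_extension_mapBifunctor (X : CochainComplex C₁ ℤ) (p : ℤ) [X.IsStrictlyLE p]
    (hX : ∀ (i : ℤ) (S : ShortComplex C₂), S.Exact → (S.map (F.obj (X.X i))).Exact)
    (Y : CochainComplex C₂ ℤ) (hY : Y.Acyclic) (n' n n'' : ℤ) (hn' : n' + 1 = n)
    (hn'' : n + 1 = n'') {I : D} [Injective I] (φ : (mapBifunctor X Y F (up ℤ)).X n ⟶ I)
    (hφ : (mapBifunctor X Y F (up ℤ)).d n' n ≫ φ = 0) :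
    ∃ ψ : (mapBifunctor X Y F (up ℤ)).X n'' ⟶ I, (mapBifunctor X Y F (up ℤ)).d n n'' ≫ ψ = φ := by
  have hφ' (i j j' : ℤ) (h : i + j = n') (hj : j + 1 = j') :
      (F.map (X.d i (i + 1))).app (Y.X j) ≫ ιMapBifunctor X Y F (up ℤ) (i + 1) j n
        (show i + 1 + j = n by lia) ≫ φ +
      i.negOnePow • ((F.obj (X.X i)).map (Y.d j j') ≫
        ιMapBifunctor X Y F (up ℤ) i j' n (show i + j' = n by lia) ≫ φ) = 0 := by
    subst hj
    have := ιMapBifunctor X Y F (up ℤ) i j n' h ≫= hφ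
    rw [← Category.assoc, ι_mapBifunctor_d F X Y i j n' h n hn'] at this
    simpa [Linear.units_smul_comp] using this
  -- The term at `i` collects the components on all `F(X^i, Y^j)` with `i + j = n''`. From `p + 1`
  -- on the columns vanish, so the zero family satisfies the relation.
  obtain ⟨ψ, hψ⟩ := exists_family_of_descending
    (α := fun i ↦ ∀ j, i + j = n'' → ((F.obj (X.X i)).obj (Y.X j) ⟶ I))
    (fun i x y ↦ ∀ j j' (h : i + j = n) (hj : j + 1 = j'),
      (F.map (X.d i (i + 1))).app (Y.X j) ≫ y j (by lia) +
        i.negOnePow • ((F.obj (X.X i)).map (Y.d j j') ≫ x j' (by lia)) =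
          ιMapBifunctor X Y F (up ℤ) i j n h ≫ φ) (p + 1) (fun _ _ _ ↦ 0)
    (fun i hi j j' h _ ↦
      (((F.map_isZero (X.isZero_of_isStrictlyLE p i (by lia))).obj _).eq_of_src _ _))
    (fun i x y hxy ↦ by
      have (j j' : ℤ) (h : i + j = n) (hj : j + 1 = j') :
          ∃ w : (F.obj (X.X i)).obj (Y.X j') ⟶ I,
          (F.map (X.d i (i + 1))).app (Y.X j) ≫ x j (by lia) +
            i.negOnePow • ((F.obj (X.X i)).map (Y.d j j') ≫ w) =
              ιMapBifunctor X Y F (up ℤ) i j n h ≫ φ := by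
        have hS := hX i _ ((exactAt_iff' _ (j - 1) j j' (by simp) (by simp [← hj])).1 (hY j))
        have h₁ := (F.map (X.d i (i + 1))).app (Y.X (j - 1)) ≫=
          hxy (j - 1) j (by lia) (by lia)
        have h₂ := hφ' i (j - 1) j (by lia) (by lia)
        have h₃ : (F.map (X.d i (i + 1))).app (Y.X (j - 1)) ≫
            (F.map (X.d (i + 1) (i + 1 + 1))).app (Y.X (j - 1)) = 0 := by
          rw [← NatTrans.comp_app, ← F.map_comp, X.d_comp_d, F.map_zero, zero_app]
        -- The obstruction vanishes: precompose the equation on column `i + 1` with the horizontal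
        -- differential, whose square is zero, and compare with the cocycle condition on `φ`. The
        -- signs of columns `i` and `i + 1` are opposite.
        have h₄ : (F.obj (X.X i)).map (Y.d (j - 1) j) ≫
            (i.negOnePow • (ιMapBifunctor X Y F (up ℤ) i j n h ≫ φ -
              (F.map (X.d i (i + 1))).app (Y.X j) ≫ x j (by lia))) = 0 := by
          rw [Preadditive.comp_add, reassoc_of% h₃, zero_comp, zero_add, Linear.comp_units_smul,
            ← NatTrans.naturality_assoc, Int.negOnePow_succ] at h₁
          rw [← h₁] at h₂
          rw [Linear.comp_units_smul, Preadditive.comp_sub, smul_sub, ← h₂]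
          simp only [NatTrans.naturality_assoc, Units.neg_smul]
          abel
        obtain ⟨w, hw⟩ : ∃ w, (F.obj (X.X i)).map (Y.d j j') ≫ w = _ :=
          ⟨_, hS.comp_descToInjective _ h₄⟩
        exact ⟨w, by rw [hw, smul_smul, Int.units_mul_self, one_smul, add_sub_cancel]⟩
      choose w hw using this
      refine ⟨fun j' h ↦ w (j' - 1) j' (by lia) (by lia), fun j j' h hj ↦ ?_⟩
      obtain rfl : j = j' - 1 := by lia
      exact hw (j' - 1) j' h hj)
  refine ⟨mapBifunctorDesc fun i j h ↦ ψ i j h, ?_⟩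
  apply mapBifunctor.hom_ext
  intro i j h
  rw [← Category.assoc, ι_mapBifunctor_d F X Y i j n h _ hn'']
  simpa [Linear.units_smul_comp] using hψ i j (j + 1) h rfl

/-- The recursion runs over the columns only, so a bound on `X` suffices and `Y` may be unbounded.
-/
lemma acyclic_mapBifunctor_right [EnoughInjectives D] (X : CochainComplex C₁ ℤ) (p : ℤ)
    [X.IsStrictlyLE p]
    (hX : ∀ (i : ℤ) (S : ShortComplex C₂), S.Exact → (S.map (F.obj (X.X i))).Exact)
    (Y : CochainComplex C₂ ℤ) (hY : Y.Acyclic) :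
    (mapBifunctor X Y F (up ℤ)).Acyclic := by
  intro n
  rw [exactAt_iff' _ (n - 1) n (n + 1) (by simp) (by simp)]
  exact exact_of_forall_injective _ fun I _ φ hφ ↦
    exists_extension_mapBifunctor F X p hX Y hY _ _ _ (by lia) rfl φ hφ

end Abstract

/-! ### Functors on complexes that preserve quasi-isomorphisms -/

section QuasiIso

universe v₁ v₂ v₃ w₁ w₂ w₃
open HomologicalComplex ComplexShape

variable {C : Type w₁} {D : Type w₂} [Category.{v₁} C] [Category.{v₂} D] [Abelian C] [Abelian D]

/-- Quasi-isomorphisms are the maps whose cone in the homotopy category lies in the subcategory of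
acyclic complexes. -/
lemma quasiIso_iff_acyclic_mappingCone {K L : CochainComplex C ℤ} (f : K ⟶ L) :
    QuasiIso f ↔ (CochainComplex.mappingCone f).Acyclic := by
  rw [← HomotopyCategory.quotient_obj_mem_subcategoryAcyclic_iff_acyclic,
    ← mem_quasiIso_iff, ← HomotopyCategory.quotient_map_mem_quasiIso_iff,
    HomotopyCategory.quasiIso_eq_trW_subcategoryAcyclic]
  exact ObjectProperty.trW_iff_of_distinguished _ _
    (HomotopyCategory.mappingCone_triangleh_distinguished f)

lemma quasiIso_of_shortExact {S : ShortComplex (CochainComplex C ℤ)} (hS : S.ShortExact)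
    (h : S.X₃.Acyclic) : QuasiIso S.f where
  quasiIsoAt n := by
    rw [quasiIsoAt_iff_isIso_homologyMap]
    have h₃ (i : ℤ) : IsZero (S.X₃.homology i) := by
      rw [← exactAt_iff_isZero_homology]
      exact h i
    have : Mono (homologyMap S.f n) :=
      (hS.homology_exact₁ (n - 1) n (by simp)).mono_g ((h₃ _).eq_of_src _ _)
    have : Epi (homologyMap S.f n) := (hS.homology_exact₂ n).epi_f ((h₃ _).eq_of_tgt _ _)
    exact isIso_of_mono_of_epi _

lemma shortExact_of_splitting {S : ShortComplex (CochainComplex C ℤ)}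
    (hS : ∀ n, Nonempty (S.map (eval C (up ℤ) n)).Splitting) : S.ShortExact :=
  shortExact_of_degreewise_shortExact _ fun n ↦ (hS n).some.shortExact

/-- Factor `f` as `K ⟶ L ⊞ N ⟶ L`, where `N` is the cone of the identity of `K`. The first map is a
degreewise split monomorphism with acyclic cokernel, and the second has the section `L ⟶ L ⊞ N` of
the same type. This avoids comparing `G` of a mapping cone with the mapping cone of `G.map f`. -/
lemma quasiIso_map_of_preserves_acyclic (G : CochainComplex C ℤ ⥤ CochainComplex D ℤ)
    [G.Additive] (hA : ∀ K, K.Acyclic → (G.obj K).Acyclic)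
    (hG : ∀ S : ShortComplex (CochainComplex C ℤ),
      (∀ n, Nonempty (S.map (eval C (up ℤ) n)).Splitting) →
        ∀ n, Nonempty ((S.map G).map (eval D (up ℤ) n)).Splitting)
    {K L : CochainComplex C ℤ} (f : K ⟶ L) (hf : QuasiIso f) : QuasiIso (G.map f) := by
  have key (S : ShortComplex (CochainComplex C ℤ))
      (hS : ∀ n, Nonempty (S.map (eval C (up ℤ) n)).Splitting) (h : S.X₃.Acyclic) :
      QuasiIso (G.map S.f) :=
    quasiIso_of_shortExact (S := S.map G) (shortExact_of_splitting (hG S hS)) (hA _ h)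
  let N := CochainComplex.mappingCone (𝟙 K)
  have hN : N.Acyclic := (quasiIso_iff_acyclic_mappingCone (𝟙 K)).1 inferInstance
  let T : ShortComplex (CochainComplex C ℤ) :=
    ShortComplex.mk (biprod.inl : L ⟶ L ⊞ N) biprod.snd (by simp)
  have hT : ∀ n, Nonempty (T.map (eval C (up ℤ) n)).Splitting := fun n ↦
    ⟨(ShortComplex.Splitting.ofHasBinaryBiproduct L N).map (eval C (up ℤ) n)⟩
  have h_inl : QuasiIso (biprod.inl : L ⟶ L ⊞ N) :=
    quasiIso_of_shortExact (S := T) (shortExact_of_splitting hT) hN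
  have h_inl' : QuasiIso (G.map (biprod.inl : L ⟶ L ⊞ N)) := key T hT hN
  have h_fst : QuasiIso (biprod.fst : L ⊞ N ⟶ L) := by
    have : QuasiIso ((biprod.inl : L ⟶ L ⊞ N) ≫ biprod.fst) := by
      rw [biprod.inl_fst]; infer_instance
    exact quasiIso_of_comp_left biprod.inl biprod.fst
  have h_fst' : QuasiIso (G.map (biprod.fst : L ⊞ N ⟶ L)) := by
    have : QuasiIso (G.map (biprod.inl : L ⟶ L ⊞ N) ≫ G.map biprod.fst) := by
      rw [← G.map_comp, biprod.inl_fst, G.map_id]; infer_instance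
    exact quasiIso_of_comp_left (G.map biprod.inl) _
  let i : K ⟶ L ⊞ N := biprod.lift f (CochainComplex.mappingCone.inr (𝟙 K))
  have fac : i ≫ biprod.fst = f := by simp [i]
  have hi : QuasiIso i := by
    have : QuasiIso (i ≫ biprod.fst) := by rwa [fac]
    exact quasiIso_of_comp_right i biprod.fst
  -- In each degree `N` is a sum with `K.X n` as a summand, embedded by `inr`. The projection `snd`
  -- onto it retracts `i` degreewise, although it is not a map of complexes.
  let r (n : ℤ) : (L ⊞ N).X n ⟶ K.X n :=
    (biprod.snd : L ⊞ N ⟶ N).f n ≫ (CochainComplex.mappingCone.snd (𝟙 K)).v n n (add_zero n)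
  have hr (n : ℤ) : i.f n ≫ r n = 𝟙 _ := by
    rw [← Category.assoc, ← comp_f, biprod.lift_snd]
    exact CochainComplex.mappingCone.inr_f_snd_v _ _
  have : Mono i := by
    have (n : ℤ) : Mono (i.f n) := mono_of_mono_fac (hr n)
    exact mono_of_mono_f i this
  let S : ShortComplex (CochainComplex C ℤ) := ShortComplex.mk i (cokernel.π i) (by simp)
  have hS : S.ShortExact := { exact := S.exact_of_g_is_cokernel (cokernelIsCokernel i) }
  have hS' : ∀ n, Nonempty (S.map (eval C (up ℤ) n)).Splitting := fun n ↦ by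
    have := hS.map_of_exact (eval C (up ℤ) n)
    exact ⟨ShortComplex.Splitting.ofExactOfRetraction _ this.exact (r n) (hr n) this.epi_g⟩
  have : QuasiIso (G.map i) := key S hS' (hS.acyclic_X₃ hi)
  rw [← fac, G.map_comp]
  infer_instance

end QuasiIso

/-! ### Total complexes and quasi-isomorphisms in each variable -/

section Tensor

universe v₁ v₂ v₃ w₁ w₂ w₃
open HomologicalComplex ComplexShape

variable {C₁ : Type w₁} {C₂ : Type w₂} {D : Type w₃} [Category.{v₁} C₁] [Category.{v₂} C₂]
  [Category.{v₃} D] [Abelian C₁] [Abelian C₂] [Abelian D]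
  (F : C₁ ⥤ C₂ ⥤ D) [F.Additive] [∀ X, (F.obj X).Additive]
  [∀ (X : CochainComplex C₁ ℤ) (Y : CochainComplex C₂ ℤ), CochainComplex.HasMapBifunctor X Y F]

/-- The map in degree `n` of the total complexes that is induced by a family of morphisms, in the
second variable, which need not commute with the differentials. -/
def mapBifunctorGraded (X : CochainComplex C₁ ℤ) {Y Y' : CochainComplex C₂ ℤ}
    (r : ∀ j, Y.X j ⟶ Y'.X j) (n : ℤ) :
    (mapBifunctor X Y F (up ℤ)).X n ⟶ (mapBifunctor X Y' F (up ℤ)).X n :=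
  mapBifunctorDesc fun i j h ↦ (F.obj (X.X i)).map (r j) ≫ ιMapBifunctor X Y' F (up ℤ) i j n h

lemma mapBifunctorMap_f_eq_graded (X : CochainComplex C₁ ℤ) {Y Y' : CochainComplex C₂ ℤ}
    (g : Y ⟶ Y') (n : ℤ) :
    (mapBifunctorMap (𝟙 X) g F (up ℤ)).f n = mapBifunctorGraded F X g.f n := by
  apply mapBifunctor.hom_ext
  intro i j h
  simp [mapBifunctorGraded]

lemma mapBifunctorGraded_comp (X : CochainComplex C₁ ℤ) {Y Y' Y'' : CochainComplex C₂ ℤ}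
    (r : ∀ j, Y.X j ⟶ Y'.X j) (s : ∀ j, Y'.X j ⟶ Y''.X j) (n : ℤ) :
    mapBifunctorGraded F X r n ≫ mapBifunctorGraded F X s n =
      mapBifunctorGraded F X (fun j ↦ r j ≫ s j) n := by
  apply mapBifunctor.hom_ext
  intro i j h
  simp [mapBifunctorGraded]

lemma mapBifunctorGraded_add (X : CochainComplex C₁ ℤ) {Y Y' : CochainComplex C₂ ℤ}
    (r s : ∀ j, Y.X j ⟶ Y'.X j) (n : ℤ) :
    mapBifunctorGraded F X (fun j ↦ r j + s j) n =
      mapBifunctorGraded F X r n + mapBifunctorGraded F X s n := by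
  apply mapBifunctor.hom_ext
  intro i j h
  simp [mapBifunctorGraded, Functor.map_add]

lemma mapBifunctorGraded_id (X : CochainComplex C₁ ℤ) (Y : CochainComplex C₂ ℤ) (n : ℤ) :
    mapBifunctorGraded F X (fun j ↦ 𝟙 (Y.X j)) n = 𝟙 _ := by
  apply mapBifunctor.hom_ext
  intro i j h
  simp [mapBifunctorGraded]

/-- The functor `F(X, -)` preserves acyclic complexes by `acyclic_mapBifunctor_right`. It also
preserves degreewise splittings: the splitting maps need not commute with differentials, but
`mapBifunctorGraded` is functorial and additive in such families. -/
lemma quasiIso_mapBifunctorMap_right [EnoughInjectives D] (X : CochainComplex C₁ ℤ) (p : ℤ) [X.IsStrictlyLE p]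
    (hX : ∀ (i : ℤ) (S : ShortComplex C₂), S.Exact → (S.map (F.obj (X.X i))).Exact)
    {Y Y' : CochainComplex C₂ ℤ} (g : Y ⟶ Y') (hg : QuasiIso g) :
    QuasiIso (mapBifunctorMap (𝟙 X) g F (up ℤ)) := by
  have : (F.map₂CochainComplex.obj X).Additive := ⟨fun {Y Y' f g} ↦ by
    ext n
    change (mapBifunctorMap (𝟙 X) (f + g) F (up ℤ)).f n =
      (mapBifunctorMap (𝟙 X) f F (up ℤ)).f n + (mapBifunctorMap (𝟙 X) g F (up ℤ)).f n
    simp only [mapBifunctorMap_f_eq_graded]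
    exact mapBifunctorGraded_add F X f.f g.f n⟩
  refine quasiIso_map_of_preserves_acyclic (F.map₂CochainComplex.obj X)
    (acyclic_mapBifunctor_right F X p hX) (fun S hS n ↦ ⟨?_⟩) g hg
  let r (j : ℤ) : S.X₂.X j ⟶ S.X₁.X j := (hS j).some.r
  let s (j : ℤ) : S.X₃.X j ⟶ S.X₂.X j := (hS j).some.s
  have h₁ : (fun j ↦ S.f.f j ≫ r j) = fun j ↦ 𝟙 _ := funext fun j ↦ (hS j).some.f_r
  have h₂ : (fun j ↦ s j ≫ S.g.f j) = fun j ↦ 𝟙 _ := funext fun j ↦ (hS j).some.s_g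
  have h₃ : (fun j ↦ r j ≫ S.f.f j + S.g.f j ≫ s j) = fun j ↦ 𝟙 _ :=
    funext fun j ↦ (hS j).some.id
  refine
    { r := mapBifunctorGraded F X r n
      s := mapBifunctorGraded F X s n
      f_r := ?_
      s_g := ?_
      id := ?_ }
  · change (mapBifunctorMap (𝟙 X) S.f F (up ℤ)).f n ≫ mapBifunctorGraded F X r n = 𝟙 _
    rw [mapBifunctorMap_f_eq_graded, mapBifunctorGraded_comp, h₁, mapBifunctorGraded_id]
  · change mapBifunctorGraded F X s n ≫ (mapBifunctorMap (𝟙 X) S.g F (up ℤ)).f n = 𝟙 _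
    rw [mapBifunctorMap_f_eq_graded, mapBifunctorGraded_comp, h₂, mapBifunctorGraded_id]
  · change mapBifunctorGraded F X r n ≫ (mapBifunctorMap (𝟙 X) S.f F (up ℤ)).f n +
      (mapBifunctorMap (𝟙 X) S.g F (up ℤ)).f n ≫ mapBifunctorGraded F X s n = 𝟙 _
    rw [mapBifunctorMap_f_eq_graded, mapBifunctorMap_f_eq_graded, mapBifunctorGraded_comp,
      mapBifunctorGraded_comp, ← mapBifunctorGraded_add, h₃, mapBifunctorGraded_id]

/-- The symmetry of total complexes reduces this to `quasiIso_mapBifunctorMap_right` for `F.flip`.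
-/
lemma quasiIso_mapBifunctorMap_left [EnoughInjectives D] {X X' : CochainComplex C₁ ℤ}
    (f : X ⟶ X') (hf : QuasiIso f) (Y : CochainComplex C₂ ℤ) (p : ℤ) [Y.IsStrictlyLE p]
    (hY : ∀ (i : ℤ) (S : ShortComplex C₁), S.Exact → (S.map (F.flip.obj (Y.X i))).Exact) :
    QuasiIso (mapBifunctorMap f (𝟙 Y) F (up ℤ)) := by
  have : ∀ (Y : CochainComplex C₂ ℤ) (X : CochainComplex C₁ ℤ),
    CochainComplex.HasMapBifunctor Y X F.flip := fun _ _ ↦ inferInstance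
  have : F.flip.Additive := ⟨fun {Y Y' f g} ↦ by ext X; exact (F.obj X).map_add⟩
  have (Y : C₂) : (F.flip.obj Y).Additive := ⟨fun {X X' f g} ↦ by
    exact congr_app F.map_add Y⟩
  have h := quasiIso_mapBifunctorMap_right F.flip Y p hY f hf
  refine quasiIso_of_arrow_mk_iso _ _ (Arrow.isoMk (mapBifunctorFlipIso X Y F (up ℤ))
    (mapBifunctorFlipIso X' Y F (up ℤ)) ?_) (hφ := h)
  exact (mapBifunctorFlipIso_hom_naturality f (𝟙 Y) F (up ℤ)).symm

end Tensor

/-! ### Derived isomorphisms as zigzags, and vanishing in homology -/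

section Zigzag

universe v w
variable {𝒞 : Type w} [Category.{v} 𝒞] [Abelian 𝒞]

/-- Write `e` as a right fraction whose middle term is bounded above by `n`. Since `e` is
invertible, both legs are quasi-isomorphisms, and a projective resolution of the middle term gives
`R`. -/
lemma exists_projective_zigzag [HasDerivedCategory 𝒞] [EnoughProjectives 𝒞]
    {X Y : CochainComplex 𝒞 ℤ} (n : ℤ) [X.IsStrictlyLE n]
    (e : DerivedCategory.Q.obj X ≅ DerivedCategory.Q.obj Y) :
    ∃ (R : CochainComplex 𝒞 ℤ) (r : R ⟶ X) (s : R ⟶ Y), QuasiIso r ∧ QuasiIso s ∧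
      (∀ i, Projective (R.X i)) ∧ R.IsStrictlyLE n := by
  obtain ⟨Z, _, s, _, g, fac⟩ := DerivedCategory.right_fac_of_isStrictlyLE e.hom n
  have hg : DerivedCategory.Q.map g = DerivedCategory.Q.map s ≫ e.hom := by simp [fac]
  have : IsIso (DerivedCategory.Q.map g) := by rw [hg]; infer_instance
  have : QuasiIso s := (DerivedCategory.isIso_Q_map_iff_quasiIso 𝒞 s).1 inferInstance
  have : QuasiIso g := (DerivedCategory.isIso_Q_map_iff_quasiIso 𝒞 g).1 inferInstance
  obtain ⟨R, f, hf, hR, hR'⟩ := exists_projective_resolution Z n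
  exact ⟨R, f ≫ s, f ≫ g, inferInstance, inferInstance, hR, hR'⟩

lemma nonempty_Q_iso_of_zigzag [HasDerivedCategory 𝒞] {R X Y : CochainComplex 𝒞 ℤ} (r : R ⟶ X)
    (s : R ⟶ Y) (hr : QuasiIso r) (hs : QuasiIso s) :
    Nonempty (DerivedCategory.Q.obj X ≅ DerivedCategory.Q.obj Y) :=
  ⟨(asIso (DerivedCategory.Q.map r)).symm ≪≫ asIso (DerivedCategory.Q.map s)⟩

open HomologicalComplex in
lemma homologyMap_eq_zero_of_comm_right {X X' Y Y' : CochainComplex 𝒞 ℤ} {f : X ⟶ Y}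
    {f' : X' ⟶ Y'} (a : X ⟶ X') (b : Y ⟶ Y') (ha : QuasiIso a) (h : a ≫ f' = f ≫ b) (n : ℤ)
    (hf : homologyMap f n = 0) : homologyMap f' n = 0 := by
  rw [← cancel_epi (homologyMap a n), ← homologyMap_comp, h, homologyMap_comp, hf, zero_comp,
    comp_zero]

open HomologicalComplex in
lemma homologyMap_eq_zero_of_comm_left {X X' Y Y' : CochainComplex 𝒞 ℤ} {f : X ⟶ Y}
    {f' : X' ⟶ Y'} (a : X ⟶ X') (b : Y ⟶ Y') (hb : QuasiIso b) (h : a ≫ f' = f ≫ b) (n : ℤ)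
    (hf : homologyMap f' n = 0) : homologyMap f n = 0 := by
  rw [← cancel_mono (homologyMap b n), ← homologyMap_comp, ← h, homologyMap_comp, hf, zero_comp,
    comp_zero]

open HomologicalComplex in
/-- Homology in degree `n` is detected by maps from complexes of projectives concentrated in
degree `n`. -/
lemma exactAt_of_projective_test [EnoughProjectives 𝒞] (P : CochainComplex 𝒞 ℤ) (n : ℤ)
    (h : ∀ (M : 𝒞) [Projective M] (g : (single 𝒞 (ComplexShape.up ℤ) n).obj M ⟶ P),
      homologyMap g n = 0) : P.ExactAt n := by
  -- Test with a projective that surjects onto the cycles. Vanishing of the induced map on homology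
  -- says that the composite epimorphism onto the homology of `P` is zero.
  let g := mkHomFromSingle (c := ComplexShape.up ℤ) (j := n) (K := P)
    (Projective.π (P.cycles n) ≫ P.iCycles n) (fun k hk ↦ by simp)
  have hg := h _ g
  have h₁ : Projective.π (P.cycles n) ≫ P.homologyπ n = 0 := by
    have : (singleObjCyclesSelfIso (ComplexShape.up ℤ) n _).inv ≫ cyclesMap g n =
        Projective.π (P.cycles n) := by
      rw [← cancel_mono (P.iCycles n)]
      simp [g]
    rw [← this, Category.assoc, ← homologyπ_naturality, hg]
    simp
  rw [exactAt_iff_isZero_homology, IsZero.iff_id_eq_zero, ← cancel_epi (P.homologyπ n),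
    ← cancel_epi (Projective.π (P.cycles n))]
  simp [h₁]

end Zigzag

/-! ### The unit and the associativity of total complexes -/

section Total

universe v₁ v₂ v₃ v₄ v₅ v₆ w₁ w₂ w₃ w₄ w₅ w₆
open HomologicalComplex ComplexShape

section Single

variable {C₁ : Type w₁} {C₂ : Type w₂} {D : Type w₃} [Category.{v₁} C₁] [Category.{v₂} C₂]
  [Category.{v₃} D] [Abelian C₁] [Abelian C₂] [Abelian D]
  (F : C₁ ⥤ C₂ ⥤ D) [F.Additive] [∀ X, (F.obj X).Additive]
  [∀ (X : CochainComplex C₁ ℤ) (Y : CochainComplex C₂ ℤ), CochainComplex.HasMapBifunctor X Y F]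

/-- The inclusion of `F(A, Yⁿ)` in the total complex of `F(A[0], Y)` in degree `n`. -/
def ιMapBifunctorSingle (A : C₁) (Y : CochainComplex C₂ ℤ) (n : ℤ) : (F.obj A).obj (Y.X n) ⟶
      (mapBifunctor ((single C₁ (up ℤ) 0).obj A) Y F (up ℤ)).X n :=
  (F.map (singleObjXSelf (up ℤ) 0 A).inv).app (Y.X n) ≫
    ιMapBifunctor _ Y F (up ℤ) 0 n n (zero_add n)

lemma ιMapBifunctorSingle_d (A : C₁) (Y : CochainComplex C₂ ℤ) (n n' : ℤ) (hn : n + 1 = n') :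
    ιMapBifunctorSingle F A Y n ≫ (mapBifunctor ((single C₁ (up ℤ) 0).obj A) Y F (up ℤ)).d n n' =
      (F.obj A).map (Y.d n n') ≫ ιMapBifunctorSingle F A Y n' := by
  subst hn
  rw [ιMapBifunctorSingle, Category.assoc, ι_mapBifunctor_d F _ Y 0 n n (zero_add n) _ rfl]
  simp [ιMapBifunctorSingle]

lemma isIso_ιMapBifunctorSingle (A : C₁) (Y : CochainComplex C₂ ℤ) (n : ℤ) :
    IsIso (ιMapBifunctorSingle F A Y n) := by
  let π : (mapBifunctor ((single C₁ (up ℤ) 0).obj A) Y F (up ℤ)).X n ⟶ (F.obj A).obj (Y.X n) :=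
    mapBifunctorDesc fun i j h ↦ if hi : i = 0 then
      (F.map (singleObjXIsoOfEq (up ℤ) 0 A i hi).hom).app (Y.X j) ≫
        (F.obj A).map (Y.XIsoOfEq (show j = n by change i + j = n at h; lia)).hom else 0
  have h_id (j : ℤ) : (F.obj A).map (Y.XIsoOfEq (rfl : j = j)).hom = 𝟙 _ := by
    rw [XIsoOfEq_rfl]
    exact (F.obj A).map_id _
  refine ⟨π, ?_, ?_⟩
  · rw [ιMapBifunctorSingle, Category.assoc, ι_mapBifunctorDesc, dif_pos rfl]
    rw [h_id, Category.comp_id]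
    change (F.map _).app _ ≫ (F.map (singleObjXSelf (up ℤ) 0 A).hom).app _ = _
    rw [← NatTrans.comp_app, ← F.map_comp]
    simp
  · apply mapBifunctor.hom_ext
    intro i j h
    rw [Category.comp_id, ι_mapBifunctorDesc_assoc]
    by_cases hi : i = 0
    · subst hi
      obtain rfl : j = n := by change 0 + j = n at h; lia
      rw [dif_pos rfl]
      rw [h_id, Category.comp_id, ιMapBifunctorSingle]
      change (F.map (singleObjXSelf (up ℤ) 0 A).hom).app _ ≫ _ = _
      rw [← NatTrans.comp_app_assoc, ← F.map_comp]
      simp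
    · exact ((F.map_isZero (isZero_single_obj_X (up ℤ) 0 A i hi)).obj _).eq_of_src _ _

/-- The complex `F(A, Y)` identifies to the total complex of `F(A[0], Y)`. -/
def mapBifunctorSingleIso (A : C₁) (Y : CochainComplex C₂ ℤ) :
    ((F.obj A).mapHomologicalComplex (up ℤ)).obj Y ≅
      mapBifunctor ((single C₁ (up ℤ) 0).obj A) Y F (up ℤ) :=
  Hom.isoOfComponents
    (fun n ↦ @asIso _ _ _ _ (ιMapBifunctorSingle F A Y n) (isIso_ιMapBifunctorSingle F A Y n))
    (fun n n' hn ↦ ιMapBifunctorSingle_d F A Y n n' hn)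

lemma mapBifunctorSingleIso_hom_naturality (A : C₁) {Y Y' : CochainComplex C₂ ℤ} (g : Y ⟶ Y') :
    (mapBifunctorSingleIso F A Y).hom ≫ mapBifunctorMap (𝟙 _) g F (up ℤ) =
      ((F.obj A).mapHomologicalComplex (up ℤ)).map g ≫ (mapBifunctorSingleIso F A Y').hom := by
  ext n
  change ιMapBifunctorSingle F A Y n ≫ (mapBifunctorMap (𝟙 _) g F (up ℤ)).f n =
    (F.obj A).map (g.f n) ≫ ιMapBifunctorSingle F A Y' n
  simp [ιMapBifunctorSingle]

end Single

section Assoc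

variable {C₁ : Type w₁} {C₂ : Type w₂} {C₃ : Type w₃} {C₁₂ : Type w₄} {C₂₃ : Type w₅}
  {C₄ : Type w₆} [Category.{v₁} C₁] [Category.{v₂} C₂] [Category.{v₃} C₃] [Category.{v₄} C₁₂]
  [Category.{v₅} C₂₃] [Category.{v₆} C₄] [HasZeroMorphisms C₁] [HasZeroMorphisms C₂]
  [HasZeroMorphisms C₃] [Preadditive C₁₂] [Preadditive C₂₃] [Preadditive C₄]
  {F₁₂ : C₁ ⥤ C₂ ⥤ C₁₂} {G : C₁₂ ⥤ C₃ ⥤ C₄} {F : C₁ ⥤ C₂₃ ⥤ C₄} {G₂₃ : C₂ ⥤ C₃ ⥤ C₂₃}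
  [F₁₂.PreservesZeroMorphisms] [∀ (X₁ : C₁), (F₁₂.obj X₁).PreservesZeroMorphisms]
  [G.Additive] [∀ (X₁₂ : C₁₂), (G.obj X₁₂).PreservesZeroMorphisms]
  [G₂₃.PreservesZeroMorphisms] [∀ (X₂ : C₂), (G₂₃.obj X₂).PreservesZeroMorphisms]
  [F.PreservesZeroMorphisms] [∀ (X₁ : C₁), (F.obj X₁).Additive]
  (associator : bifunctorComp₁₂ F₁₂ G ≅ bifunctorComp₂₃ F G₂₃)
  (K₁ : CochainComplex C₁ ℤ) (K₂ : CochainComplex C₂ ℤ) {K₃ L₃ : CochainComplex C₃ ℤ}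
  (g : K₃ ⟶ L₃)
  [HasMapBifunctor K₁ K₂ F₁₂ (up ℤ)] [HasMapBifunctor K₂ K₃ G₂₃ (up ℤ)]
  [HasMapBifunctor K₂ L₃ G₂₃ (up ℤ)]
  [HasMapBifunctor (mapBifunctor K₁ K₂ F₁₂ (up ℤ)) K₃ G (up ℤ)]
  [HasMapBifunctor K₁ (mapBifunctor K₂ K₃ G₂₃ (up ℤ)) F (up ℤ)]
  [HasMapBifunctor (mapBifunctor K₁ K₂ F₁₂ (up ℤ)) L₃ G (up ℤ)]
  [HasMapBifunctor K₁ (mapBifunctor K₂ L₃ G₂₃ (up ℤ)) F (up ℤ)]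
  [HasGoodTrifunctor₁₂Obj F₁₂ G K₁ K₂ K₃ (up ℤ) (up ℤ)]
  [HasGoodTrifunctor₂₃Obj F G₂₃ K₁ K₂ K₃ (up ℤ) (up ℤ) (up ℤ)]
  [HasGoodTrifunctor₁₂Obj F₁₂ G K₁ K₂ L₃ (up ℤ) (up ℤ)]
  [HasGoodTrifunctor₂₃Obj F G₂₃ K₁ K₂ L₃ (up ℤ) (up ℤ) (up ℤ)]

/-- Both composites agree on each summand of tridegree `(i₁, i₂, i₃)` by naturality of `associator`.
This transfers vanishing in homology between the two bracketings of a triple tensor product. -/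
lemma mapBifunctorAssociator_hom_naturality :
    mapBifunctorMap (𝟙 (mapBifunctor K₁ K₂ F₁₂ (up ℤ))) g G (up ℤ) ≫
      (mapBifunctorAssociator associator K₁ K₂ L₃ (up ℤ) (up ℤ) (up ℤ)).hom =
    (mapBifunctorAssociator associator K₁ K₂ K₃ (up ℤ) (up ℤ) (up ℤ)).hom ≫
      mapBifunctorMap (𝟙 K₁) (mapBifunctorMap (𝟙 K₂) g G₂₃ (up ℤ)) F (up ℤ) := by
  ext n : 1
  apply mapBifunctor₁₂.hom_ext
  intro i₁ i₂ i₃ h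
  change _ ≫ (mapBifunctorMap (𝟙 (mapBifunctor K₁ K₂ F₁₂ (up ℤ))) g G (up ℤ)).f n ≫
    (mapBifunctorAssociatorX associator K₁ K₂ L₃ (up ℤ) (up ℤ) (up ℤ) n).hom =
    _ ≫ (mapBifunctorAssociatorX associator K₁ K₂ K₃ (up ℤ) (up ℤ) (up ℤ) n).hom ≫
      (mapBifunctorMap (𝟙 K₁) (mapBifunctorMap (𝟙 K₂) g G₂₃ (up ℤ)) F (up ℤ)).f n
  rw [ι_mapBifunctorAssociatorX_hom_assoc]
  have h₁ : mapBifunctor₁₂.ι F₁₂ G K₁ K₂ K₃ (up ℤ) (up ℤ) i₁ i₂ i₃ n h ≫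
      (mapBifunctorMap (𝟙 (mapBifunctor K₁ K₂ F₁₂ (up ℤ))) g G (up ℤ)).f n =
      (G.obj ((F₁₂.obj (K₁.X i₁)).obj (K₂.X i₂))).map (g.f i₃) ≫
        mapBifunctor₁₂.ι F₁₂ G K₁ K₂ L₃ (up ℤ) (up ℤ) i₁ i₂ i₃ n h := by
    rw [mapBifunctor₁₂.ι_eq F₁₂ G K₁ K₂ K₃ (up ℤ) (up ℤ) i₁ i₂ i₃ (i₁ + i₂) n rfl h,
      mapBifunctor₁₂.ι_eq F₁₂ G K₁ K₂ L₃ (up ℤ) (up ℤ) i₁ i₂ i₃ (i₁ + i₂) n rfl h, Category.assoc]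
    erw [ι_mapBifunctorMap]
    simp
  have h' : i₁ + (i₂ + i₃) = n := by
    change i₁ + i₂ + i₃ = n at h
    lia
  have h₂ : mapBifunctor₂₃.ι F G₂₃ K₁ K₂ K₃ (up ℤ) (up ℤ) (up ℤ) i₁ i₂ i₃ n h ≫
      (mapBifunctorMap (𝟙 K₁) (mapBifunctorMap (𝟙 K₂) g G₂₃ (up ℤ)) F (up ℤ)).f n =
      (F.obj (K₁.X i₁)).map ((G₂₃.obj (K₂.X i₂)).map (g.f i₃)) ≫
        mapBifunctor₂₃.ι F G₂₃ K₁ K₂ L₃ (up ℤ) (up ℤ) (up ℤ) i₁ i₂ i₃ n h := by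
    rw [mapBifunctor₂₃.ι_eq F G₂₃ K₁ K₂ K₃ (up ℤ) (up ℤ) (up ℤ) i₁ i₂ i₃ (i₂ + i₃) n rfl h',
      mapBifunctor₂₃.ι_eq F G₂₃ K₁ K₂ L₃ (up ℤ) (up ℤ) (up ℤ) i₁ i₂ i₃ (i₂ + i₃) n rfl h']
    rw [Category.assoc]
    erw [ι_mapBifunctorMap]
    simp only [id_f, CategoryTheory.Functor.map_id, NatTrans.id_app, Category.id_comp]
    rw [← Functor.map_comp_assoc, ← Functor.map_comp_assoc, ι_mapBifunctorMap]
    simp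
  rw [reassoc_of% h₁]
  erw [h₂]
  rw [ι_mapBifunctorAssociatorX_hom]
  exact ((associator.hom.app (K₁.X i₁)).app (K₂.X i₂)).naturality_assoc (g.f i₃) _

end Assoc

end Total

/-! ### Calculus of pure tensors over a noncommutative ring -/

section BimoduleTensor

variable {K B A C : Type u} [CommRing K] [Ring B] [Algebra K B] [Ring A] [Algebra K A]
  [Ring C] [Algebra K C]

/-- The tensor product `M ⊗_A N` as a bimodule. -/
abbrev tensorObj (M : Bimod K B A) (N : Bimod K A C) : Bimod K B C :=
  ((tensorFunctor K B A C).obj M).obj N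

/-- The pure tensor `m ⊗ n` in `M ⊗_A N`. -/
def tm {M : Bimod K B A} {N : Bimod K A C} (m : M) (n : N) : tensorObj M N :=
  BimodTensor.proj K B A C M N (m ⊗ₜ[K] n)

lemma kModule_smul_eq_left {M : Bimod K B A} (k : K) (m : M) :
    k • m = (algebraMap K B k ⊗ₜ[K] (1 : Aᵐᵒᵖ)) • m := by
  rw [← algebraMap_smul (B ⊗[K] Aᵐᵒᵖ) k m, Algebra.TensorProduct.algebraMap_apply]

lemma kModule_smul_eq_right {M : Bimod K B A} (k : K) (m : M) :
    k • m = ((1 : B) ⊗ₜ[K] MulOpposite.op (algebraMap K A k)) • m := by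
  rw [← algebraMap_smul (B ⊗[K] Aᵐᵒᵖ) k m, Algebra.TensorProduct.algebraMap_apply']
  rfl

/-- An additive map that commutes with the actions of pure tensors is a morphism of bimodules. -/
def bimodHomMk {M N : Bimod K B A} (f : M →+ N)
    (h : ∀ (b : B) (a : Aᵐᵒᵖ) (m : M), f ((b ⊗ₜ[K] a) • m) = (b ⊗ₜ[K] a) • f m) : M ⟶ N :=
  ModuleCat.ofHom
    { toFun := f
      map_add' := map_add f
      map_smul' := fun r m ↦ by
        induction r using TensorProduct.induction_on with
        | zero =>
          exact (congrArg f (zero_smul (B ⊗[K] Aᵐᵒᵖ) m)).trans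
            ((map_zero f).trans (zero_smul (B ⊗[K] Aᵐᵒᵖ) (f m)).symm)
        | add r s hr hs => simp only [add_smul, map_add, hr, hs]
        | tmul b a => exact h b a m }

section

variable {M : Bimod K B A} {N : Bimod K A C}

lemma tm_add_left (m m' : M) (n : N) : tm (m + m') n = tm m n + tm m' n := by
  simp only [tm, TensorProduct.add_tmul, map_add]
  rfl

lemma tm_add_right (m : M) (n n' : N) : tm m (n + n') = tm m n + tm m n' := by
  simp only [tm, TensorProduct.tmul_add, map_add]
  rfl

lemma tm_balanced (a : A) (m : M) (n : N) :
    tm (((1 : B) ⊗ₜ[K] MulOpposite.op a) • m) n = tm m ((a ⊗ₜ[K] (1 : Cᵐᵒᵖ)) • n) :=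
  (Submodule.Quotient.eq _).2 (Submodule.subset_span ⟨m, a, n, rfl⟩)

lemma smul_tm (b : B) (c : Cᵐᵒᵖ) (m : M) (n : N) :
    (b ⊗ₜ[K] c) • tm m n = tm ((b ⊗ₜ[K] (1 : Aᵐᵒᵖ)) • m) (((1 : A) ⊗ₜ[K] c) • n) :=
  BimodTensor.actHom_tmul M N b c m n

/-- The pure tensor as a biadditive map. -/
def tmHom (M : Bimod K B A) (N : Bimod K A C) : M →+ N →+ tensorObj M N :=
  AddMonoidHom.mk' (fun m ↦ AddMonoidHom.mk' (tm m) (tm_add_right m))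
    fun m m' ↦ by ext n; exact tm_add_left m m' n

lemma tmHom_apply (m : M) (n : N) : tmHom M N m n = tm m n := rfl

lemma tm_zero_left (n : N) : tm (0 : M) n = 0 := by
  rw [← tmHom_apply, map_zero, AddMonoidHom.zero_apply]

lemma tm_zero_right (m : M) : tm m (0 : N) = 0 := by
  rw [← tmHom_apply, map_zero]

lemma tensorObj_induction {p : tensorObj M N → Prop} (x : tensorObj M N) (zero : p 0)
    (tmul : ∀ m n, p (tm m n)) (add : ∀ x y, p x → p y → p (x + y)) : p x := by
  obtain ⟨x, rfl⟩ := BimodTensor.proj_surjective (K := K) (B := B) (A := A) (C := C) x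
  induction x using TensorProduct.induction_on with
  | zero => rw [map_zero]; exact zero
  | add x y hx hy => rw [map_add]; exact add _ _ hx hy
  | tmul m n => exact tmul m n

/-- The additive map out of `M ⊗_A N` attached to an `A`-balanced biadditive map. -/
def tensorLiftAdd {P : Type*} [AddCommGroup P] (β : M →+ N →+ P)
    (h : ∀ (a : A) (m : M) (n : N), β (((1 : B) ⊗ₜ[K] MulOpposite.op a) • m) n =
      β m ((a ⊗ₜ[K] (1 : Cᵐᵒᵖ)) • n)) : tensorObj M N →+ P :=
  QuotientAddGroup.lift (balancedRel K B A C M N).toAddSubgroup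
    (TensorProduct.liftAddHom β (fun k m n ↦ by
      rw [kModule_smul_eq_right, kModule_smul_eq_left, h])) (by
    intro x hx
    have hk : ∀ (k : K) (x : (M : Type u) ⊗[K] (N : Type u)),
        TensorProduct.liftAddHom β (fun k m n ↦ by
          rw [kModule_smul_eq_right, kModule_smul_eq_left, h]) (k • x) =
        TensorProduct.liftAddHom (β.comp (DistribSMul.toAddMonoidHom M k)) (fun l m n ↦ by
          simp only [AddMonoidHom.comp_apply, DistribSMul.toAddMonoidHom_apply]
          rw [smul_comm k l m, kModule_smul_eq_right l, kModule_smul_eq_left l, h]) x := by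
      intro k x
      induction x using TensorProduct.induction_on with
      | zero => simp
      | add x y hx hy => simp only [smul_add, map_add, hx, hy]
      | tmul m n => rfl
    change x ∈ balancedRel K B A C M N at hx
    -- `P` is only an additive group, while the relations are a `K`-span. The induction therefore
    -- proves that all multiples `k • x` are killed, and `hk` absorbs `k` into `β`.
    suffices ∀ k : K, TensorProduct.liftAddHom β (fun k m n ↦ by
          rw [kModule_smul_eq_right, kModule_smul_eq_left, h]) (k • x) = 0 by
      simpa using this 1
    induction hx using Submodule.span_induction with
    | mem x hx =>
      obtain ⟨m, a, n, rfl⟩ := hx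
      intro k
      rw [hk, map_sub, sub_eq_zero]
      change β (k • (((1 : B) ⊗ₜ[K] MulOpposite.op a) • m)) n =
        β (k • m) ((a ⊗ₜ[K] (1 : Cᵐᵒᵖ)) • n)
      rw [smul_comm, h]
    | zero => intro k; simp
    | add x y _ _ hx hy => intro k; rw [smul_add, map_add, hx, hy, add_zero]
    | smul l x _ hx => intro k; rw [smul_smul]; exact hx _)

/-- The morphism of bimodules out of `M ⊗_A N` attached to an `A`-balanced biadditive map that
commutes with the outer actions. -/
def tensorLift {P : Bimod K B C} (β : M →+ N →+ P)
    (h : ∀ (a : A) (m : M) (n : N), β (((1 : B) ⊗ₜ[K] MulOpposite.op a) • m) n =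
      β m ((a ⊗ₜ[K] (1 : Cᵐᵒᵖ)) • n))
    (h' : ∀ (b : B) (c : Cᵐᵒᵖ) (m : M) (n : N),
      β ((b ⊗ₜ[K] (1 : Aᵐᵒᵖ)) • m) (((1 : A) ⊗ₜ[K] c) • n) = (b ⊗ₜ[K] c) • β m n) :
    tensorObj M N ⟶ P :=
  bimodHomMk (M := tensorObj M N) (tensorLiftAdd β h) fun b c x ↦ by
    induction x using tensorObj_induction with
    | zero => simp
    | add x y hx hy => simp only [smul_add, map_add, hx, hy]
    | tmul m n =>
      rw [smul_tm]
      exact h' b c m n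

lemma tensorLift_tm {P : Bimod K B C} (β : M →+ N →+ P) (h) (h') (m : M) (n : N) :
    (tensorLift β h h').hom (tm m n) = β m n := rfl

lemma tensorObj_hom_ext {P : Bimod K B C} {f g : tensorObj M N ⟶ P}
    (h : ∀ (m : M) (n : N), f.hom (tm m n) = g.hom (tm m n)) : f = g :=
  bimodTensor_hom_ext h

end

lemma tensorFunctor_obj_map_tm (M : Bimod K B A) {N N' : Bimod K A C} (g : N ⟶ N') (m : M)
    (n : N) : (((tensorFunctor K B A C).obj M).map g).hom (tm m n) = tm m (g.hom n) := rfl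

lemma tensorFunctor_map_app_tm {M M' : Bimod K B A} (f : M ⟶ M') (N : Bimod K A C) (m : M)
    (n : N) : (((tensorFunctor K B A C).map f).app N).hom (tm m n) = tm (f.hom m) n := rfl

end BimoduleTensor

/-! ### Exactness and flatness of `M ⊗_A -` for a projective bimodule `M` -/

section Exactness

variable {K B A C : Type u} [CommRing K] [Ring B] [Algebra K B] [Ring A] [Algebra K A]
  [Ring C] [Algebra K C]

lemma exists_mapRange_eq {ι X Y Z : Type*} [Zero X] [Zero Y] [Zero Z] (f : ZeroHom X Y)
    (g : ZeroHom Y Z) (h : ∀ y, g y = 0 → ∃ x, f x = y) (v : ι →₀ Y)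
    (hv : v.mapRange g g.map_zero' = 0) : ∃ w : ι →₀ X, w.mapRange f f.map_zero' = v := by
  classical
  have (i : ι) : ∃ x, f x = v i := h _ (by simpa using DFunLike.congr_fun hv i)
  choose x hx using this
  -- The chosen preimage of `0` may be nonzero, so it is replaced by `0` off the support of `v` to
  -- keep `w` finitely supported.
  refine ⟨Finsupp.onFinset v.support (fun i ↦ if v i = 0 then 0 else x i) fun i hi ↦ ?_, ?_⟩
  · rw [Finsupp.mem_support_iff]
    intro h0
    exact hi (if_pos h0)
  · ext i
    rw [Finsupp.mapRange_apply, Finsupp.onFinset_apply]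
    split_ifs with h0
    · rw [h0, map_zero]
    · exact hx i

lemma exists_linearCombination_section {R : Type u} [Ring R] (M : ModuleCat.{u} R) [Projective M] :
    ∃ s : M →ₗ[R] (M →₀ R), ∀ m, Finsupp.linearCombination R (id : M → M) (s m) = m := by
  have : Module.Projective R M := (IsProjective.iff_projective M).2 inferInstance
  obtain ⟨s, hs⟩ := (Module.projective_def' (R := R) (P := M)).1 this
  exact ⟨s, fun m ↦ LinearMap.congr_fun hs m⟩

/-- The map `b ⊗ a ↦ b ⊗ a n`. -/
def leftCoeff (B : Type u) [Ring B] [Algebra K B] {N : Bimod K A C} (n : N) :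
    B ⊗[K] Aᵐᵒᵖ →ₗ[K] B ⊗[K] N :=
  LinearMap.lTensor B (((leftAct K A C N).toLinearMap.flip n).comp
    (MulOpposite.opLinearEquiv K).symm.toLinearMap)

lemma leftCoeff_tmul {N : Bimod K A C} (n : N) (b : B) (a : A) :
    leftCoeff B n (b ⊗ₜ MulOpposite.op a) = b ⊗ₜ ((a ⊗ₜ[K] (1 : Cᵐᵒᵖ)) • n) := rfl

lemma leftCoeff_add {N : Bimod K A C} (n n' : N) :
    leftCoeff (K := K) B (n + n') = leftCoeff B n + leftCoeff B n' := by
  refine TensorProduct.ext' fun b a ↦ ?_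
  obtain ⟨a, rfl⟩ := MulOpposite.op_surjective a
  rw [LinearMap.add_apply]
  simp only [leftCoeff_tmul, smul_add, TensorProduct.tmul_add]

lemma leftCoeff_mul {N : Bimod K A C} (a : A) (r : B ⊗[K] Aᵐᵒᵖ) (n : N) :
    leftCoeff B n (((1 : B) ⊗ₜ[K] MulOpposite.op a) * r) =
      leftCoeff B ((a ⊗ₜ[K] (1 : Cᵐᵒᵖ)) • n) r := by
  induction r using TensorProduct.induction_on with
  | zero => simp
  | add x y hx hy => simp only [mul_add, map_add, hx, hy]
  | tmul b a' =>
    obtain ⟨a', rfl⟩ := MulOpposite.op_surjective a'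
    rw [Algebra.TensorProduct.tmul_mul_tmul, ← MulOpposite.op_mul, leftCoeff_tmul, leftCoeff_tmul,
      smul_smul, Algebra.TensorProduct.tmul_mul_tmul, one_mul, one_mul]

/-- `b ⊗ n ↦ b m ⊗ n`. -/
def leftOrbit {M : Bimod K B A} (m : M) (N : Bimod K A C) :
    B ⊗[K] N →+ tensorObj M N :=
  TensorProduct.liftAddHom ((tmHom M N).comp
    (((leftAct K B A M).toLinearMap.flip m).toAddMonoidHom)) (by
      intro k b n
      change tm (((k • b) ⊗ₜ[K] (1 : Aᵐᵒᵖ)) • m) n = tm ((b ⊗ₜ[K] (1 : Aᵐᵒᵖ)) • m) (k • n)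
      have : (k • b) ⊗ₜ[K] (1 : Aᵐᵒᵖ) = b ⊗ₜ[K] MulOpposite.op (algebraMap K A k) := by
        rw [TensorProduct.smul_tmul, Algebra.algebraMap_eq_smul_one]
        rfl
      rw [kModule_smul_eq_left k n, ← tm_balanced, smul_smul, Algebra.TensorProduct.tmul_mul_tmul,
        one_mul, mul_one, this])

lemma leftOrbit_tmul {M : Bimod K B A} (m : M) {N : Bimod K A C} (b : B) (n : N) :
    leftOrbit m N (b ⊗ₜ n) = tm ((b ⊗ₜ[K] (1 : Aᵐᵒᵖ)) • m) n := rfl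

lemma leftOrbit_leftCoeff {M : Bimod K B A} (m : M) {N : Bimod K A C} (n : N)
    (r : B ⊗[K] Aᵐᵒᵖ) : leftOrbit m N (leftCoeff B n r) = tm (r • m) n := by
  induction r using TensorProduct.induction_on with
  | zero => rw [map_zero, map_zero]; exact ((congrArg (tm · n)
      (zero_smul (B ⊗[K] Aᵐᵒᵖ) m)).trans (tm_zero_left n)).symm
  | add x y hx hy => rw [map_add, map_add, hx, hy, add_smul, tm_add_left]
  | tmul b a =>
    obtain ⟨a, rfl⟩ := MulOpposite.op_surjective a
    rw [leftCoeff_tmul, leftOrbit_tmul, ← tm_balanced, smul_smul,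
      Algebra.TensorProduct.tmul_mul_tmul, one_mul, mul_one]

lemma leftOrbit_lTensor {M : Bimod K B A} (m : M) {N N' : Bimod K A C} (g : N ⟶ N')
    (x : B ⊗[K] N) : leftOrbit m N' (LinearMap.lTensor B (kHom g) x) =
      (((tensorFunctor K B A C).obj M).map g).hom (leftOrbit m N x) := by
  induction x using TensorProduct.induction_on with
  | zero => simp
  | add x y hx hy => simp only [map_add, hx, hy]
  | tmul b n => rfl

/-- For a projective bimodule `M`, the module `M ⊗_A N` is a retract of a direct sum of copies
of `B ⊗[K] N`; this is the section. -/
def leftSection {M : Bimod K B A} (s : M →ₗ[B ⊗[K] Aᵐᵒᵖ] (M →₀ B ⊗[K] Aᵐᵒᵖ))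
    (N : Bimod K A C) : tensorObj M N →+ (M →₀ B ⊗[K] N) :=
  tensorLiftAdd
    (AddMonoidHom.mk' (fun m ↦ AddMonoidHom.mk'
      (fun n ↦ (s m).mapRange (leftCoeff B n) (map_zero _))
      (fun n n' ↦ by ext; simp [leftCoeff_add]))
      (fun m m' ↦ by ext; simp))
    (fun a m n ↦ by
      ext m'
      simp [leftCoeff_mul])

lemma leftSection_tm {M : Bimod K B A} (s : M →ₗ[B ⊗[K] Aᵐᵒᵖ] (M →₀ B ⊗[K] Aᵐᵒᵖ))
    {N : Bimod K A C} (m : M) (n : N) :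
    leftSection s N (tm m n) = (s m).mapRange (leftCoeff B n) (map_zero _) := rfl

/-- The retraction of `leftSection`. -/
def leftRetraction (M : Bimod K B A) (N : Bimod K A C) : (M →₀ B ⊗[K] N) →+ tensorObj M N :=
  Finsupp.liftAddHom fun m ↦ leftOrbit m N

lemma leftRetraction_leftSection {M : Bimod K B A}
    (s : M →ₗ[B ⊗[K] Aᵐᵒᵖ] (M →₀ B ⊗[K] Aᵐᵒᵖ))
    (hs : ∀ m, Finsupp.linearCombination (B ⊗[K] Aᵐᵒᵖ) (id : M → M) (s m) = m)
    {N : Bimod K A C} (x : tensorObj M N) : leftRetraction M N (leftSection s N x) = x := by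
  induction x using tensorObj_induction with
  | zero => simp
  | add x y hx hy => simp only [map_add, hx, hy]
  | tmul m n =>
    rw [leftSection_tm, leftRetraction, Finsupp.liftAddHom_apply,
      Finsupp.sum_mapRange_index (by simp)]
    simp only [leftOrbit_leftCoeff]
    conv_rhs => rw [← hs m, Finsupp.linearCombination_apply]
    exact (map_finsuppSum ((tmHom M N).flip n) (s m) _).symm

lemma leftSection_naturality {M : Bimod K B A}
    (s : M →ₗ[B ⊗[K] Aᵐᵒᵖ] (M →₀ B ⊗[K] Aᵐᵒᵖ)) {N N' : Bimod K A C} (g : N ⟶ N')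
    (x : tensorObj M N) :
    leftSection s N' ((((tensorFunctor K B A C).obj M).map g).hom x) =
      (leftSection s N x).mapRange (LinearMap.lTensor B (kHom g)) (map_zero _) := by
  induction x using tensorObj_induction with
  | zero => simp
  | add x y hx hy =>
    simp only [map_add, hx, hy]
    ext; simp
  | tmul m n =>
    rw [tensorFunctor_obj_map_tm, leftSection_tm, leftSection_tm]
    ext m'
    simp only [Finsupp.mapRange_apply]
    generalize (s m) m' = r
    induction r using TensorProduct.induction_on with
    | zero => simp
    | add x y hx hy => simp only [map_add, hx, hy]
    | tmul b a =>
      obtain ⟨a, rfl⟩ := MulOpposite.op_surjective a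
      rw [leftCoeff_tmul, leftCoeff_tmul, LinearMap.lTensor_tmul]
      congr 1
      exact (g.hom.map_smul _ _).symm

lemma leftRetraction_naturality (M : Bimod K B A) {N N' : Bimod K A C} (g : N ⟶ N')
    (v : M →₀ B ⊗[K] N) :
    leftRetraction M N' (v.mapRange (LinearMap.lTensor B (kHom g)) (map_zero _)) =
      (((tensorFunctor K B A C).obj M).map g).hom (leftRetraction M N v) := by
  rw [leftRetraction, Finsupp.liftAddHom_apply, Finsupp.sum_mapRange_index (by simp),
    leftRetraction, Finsupp.liftAddHom_apply, map_finsuppSum]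
  simp only [leftOrbit_lTensor]

/-- Naturally in `N`, the group `M ⊗_A N` is a retract of a direct sum of copies of `B ⊗ N`, because
`M` is a retract of a free bimodule. Flatness of `B` makes `B ⊗ -` exact, and exactness passes to
sums and to natural retracts. -/
theorem exact_map_tensorFunctor_obj [Module.Flat K B] (M : Bimod K B A) [Projective M]
    (S : ShortComplex (Bimod K A C)) (hS : S.Exact) :
    (S.map ((tensorFunctor K B A C).obj M)).Exact := by
  obtain ⟨s, hs⟩ := exists_linearCombination_section M
  rw [ShortComplex.moduleCat_exact_iff] at hS ⊢
  intro (x : tensorObj M S.X₂) hx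
  have hex : Function.Exact (kHom S.f) (kHom S.g) := fun y ↦
    ⟨hS y, by rintro ⟨x, rfl⟩; exact S.moduleCat_zero_apply x⟩
  have hex' := Module.Flat.lTensor_exact B hex
  have h0 : leftSection s S.X₃ ((((tensorFunctor K B A C).obj M).map S.g).hom x) = 0 := by
    erw [hx]
    exact map_zero _
  rw [leftSection_naturality] at h0
  obtain ⟨w, hw⟩ := exists_mapRange_eq
    (LinearMap.lTensor B (kHom S.f)).toAddMonoidHom.toZeroHom
    (LinearMap.lTensor B (kHom S.g)).toAddMonoidHom.toZeroHom
    (fun y hy ↦ (hex' y).1 hy) _ h0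
  refine ⟨leftRetraction M S.X₁ w, ?_⟩
  rw [← leftRetraction_leftSection s hs x, ← hw]
  exact (leftRetraction_naturality M S.f w).symm

lemma leftSection_smul {M : Bimod K B A}
    (s : M →ₗ[B ⊗[K] Aᵐᵒᵖ] (M →₀ B ⊗[K] Aᵐᵒᵖ)) {N : Bimod K A C} (k : K)
    (x : tensorObj M N) : leftSection s N (k • x) = k • leftSection s N x := by
  induction x using tensorObj_induction with
  | zero => simp
  | add x y hx hy => simp only [smul_add, map_add, hx, hy]
  | tmul m n =>
    rw [kModule_smul_eq_left k, smul_tm, ← kModule_smul_eq_left, ← Algebra.TensorProduct.one_def,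
      one_smul, leftSection_tm, leftSection_tm]
    ext m'
    rw [← algebraMap_smul (B ⊗[K] Aᵐᵒᵖ) k m]
    rw [Finsupp.mapRange_apply, map_smul, Finsupp.smul_apply, Finsupp.smul_apply,
      Finsupp.mapRange_apply, smul_eq_mul, ← Algebra.smul_def, map_smul]

lemma leftRetraction_smul (M : Bimod K B A) (N : Bimod K A C) (k : K) (v : M →₀ B ⊗[K] N) :
    leftRetraction M N (k • v) = k • leftRetraction M N v := by
  induction v using Finsupp.induction_linear with
  | zero => simp
  | add x y hx hy => simp only [smul_add, map_add, hx, hy]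
  | single m t =>
    rw [Finsupp.smul_single, leftRetraction, Finsupp.liftAddHom_apply_single,
      Finsupp.liftAddHom_apply_single]
    induction t using TensorProduct.induction_on with
    | zero => simp
    | add x y hx hy => simp only [smul_add, map_add, hx, hy]
    | tmul b n =>
      rw [TensorProduct.smul_tmul', leftOrbit_tmul, leftOrbit_tmul, kModule_smul_eq_left k, smul_tm,
        ← Algebra.TensorProduct.one_def, one_smul, smul_smul, Algebra.TensorProduct.tmul_mul_tmul,
        mul_one, Algebra.smul_def]

lemma flat_finsupp (ι : Type*) (V : Type*) [AddCommGroup V] [Module K V] [Module.Flat K V] :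
    Module.Flat K (ι →₀ V) := by
  classical exact Module.Flat.of_linearEquiv (finsuppLEquivDirectSum K V ι)

/-- The section and the retraction are `K`-linear, so `M ⊗_A N` is a `K`-linear retract of copies of
the flat module `B ⊗ N`. -/
theorem flat_tensorObj [Module.Flat K B] (M : Bimod K B A) [Projective M] (N : Bimod K A C)
    [Module.Flat K N] : Module.Flat K (tensorObj M N) := by
  obtain ⟨s, hs⟩ := exists_linearCombination_section M
  let i : tensorObj M N →ₗ[K] (M →₀ B ⊗[K] N) :=
    { toFun := leftSection s N, map_add' := map_add _, map_smul' := leftSection_smul s }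
  let r : (M →₀ B ⊗[K] N) →ₗ[K] tensorObj M N :=
    { toFun := leftRetraction M N, map_add' := map_add _, map_smul' := leftRetraction_smul M N }
  have := flat_finsupp (K := K) M (B ⊗[K] N)
  exact Module.Flat.of_retract i r (LinearMap.ext (leftRetraction_leftSection s hs))

/-- A projective bimodule is a retract of a free module over `B ⊗ Aᵐᵒᵖ`, which is flat over `K`. -/
theorem flat_of_projective [Module.Flat K B] [Module.Flat K A] (M : Bimod K B A) [Projective M] :
    Module.Flat K M := by
  have : Module.Flat K Aᵐᵒᵖ := Module.Flat.of_linearEquiv (MulOpposite.opLinearEquiv K).symm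
  obtain ⟨s, hs⟩ := exists_linearCombination_section M
  have := flat_finsupp (K := K) M (B ⊗[K] Aᵐᵒᵖ)
  exact Module.Flat.of_retract (s.restrictScalars K)
    ((Finsupp.linearCombination (B ⊗[K] Aᵐᵒᵖ) (id : M → M)).restrictScalars K)
    (LinearMap.ext hs)

end Exactness

/-! ### Exactness of `- ⊗_A N` for a projective bimodule `N` -/

section ExactnessLeft

variable {K B A C : Type u} [CommRing K] [Ring B] [Algebra K B] [Ring A] [Algebra K A]
  [Ring C] [Algebra K C]

/-- The map `a ⊗ c ↦ m a ⊗ c`. -/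
def rightCoeff (C : Type u) [Ring C] [Algebra K C] {M : Bimod K B A} (m : M) :
    A ⊗[K] Cᵐᵒᵖ →ₗ[K] M ⊗[K] Cᵐᵒᵖ :=
  LinearMap.rTensor Cᵐᵒᵖ (((rightAct K B A M).toLinearMap.flip m).comp
    (MulOpposite.opLinearEquiv K).toLinearMap)

lemma rightCoeff_tmul {M : Bimod K B A} (m : M) (a : A) (c : Cᵐᵒᵖ) :
    rightCoeff C m (a ⊗ₜ c) = (((1 : B) ⊗ₜ[K] MulOpposite.op a) • m) ⊗ₜ c := rfl

lemma rightCoeff_add {M : Bimod K B A} (m m' : M) :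
    rightCoeff (K := K) C (m + m') = rightCoeff C m + rightCoeff C m' := by
  refine TensorProduct.ext' fun a c ↦ ?_
  rw [LinearMap.add_apply]
  simp only [rightCoeff_tmul, smul_add, TensorProduct.add_tmul]

lemma rightCoeff_mul {M : Bimod K B A} (a : A) (r : A ⊗[K] Cᵐᵒᵖ) (m : M) :
    rightCoeff C m ((a ⊗ₜ[K] (1 : Cᵐᵒᵖ)) * r) =
      rightCoeff C (((1 : B) ⊗ₜ[K] MulOpposite.op a) • m) r := by
  induction r using TensorProduct.induction_on with
  | zero => simp
  | add x y hx hy => simp only [mul_add, map_add, hx, hy]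
  | tmul a' c =>
    rw [Algebra.TensorProduct.tmul_mul_tmul, rightCoeff_tmul, rightCoeff_tmul, smul_smul,
      Algebra.TensorProduct.tmul_mul_tmul, one_mul, one_mul, MulOpposite.op_mul]

/-- `m ⊗ c ↦ m ⊗ n c`. -/
def rightOrbit (M : Bimod K B A) {N : Bimod K A C} (n : N) :
    M ⊗[K] Cᵐᵒᵖ →+ tensorObj M N :=
  TensorProduct.liftAddHom ((((tmHom M N).flip).comp
    (((rightAct K A C N).toLinearMap.flip n).toAddMonoidHom)).flip) (by
      intro k m c
      change tm (k • m) (((1 : A) ⊗ₜ[K] c) • n) = tm m (((1 : A) ⊗ₜ[K] (k • c)) • n)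
      rw [kModule_smul_eq_right k m, tm_balanced, smul_smul, Algebra.TensorProduct.tmul_mul_tmul,
        one_mul, mul_one, ← TensorProduct.smul_tmul, Algebra.algebraMap_eq_smul_one])

lemma rightOrbit_tmul {M : Bimod K B A} (m : M) {N : Bimod K A C} (c : Cᵐᵒᵖ) (n : N) :
    rightOrbit M n (m ⊗ₜ c) = tm m (((1 : A) ⊗ₜ[K] c) • n) := rfl

lemma rightOrbit_rightCoeff {M : Bimod K B A} (m : M) {N : Bimod K A C} (n : N)
    (r : A ⊗[K] Cᵐᵒᵖ) : rightOrbit M n (rightCoeff C m r) = tm m (r • n) := by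
  induction r using TensorProduct.induction_on with
  | zero => rw [map_zero, map_zero]; exact ((congrArg (tm m ·)
      (zero_smul (A ⊗[K] Cᵐᵒᵖ) n)).trans (tm_zero_right m)).symm
  | add x y hx hy => rw [map_add, map_add, hx, hy, add_smul, tm_add_right]
  | tmul a c =>
    rw [rightCoeff_tmul, rightOrbit_tmul, tm_balanced, smul_smul,
      Algebra.TensorProduct.tmul_mul_tmul, one_mul, mul_one]

lemma rightOrbit_rTensor {N : Bimod K A C} (n : N) {M M' : Bimod K B A} (f : M ⟶ M')
    (x : M ⊗[K] Cᵐᵒᵖ) : rightOrbit M' n (LinearMap.rTensor Cᵐᵒᵖ (kHom f) x) =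
      (((tensorFunctor K B A C).map f).app N).hom (rightOrbit M n x) := by
  induction x using TensorProduct.induction_on with
  | zero => simp
  | add x y hx hy => simp only [map_add, hx, hy]
  | tmul b n => rfl

/-- For a projective bimodule `N`, the module `M ⊗_A N` is a retract of a direct sum of copies
of `M ⊗[K] Cᵐᵒᵖ`; this is the section. -/
def rightSection {N : Bimod K A C} (s : N →ₗ[A ⊗[K] Cᵐᵒᵖ] (N →₀ A ⊗[K] Cᵐᵒᵖ))
    (M : Bimod K B A) : tensorObj M N →+ (N →₀ M ⊗[K] Cᵐᵒᵖ) :=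
  tensorLiftAdd
    (AddMonoidHom.mk' (fun m ↦ AddMonoidHom.mk'
      (fun n ↦ (s n).mapRange (rightCoeff C m) (map_zero _))
      (fun n n' ↦ by ext; simp))
      (fun m m' ↦ by ext; simp [rightCoeff_add]))
    (fun a m n ↦ by
      ext m'
      simp [rightCoeff_mul])

lemma rightSection_tm {N : Bimod K A C} (s : N →ₗ[A ⊗[K] Cᵐᵒᵖ] (N →₀ A ⊗[K] Cᵐᵒᵖ))
    {M : Bimod K B A} (m : M) (n : N) :
    rightSection s M (tm m n) = (s n).mapRange (rightCoeff C m) (map_zero _) := rfl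

/-- The retraction of `rightSection`. -/
def rightRetraction (M : Bimod K B A) (N : Bimod K A C) : (N →₀ M ⊗[K] Cᵐᵒᵖ) →+ tensorObj M N :=
  Finsupp.liftAddHom fun n ↦ rightOrbit M n

lemma rightRetraction_rightSection {N : Bimod K A C}
    (s : N →ₗ[A ⊗[K] Cᵐᵒᵖ] (N →₀ A ⊗[K] Cᵐᵒᵖ))
    (hs : ∀ n, Finsupp.linearCombination (A ⊗[K] Cᵐᵒᵖ) (id : N → N) (s n) = n)
    {M : Bimod K B A} (x : tensorObj M N) : rightRetraction M N (rightSection s M x) = x := by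
  induction x using tensorObj_induction with
  | zero => simp
  | add x y hx hy => simp only [map_add, hx, hy]
  | tmul m n =>
    rw [rightSection_tm, rightRetraction, Finsupp.liftAddHom_apply,
      Finsupp.sum_mapRange_index (by simp)]
    simp only [rightOrbit_rightCoeff]
    conv_rhs => rw [← hs n, Finsupp.linearCombination_apply]
    exact (map_finsuppSum (tmHom M N m) (s n) _).symm

lemma rightSection_naturality {N : Bimod K A C}
    (s : N →ₗ[A ⊗[K] Cᵐᵒᵖ] (N →₀ A ⊗[K] Cᵐᵒᵖ)) {M M' : Bimod K B A} (f : M ⟶ M')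
    (x : tensorObj M N) :
    rightSection s M' ((((tensorFunctor K B A C).map f).app N).hom x) =
      (rightSection s M x).mapRange (LinearMap.rTensor Cᵐᵒᵖ (kHom f)) (map_zero _) := by
  induction x using tensorObj_induction with
  | zero => simp
  | add x y hx hy =>
    simp only [map_add, hx, hy]
    ext; simp
  | tmul m n =>
    rw [tensorFunctor_map_app_tm, rightSection_tm, rightSection_tm]
    ext m'
    simp only [Finsupp.mapRange_apply]
    generalize (s n) m' = r
    induction r using TensorProduct.induction_on with
    | zero => simp
    | add x y hx hy => simp only [map_add, hx, hy]
    | tmul a c =>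
      rw [rightCoeff_tmul, rightCoeff_tmul, LinearMap.rTensor_tmul]
      congr 1
      exact (f.hom.map_smul _ _).symm

lemma rightRetraction_naturality (N : Bimod K A C) {M M' : Bimod K B A} (f : M ⟶ M')
    (v : N →₀ M ⊗[K] Cᵐᵒᵖ) :
    rightRetraction M' N (v.mapRange (LinearMap.rTensor Cᵐᵒᵖ (kHom f)) (map_zero _)) =
      (((tensorFunctor K B A C).map f).app N).hom (rightRetraction M N v) := by
  rw [rightRetraction, Finsupp.liftAddHom_apply, Finsupp.sum_mapRange_index (by simp),
    rightRetraction, Finsupp.liftAddHom_apply, map_finsuppSum]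
  simp only [rightOrbit_rTensor]

/-- Mirror image of `exact_map_tensorFunctor_obj`: here `M ⊗_A N` is a natural retract of copies of
`M ⊗ Cᵐᵒᵖ`, so it is the flatness of `C` that enters. -/
theorem exact_map_tensorFunctor_flip_obj [Module.Flat K C] (N : Bimod K A C) [Projective N]
    (S : ShortComplex (Bimod K B A)) (hS : S.Exact) :
    (S.map ((tensorFunctor K B A C).flip.obj N)).Exact := by
  obtain ⟨s, hs⟩ := exists_linearCombination_section N
  rw [ShortComplex.moduleCat_exact_iff] at hS ⊢
  intro (x : tensorObj S.X₂ N) hx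
  have hex : Function.Exact (kHom S.f) (kHom S.g) := fun y ↦
    ⟨hS y, by rintro ⟨x, rfl⟩; exact S.moduleCat_zero_apply x⟩
  have : Module.Flat K Cᵐᵒᵖ := Module.Flat.of_linearEquiv (MulOpposite.opLinearEquiv K).symm
  have hex' := Module.Flat.rTensor_exact Cᵐᵒᵖ hex
  have h0 : rightSection s S.X₃ ((((tensorFunctor K B A C).map S.g).app N).hom x) = 0 := by
    erw [hx]
    exact map_zero _
  rw [rightSection_naturality] at h0
  obtain ⟨w, hw⟩ := exists_mapRange_eq
    (LinearMap.rTensor Cᵐᵒᵖ (kHom S.f)).toAddMonoidHom.toZeroHom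
    (LinearMap.rTensor Cᵐᵒᵖ (kHom S.g)).toAddMonoidHom.toZeroHom
    (fun y hy ↦ (hex' y).1 hy) _ h0
  refine ⟨rightRetraction S.X₁ N w, ?_⟩
  rw [← rightRetraction_rightSection s hs x, ← hw]
  exact (rightRetraction_naturality N S.f w).symm

end ExactnessLeft

/-! ### Associativity and unit of the bimodule tensor product -/

section Coherence

variable {K B A C D : Type u} [CommRing K] [Ring B] [Algebra K B] [Ring A] [Algebra K A]
  [Ring C] [Algebra K C] [Ring D] [Algebra K D]

lemma tensorObj_addHom_ext {M : Bimod K B A} {N : Bimod K A C} {P : Type*} [AddZeroClass P]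
    {f g : tensorObj M N →+ P} (h : ∀ m n, f (tm m n) = g (tm m n)) : f = g := by
  ext x
  induction x using tensorObj_induction with
  | zero => rw [map_zero, map_zero]
  | add x y hx hy => rw [map_add, map_add, hx, hy]
  | tmul m n => exact h m n

/-- The additive map underlying the associator. -/
def assocHomAux (M : Bimod K B A) (N : Bimod K A C) (L : Bimod K C D) :
    tensorObj M N →+ L →+ tensorObj M (tensorObj N L) :=
  tensorLiftAdd
    (AddMonoidHom.mk' (fun m ↦ AddMonoidHom.mk'
      (fun n ↦ ((tmHom M (tensorObj N L) m).comp (tmHom N L n)))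
      (fun n n' ↦ by
        ext l
        simp only [AddMonoidHom.comp_apply, AddMonoidHom.add_apply, map_add]))
      (fun m m' ↦ by
        ext n l
        simp only [AddMonoidHom.mk'_apply, AddMonoidHom.comp_apply, AddMonoidHom.add_apply,
          map_add]))
    (fun a m n ↦ by
      ext l
      change tm _ (tm n l) = tm m (tm _ l)
      rw [tm_balanced, smul_tm, ← Algebra.TensorProduct.one_def, one_smul])

/-- The associator on objects. -/
def assocHom (M : Bimod K B A) (N : Bimod K A C) (L : Bimod K C D) :
    tensorObj (tensorObj M N) L ⟶ tensorObj M (tensorObj N L) :=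
  tensorLift (assocHomAux M N L)
    (fun c x l ↦ by
      induction x using tensorObj_induction with
      | zero => simp
      | add x y hx hy => simp only [smul_add, map_add, AddMonoidHom.add_apply, hx, hy]
      | tmul m n =>
        rw [smul_tm, ← Algebra.TensorProduct.one_def, one_smul]
        change tm m (tm _ l) = tm m (tm n _)
        rw [tm_balanced])
    (fun b d x l ↦ by
      induction x using tensorObj_induction with
      | zero => simp
      | add x y hx hy => simp only [smul_add, map_add, AddMonoidHom.add_apply, hx, hy]
      | tmul m n =>
        rw [smul_tm, ← Algebra.TensorProduct.one_def, one_smul]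
        change tm _ (tm n _) = (b ⊗ₜ[K] d) • tm m (tm n l)
        rw [smul_tm, smul_tm, ← Algebra.TensorProduct.one_def, one_smul])

/-- The additive map underlying the inverse of the associator. -/
def assocInvAux (M : Bimod K B A) (N : Bimod K A C) (L : Bimod K C D) :
    M →+ tensorObj N L →+ tensorObj (tensorObj M N) L :=
  AddMonoidHom.mk'
    (fun m ↦ tensorLiftAdd ((tmHom (tensorObj M N) L).comp (tmHom M N m)) (fun c n l ↦ by
      change tm (tm m _) l = tm (tm m n) _
      rw [← tm_balanced, smul_tm, ← Algebra.TensorProduct.one_def, one_smul]))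
    (fun m m' ↦ tensorObj_addHom_ext fun n l ↦ by
      change tm (tm (m + m') n) l = tm (tm m n) l + tm (tm m' n) l
      rw [tm_add_left, tm_add_left])

/-- The inverse of the associator on objects. -/
def assocInv (M : Bimod K B A) (N : Bimod K A C) (L : Bimod K C D) :
    tensorObj M (tensorObj N L) ⟶ tensorObj (tensorObj M N) L :=
  tensorLift (assocInvAux M N L)
    (fun a m x ↦ by
      induction x using tensorObj_induction with
      | zero => simp
      | add x y hx hy => simp only [smul_add, map_add, hx, hy]
      | tmul n l =>
        rw [smul_tm, ← Algebra.TensorProduct.one_def, one_smul]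
        change tm (tm _ n) l = tm (tm m _) l
        rw [tm_balanced])
    (fun b d m x ↦ by
      induction x using tensorObj_induction with
      | zero => simp
      | add x y hx hy => simp only [smul_add, map_add, hx, hy]
      | tmul n l =>
        rw [smul_tm, ← Algebra.TensorProduct.one_def, one_smul]
        change tm (tm _ n) _ = (b ⊗ₜ[K] d) • tm (tm m n) l
        rw [smul_tm, smul_tm, ← Algebra.TensorProduct.one_def, one_smul])

/-- The associator on objects, as an isomorphism. -/
def assocIso (M : Bimod K B A) (N : Bimod K A C) (L : Bimod K C D) :
    tensorObj (tensorObj M N) L ≅ tensorObj M (tensorObj N L) where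
  hom := assocHom M N L
  inv := assocInv M N L
  hom_inv_id := tensorObj_hom_ext fun x l ↦ by
    induction x using tensorObj_induction with
    | zero => rw [tm_zero_left, map_zero, map_zero]
    | add x y hx hy => rw [tm_add_left, map_add, map_add, hx, hy]
    | tmul m n => rfl
  inv_hom_id := tensorObj_hom_ext fun m x ↦ by
    induction x using tensorObj_induction with
    | zero => rw [tm_zero_right, map_zero, map_zero]
    | add x y hx hy => rw [tm_add_right, map_add, map_add, hx, hy]
    | tmul n l => rfl

lemma tensorObj₃_hom_ext {M : Bimod K B A} {N : Bimod K A C} {L : Bimod K C D} {P : Bimod K B D}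
    {f g : tensorObj (tensorObj M N) L ⟶ P}
    (h : ∀ m n l, f.hom (tm (tm m n) l) = g.hom (tm (tm m n) l)) : f = g :=
  tensorObj_hom_ext fun x l ↦ by
    induction x using tensorObj_induction with
    | zero => rw [tm_zero_left, map_zero, map_zero]
    | add x y hx hy => rw [tm_add_left, map_add, map_add, hx, hy]
    | tmul m n => exact h m n l

variable (K B A C D) in
/-- The associator `(M ⊗_A N) ⊗_C L ≅ M ⊗_A (N ⊗_C L)`. -/
def tensorAssociator :
    bifunctorComp₁₂ (tensorFunctor K B A C) (tensorFunctor K B C D) ≅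
      bifunctorComp₂₃ (tensorFunctor K B A D) (tensorFunctor K A C D) :=
  NatIso.ofComponents
    (fun M ↦ NatIso.ofComponents
      (fun N ↦ NatIso.ofComponents (fun L ↦ assocIso M N L)
        (fun {L L'} l ↦ tensorObj₃_hom_ext fun _ _ _ ↦ rfl))
      (fun {N N'} g ↦ by
        ext L : 2
        exact tensorObj₃_hom_ext fun _ _ _ ↦ rfl))
    (fun {M M'} f ↦ by
      ext N L : 4
      exact tensorObj₃_hom_ext fun _ _ _ ↦ rfl)

variable (K) in
/-- An element of `B`, as an element of the diagonal bimodule. -/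
def diag : B ≃+ diagonal K B := AddEquiv.refl B

lemma smul_diag (b : B) (c : Bᵐᵒᵖ) (x : B) :
    (b ⊗ₜ[K] c) • diag K x = diag K (b * x * c.unop) := by
  change AlgHom.mulLeftRight K B (b ⊗ₜ[K] c) x = _
  rw [AlgHom.mulLeftRight_apply]
  rfl

/-- The unit isomorphism on objects. -/
def unitHom (Y : Bimod K B C) : tensorObj (diagonal K B) Y ⟶ Y :=
  tensorLift
    ((AddMonoidHom.mk' (fun b : B ↦ AddMonoidHom.mk'
      (fun y : Y ↦ (b ⊗ₜ[K] (1 : Cᵐᵒᵖ)) • y) (fun _ _ ↦ smul_add _ _ _))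
      (fun b b' ↦ by
        ext y
        simp only [AddMonoidHom.mk'_apply, AddMonoidHom.add_apply, TensorProduct.add_tmul,
          add_smul])).comp (diag K).symm.toAddMonoidHom)
    (fun b x y ↦ by
      obtain ⟨x, rfl⟩ := (diag K).surjective x
      rw [smul_diag]
      change ((1 * x * b) ⊗ₜ[K] (1 : Cᵐᵒᵖ)) • y = (x ⊗ₜ[K] (1 : Cᵐᵒᵖ)) • (b ⊗ₜ[K] (1 : Cᵐᵒᵖ)) • y
      rw [smul_smul, Algebra.TensorProduct.tmul_mul_tmul, one_mul, one_mul])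
    (fun b c x y ↦ by
      obtain ⟨x, rfl⟩ := (diag K).surjective x
      rw [smul_diag]
      change ((b * x * 1) ⊗ₜ[K] (1 : Cᵐᵒᵖ)) • ((1 : B) ⊗ₜ[K] c) • y =
        (b ⊗ₜ[K] c) • (x ⊗ₜ[K] (1 : Cᵐᵒᵖ)) • y
      rw [smul_smul, smul_smul, Algebra.TensorProduct.tmul_mul_tmul,
        Algebra.TensorProduct.tmul_mul_tmul, one_mul, mul_one, mul_one, mul_one])

lemma unitHom_tm (Y : Bimod K B C) (b : B) (y : Y) :
    (unitHom Y).hom (tm (diag K b) y) = (b ⊗ₜ[K] (1 : Cᵐᵒᵖ)) • y := rfl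

lemma tm_diag (Y : Bimod K B C) (b : B) (y : Y) :
    tm (diag K b) y = tm (diag K 1) ((b ⊗ₜ[K] (1 : Cᵐᵒᵖ)) • y) := by
  rw [← tm_balanced, smul_diag, one_mul, one_mul, MulOpposite.unop_op]

/-- The inverse of the unit isomorphism on objects. -/
def unitInv (Y : Bimod K B C) : Y ⟶ tensorObj (diagonal K B) Y :=
  bimodHomMk (tmHom (diagonal K B) Y (diag K 1)) fun b c y ↦ by
    rw [tmHom_apply, tmHom_apply, smul_tm, smul_diag, tm_diag _ (b * 1 * _), smul_smul,
      Algebra.TensorProduct.tmul_mul_tmul]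
    simp

lemma unitInv_apply (Y : Bimod K B C) (y : Y) : (unitInv Y).hom y = tm (diag K 1) y := rfl

/-- The unit isomorphism `B ⊗_B Y ≅ Y`. -/
def unitIso (Y : Bimod K B C) : tensorObj (diagonal K B) Y ≅ Y where
  hom := unitHom Y
  inv := unitInv Y
  hom_inv_id := tensorObj_hom_ext fun x y ↦ by
    obtain ⟨b, rfl⟩ := (diag K).surjective x
    rw [ModuleCat.comp_apply, unitHom_tm, unitInv_apply, ← tm_diag]
    rfl
  inv_hom_id := by
    ext y
    rw [ModuleCat.comp_apply, unitInv_apply, unitHom_tm, ← Algebra.TensorProduct.one_def, one_smul]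
    rfl

variable (K B C) in
/-- The unit isomorphism `B ⊗_B - ≅ 𝟭`. -/
def tensorUnitor : (tensorFunctor K B B C).obj (diagonal K B) ≅ 𝟭 _ :=
  NatIso.ofComponents unitIso fun g ↦ tensorObj_hom_ext fun b y ↦
    (g.hom.map_smul ((diag K).symm b ⊗ₜ[K] (1 : Cᵐᵒᵖ)) y).symm

end Coherence

/-! ### Compatibility of the bimodule tensor product with coproducts -/

section Coproducts

variable {K B A C : Type u} [CommRing K] [Ring B] [Algebra K B] [Ring A] [Algebra K A]
  [Ring C] [Algebra K C] {J : Type} (M : Bimod K B A) (N : Bimod K A C)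

section

variable [DecidableEq J]

open DirectSum

/-- The direct sum of a family of bimodules. -/
abbrev directSumBimod (Z : J → Bimod K B A) : Bimod K B A := ModuleCat.of _ (⨁ j, Z j)

/-- The inclusions in a direct sum of bimodules. -/
def directSumι (Z : J → Bimod K B A) (j : J) : Z j ⟶ directSumBimod Z :=
  ModuleCat.ofHom (DirectSum.lof (B ⊗[K] Aᵐᵒᵖ) J (fun j ↦ Z j) j)

lemma directSumBimod_induction {Z : J → Bimod K B A} {p : directSumBimod Z → Prop}
    (x : directSumBimod Z) (zero : p 0) (of : ∀ j (z : Z j), p ((directSumι Z j).hom z))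
    (add : ∀ x y, p x → p y → p (x + y)) : p x :=
  DirectSum.induction_on x zero of add

/-- Additive maps out of a direct sum of bimodules. -/
def directSumDescAdd {Z : J → Bimod K B A} {P : Type*} [AddCommGroup P] (φ : ∀ j, Z j →+ P) :
    directSumBimod Z →+ P :=
  DirectSum.toAddMonoid φ

lemma directSumDescAdd_ι {Z : J → Bimod K B A} {P : Type*} [AddCommGroup P]
    (φ : ∀ j, Z j →+ P) (j : J) (z : Z j) :
    directSumDescAdd φ ((directSumι Z j).hom z) = φ j z :=
  DirectSum.toAddMonoid_of φ j z

lemma directSumBimod_addHom_ext {Z : J → Bimod K B A} {P : Type*} [AddCommGroup P]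
    {f g : directSumBimod Z →+ P}
    (h : ∀ j z, f ((directSumι Z j).hom z) = g ((directSumι Z j).hom z)) : f = g :=
  DirectSum.addHom_ext h

/-- `M ⊗_A -` turns direct sums into coproducts: the induced morphisms. -/
def tensorDirectSumDesc {Z : J → Bimod K A C} {P : Bimod K B C} (φ : ∀ j, tensorObj M (Z j) ⟶ P) :
    tensorObj M (directSumBimod Z) ⟶ P :=
  tensorLift
    (AddMonoidHom.mk'
      (fun m ↦ directSumDescAdd fun j ↦ (φ j).hom.toAddMonoidHom.comp (tmHom M (Z j) m))
      (fun m m' ↦ directSumBimod_addHom_ext fun j z ↦ by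
        rw [AddMonoidHom.add_apply, directSumDescAdd_ι, directSumDescAdd_ι, directSumDescAdd_ι,
          map_add]
        exact (φ j).hom.map_add (tm m z) (tm m' z)))
    (fun a m z ↦ by
      rw [AddMonoidHom.mk'_apply]
      induction z using directSumBimod_induction with
      | zero => simp
      | add x y hx hy => rw [smul_add, map_add, map_add, hx, hy]
      | of j z =>
        rw [← map_smul, directSumDescAdd_ι, directSumDescAdd_ι]
        exact congr((φ j).hom $(tm_balanced a m z)))
    (fun b c m z ↦ by
      rw [AddMonoidHom.mk'_apply]
      induction z using directSumBimod_induction with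
      | zero => simp
      | add x y hx hy => rw [smul_add, map_add, map_add, smul_add, hx, hy]
      | of j z =>
        rw [← map_smul, directSumDescAdd_ι, directSumDescAdd_ι]
        exact congr((φ j).hom $((smul_tm b c m z).symm)).trans
          ((φ j).hom.map_smul (b ⊗ₜ[K] c) (tm m z)))

lemma tensorDirectSumDesc_tm {Z : J → Bimod K A C} {P : Bimod K B C}
    (φ : ∀ j, tensorObj M (Z j) ⟶ P) (m : M) (j : J) (z : Z j) :
    (tensorDirectSumDesc M φ).hom (tm m ((directSumι Z j).hom z)) = (φ j).hom (tm m z) := by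
  rw [tensorDirectSumDesc, tensorLift_tm]
  exact directSumDescAdd_ι _ j z

lemma tensorDirectSum_hom_ext {Z : J → Bimod K A C} {P : Bimod K B C}
    {f g : tensorObj M (directSumBimod Z) ⟶ P}
    (h : ∀ m j (z : Z j), f.hom (tm m ((directSumι Z j).hom z)) =
      g.hom (tm m ((directSumι Z j).hom z))) : f = g :=
  tensorObj_hom_ext fun m z ↦ by
    induction z using directSumBimod_induction with
    | zero => rw [tm_zero_right, map_zero, map_zero]
    | add x y hx hy => rw [tm_add_right, map_add, map_add, hx, hy]
    | of j z => exact h m j z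

/-- `- ⊗_A N` turns direct sums into coproducts: the induced morphisms. -/
def directSumTensorDesc {Z : J → Bimod K B A} {P : Bimod K B C} (φ : ∀ j, tensorObj (Z j) N ⟶ P) :
    tensorObj (directSumBimod Z) N ⟶ P :=
  tensorLift
    (directSumDescAdd fun j ↦
      (AddMonoidHom.compHom (φ j).hom.toAddMonoidHom).comp (tmHom (Z j) N))
    (fun a z n ↦ by
      induction z using directSumBimod_induction with
      | zero => simp
      | add x y hx hy =>
        rw [smul_add, map_add, map_add, AddMonoidHom.add_apply, AddMonoidHom.add_apply, hx, hy]
      | of j z =>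
        rw [← map_smul, directSumDescAdd_ι, directSumDescAdd_ι]
        exact congr((φ j).hom $(tm_balanced a z n)))
    (fun b c z n ↦ by
      induction z using directSumBimod_induction with
      | zero => simp
      | add x y hx hy =>
        rw [smul_add, map_add, map_add, AddMonoidHom.add_apply, AddMonoidHom.add_apply, smul_add,
          hx, hy]
      | of j z =>
        rw [← map_smul, directSumDescAdd_ι, directSumDescAdd_ι]
        exact congr((φ j).hom $((smul_tm b c z n).symm)).trans
          ((φ j).hom.map_smul (b ⊗ₜ[K] c) (tm z n)))

lemma directSumTensorDesc_tm {Z : J → Bimod K B A} {P : Bimod K B C}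
    (φ : ∀ j, tensorObj (Z j) N ⟶ P) (j : J) (z : Z j) (n : N) :
    (directSumTensorDesc N φ).hom (tm ((directSumι Z j).hom z) n) = (φ j).hom (tm z n) := by
  rw [directSumTensorDesc, tensorLift_tm, directSumDescAdd_ι]
  rfl

lemma directSumTensor_hom_ext {Z : J → Bimod K B A} {P : Bimod K B C}
    {f g : tensorObj (directSumBimod Z) N ⟶ P}
    (h : ∀ j (z : Z j) n, f.hom (tm ((directSumι Z j).hom z) n) =
      g.hom (tm ((directSumι Z j).hom z) n)) : f = g :=
  tensorObj_hom_ext fun z n ↦ by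
    induction z using directSumBimod_induction with
    | zero => rw [tm_zero_left, map_zero, map_zero]
    | add x y hx hy => rw [tm_add_left, map_add, map_add, hx, hy]
    | of j z => exact h j z n

end

/-- Total complexes are coproducts over bidegrees. Triple total complexes can be compared because
tensoring on either side commutes with these coproducts. -/
instance preservesColimit_tensorFunctor_obj (Z : J → Bimod K A C) :
    PreservesColimit (Discrete.functor Z) ((tensorFunctor K B A C).obj M) := by
  classical
  refine preservesColimit_of_preserves_colimit_cocone (ModuleCat.coproductCoconeIsColimit Z)
    { desc := fun s ↦ tensorDirectSumDesc M fun j ↦ s.ι.app ⟨j⟩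
      fac := fun s ⟨j⟩ ↦ tensorObj_hom_ext fun m z ↦
        tensorDirectSumDesc_tm M (fun j ↦ s.ι.app ⟨j⟩) m j z
      uniq := fun s f hf ↦ tensorDirectSum_hom_ext M fun m j z ↦ ?_ }
  rw [tensorDirectSumDesc_tm, ← hf ⟨j⟩]
  rfl

instance preservesColimit_tensorFunctor_flip_obj (Z : J → Bimod K B A) :
    PreservesColimit (Discrete.functor Z) ((tensorFunctor K B A C).flip.obj N) := by
  classical
  refine preservesColimit_of_preserves_colimit_cocone (ModuleCat.coproductCoconeIsColimit Z)
    { desc := fun s ↦ directSumTensorDesc N fun j ↦ s.ι.app ⟨j⟩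
      fac := fun s ⟨j⟩ ↦ tensorObj_hom_ext fun z n ↦
        directSumTensorDesc_tm N (fun j ↦ s.ι.app ⟨j⟩) j z n
      uniq := fun s f hf ↦ directSumTensor_hom_ext N fun j z n ↦ ?_ }
  rw [directSumTensorDesc_tm, ← hf ⟨j⟩]
  rfl

end Coproducts

/-! ### Base change of bimodules as a left adjoint -/

section BaseChangeAlgebra

variable {K : Type u} [CommRing K] (K' : Type u) [CommRing K'] [Algebra K K']
  {B A C : Type u} [Ring B] [Algebra K B] [Ring A] [Algebra K A] [Ring C] [Algebra K C]

/-- The base change of a bimodule. -/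
abbrev bcObj (M : Bimod K B A) : Bimod K' (K' ⊗[K] B) (K' ⊗[K] A) :=
  (baseChangeFunctor K K' B A).obj M

variable {K'}

/-- The pure tensor `t ⊗ m` in `K' ⊗[K] M`. -/
def bc {M : Bimod K B A} (t : K') (m : M) : bcObj K' M := t ⊗ₜ[K] m

section

variable {M : Bimod K B A}

lemma bc_add_left (t t' : K') (m : M) : bc (t + t') m = bc t m + bc t' m :=
  TensorProduct.add_tmul t t' m

lemma bc_add_right (t : K') (m m' : M) : bc t (m + m') = bc t m + bc t m' :=
  TensorProduct.tmul_add t m m'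

lemma bc_zero_right (t : K') : bc t (0 : M) = 0 :=
  TensorProduct.tmul_zero _ t

lemma smul_bc (s s' t : K') (b : B) (a : A) (m : M) :
    ((s ⊗ₜ[K] b) ⊗ₜ[K'] (MulOpposite.op (s' ⊗ₜ[K] a))) • bc t m =
      bc (s * (s' * t)) ((b ⊗ₜ[K] MulOpposite.op a) • m) := by
  refine (baseChangeAct_tmul K' M s s' t b a m).trans ?_
  change bc _ ((b ⊗ₜ[K] (1 : Aᵐᵒᵖ)) • ((1 : B) ⊗ₜ[K] MulOpposite.op a) • m) = _
  rw [smul_smul, Algebra.TensorProduct.tmul_mul_tmul, one_mul, mul_one]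

lemma left_smul_bc (s t : K') (b : B) (m : M) :
    ((s ⊗ₜ[K] b) ⊗ₜ[K'] (1 : (K' ⊗[K] A)ᵐᵒᵖ)) • bc t m =
      bc (s * t) ((b ⊗ₜ[K] (1 : Aᵐᵒᵖ)) • m) := by
  rw [← MulOpposite.op_one, Algebra.TensorProduct.one_def, smul_bc, one_mul]
  rfl

lemma right_smul_bc (s t : K') (a : A) (m : M) :
    ((1 : K' ⊗[K] B) ⊗ₜ[K'] (MulOpposite.op (s ⊗ₜ[K] a))) • bc t m =
      bc (s * t) (((1 : B) ⊗ₜ[K] MulOpposite.op a) • m) := by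
  rw [Algebra.TensorProduct.one_def, smul_bc, one_mul]

lemma bc_induction {p : bcObj K' M → Prop} (x : bcObj K' M) (zero : p 0)
    (tmul : ∀ t m, p (bc t m)) (add : ∀ x y, p x → p y → p (x + y)) : p x := by
  change K' ⊗[K] M at x
  exact TensorProduct.induction_on x zero tmul add

/-- Additive maps out of `K' ⊗[K] M`. -/
def bcLiftAdd {P : Type*} [AddCommGroup P] (β : K' →+ M →+ P)
    (h : ∀ (k : K) (t : K') (m : M), β (k • t) m = β t (k • m)) : bcObj K' M →+ P :=
  TensorProduct.liftAddHom β h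

lemma bc_addHom_ext {P : Type*} [AddCommGroup P] {f g : bcObj K' M →+ P}
    (h : ∀ t m, f (bc t m) = g (bc t m)) : f = g := by
  ext x
  induction x using bc_induction with
  | zero => rw [map_zero, map_zero]
  | add x y hx hy => rw [map_add, map_add, hx, hy]
  | tmul t m => exact h t m

lemma bc_hom_ext {P : Bimod K' (K' ⊗[K] B) (K' ⊗[K] A)} {f g : bcObj K' M ⟶ P}
    (h : ∀ t m, f.hom (bc t m) = g.hom (bc t m)) : f = g := by
  ext x
  exact DFunLike.congr_fun
    (bc_addHom_ext (f := f.hom.toAddMonoidHom) (g := g.hom.toAddMonoidHom) h) x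

lemma bc_smul (k : K) (t : K') (m : M) : bc (k • t) m = bc t (k • m) :=
  TensorProduct.smul_tmul k t m

variable (M) in
/-- The pure tensor as a biadditive map. -/
def bcHom : K' →+ M →+ bcObj K' M :=
  AddMonoidHom.mk' (fun t ↦ AddMonoidHom.mk' (bc t) (bc_add_right t))
    fun t t' ↦ by ext n; exact bc_add_left t t' n

end

/-- An additive map that commutes with the actions of `(s ⊗ b) ⊗ (s' ⊗ a)` is a morphism of
bimodules. -/
def bimodHomMk' {M N : Bimod K' (K' ⊗[K] B) (K' ⊗[K] A)} (f : M →+ N)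
    (h : ∀ (s s' : K') (b : B) (a : A) (m : M),
      f (((s ⊗ₜ[K] b) ⊗ₜ[K'] (MulOpposite.op (s' ⊗ₜ[K] a))) • m) =
        ((s ⊗ₜ[K] b) ⊗ₜ[K'] (MulOpposite.op (s' ⊗ₜ[K] a))) • f m) : M ⟶ N :=
  bimodHomMk f fun b a m ↦ by
    obtain ⟨a, rfl⟩ := MulOpposite.op_surjective a
    induction b using TensorProduct.induction_on with
    | zero =>
      rw [TensorProduct.zero_tmul]
      exact (congrArg f (zero_smul ((K' ⊗[K] B) ⊗[K'] (K' ⊗[K] A)ᵐᵒᵖ) m)).trans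
        ((map_zero f).trans (zero_smul ((K' ⊗[K] B) ⊗[K'] (K' ⊗[K] A)ᵐᵒᵖ) (f m)).symm)
    | add x y hx hy => simp only [TensorProduct.add_tmul, add_smul, map_add, hx, hy]
    | tmul s b =>
      induction a using TensorProduct.induction_on with
      | zero =>
        rw [MulOpposite.op_zero, TensorProduct.tmul_zero]
        exact (congrArg f (zero_smul ((K' ⊗[K] B) ⊗[K'] (K' ⊗[K] A)ᵐᵒᵖ) m)).trans
          ((map_zero f).trans (zero_smul ((K' ⊗[K] B) ⊗[K'] (K' ⊗[K] A)ᵐᵒᵖ) (f m)).symm)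
      | add x y hx hy =>
        simp only [MulOpposite.op_add, TensorProduct.tmul_add, add_smul, map_add, hx, hy]
      | tmul s' a => exact h s s' b a m

variable (K K' B A) in
/-- The canonical homomorphism `B ⊗[K] Aᵐᵒᵖ → B' ⊗[K'] A'ᵐᵒᵖ`. -/
def scalarsHom : B ⊗[K] Aᵐᵒᵖ →ₐ[K] (K' ⊗[K] B) ⊗[K'] (K' ⊗[K] A)ᵐᵒᵖ :=
  Algebra.TensorProduct.lift
    ((Algebra.TensorProduct.includeLeft :
        K' ⊗[K] B →ₐ[K] (K' ⊗[K] B) ⊗[K'] (K' ⊗[K] A)ᵐᵒᵖ).comp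
      (Algebra.TensorProduct.includeRight : B →ₐ[K] K' ⊗[K] B))
    (((Algebra.TensorProduct.includeRight :
        (K' ⊗[K] A)ᵐᵒᵖ →ₐ[K'] (K' ⊗[K] B) ⊗[K'] (K' ⊗[K] A)ᵐᵒᵖ).restrictScalars K).comp
      (AlgHom.op (Algebra.TensorProduct.includeRight : A →ₐ[K] K' ⊗[K] A)))
    (fun b a ↦ by
      simp [commute_iff_eq])

lemma scalarsHom_tmul (b : B) (a : A) :
    scalarsHom K K' B A (b ⊗ₜ MulOpposite.op a) =
      ((1 : K') ⊗ₜ[K] b) ⊗ₜ[K'] MulOpposite.op ((1 : K') ⊗ₜ[K] a) := by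
  refine (Algebra.TensorProduct.lift_tmul _ _ _ b (MulOpposite.op a)).trans ?_
  change (((1 : K') ⊗ₜ[K] b) ⊗ₜ[K'] (1 : (K' ⊗[K] A)ᵐᵒᵖ)) *
    ((1 : K' ⊗[K] B) ⊗ₜ[K'] MulOpposite.op ((1 : K') ⊗ₜ[K] a)) = _
  rw [Algebra.TensorProduct.tmul_mul_tmul, mul_one, one_mul]

/-- The image of `scalarsHom` spans the target over `K'`. Hence a semilinear map out of `M` extends
to a morphism of bimodules out of `K' ⊗ M`. -/
lemma tmul_tmul_op_eq_smul (s s' : K') (b : B) (a : A) :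
    (s ⊗ₜ[K] b) ⊗ₜ[K'] (MulOpposite.op (s' ⊗ₜ[K] a)) =
      (s * s') • scalarsHom K K' B A (b ⊗ₜ MulOpposite.op a) := by
  have hs : s ⊗ₜ[K] b = s • ((1 : K') ⊗ₜ[K] b) := by
    rw [TensorProduct.smul_tmul', smul_eq_mul, mul_one]
  have hs' : MulOpposite.op (s' ⊗ₜ[K] a) = s' • MulOpposite.op ((1 : K') ⊗ₜ[K] a) := by
    rw [← MulOpposite.op_smul, TensorProduct.smul_tmul', smul_eq_mul, mul_one]
  rw [hs, hs', TensorProduct.tmul_smul, ← TensorProduct.smul_tmul', smul_smul, mul_comm,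
    scalarsHom_tmul]

variable (K K' B A) in
/-- Restriction of scalars, right adjoint to the base change functor. -/
abbrev bcRestrict : Bimod K' (K' ⊗[K] B) (K' ⊗[K] A) ⥤ Bimod K B A :=
  ModuleCat.restrictScalars (scalarsHom K K' B A).toRingHom

/-- The additive map `K' ⊗[K] M → N` that corresponds to a semilinear map `M → N`. -/
def bcDescAdd {M : Bimod K B A} {N : Bimod K' (K' ⊗[K] B) (K' ⊗[K] A)} (φ : M →+ N)
    (h : ∀ (r : B ⊗[K] Aᵐᵒᵖ) (m : M), φ (r • m) = scalarsHom K K' B A r • φ m) :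
    bcObj K' M →+ N :=
  bcLiftAdd (AddMonoidHom.mk' (fun t ↦ AddMonoidHom.mk' (fun m ↦ t • φ m)
        (fun m m' ↦ by rw [map_add, smul_add]))
        (fun t t' ↦ by ext m; exact add_smul t t' _))
      (fun k t m ↦ by
        change (k • t) • φ m = t • φ (k • m)
        rw [← algebraMap_smul (B ⊗[K] Aᵐᵒᵖ) k m, h, AlgHom.commutes,
          IsScalarTower.algebraMap_apply K K' ((K' ⊗[K] B) ⊗[K'] _),
          algebraMap_smul, smul_smul, Algebra.smul_def, mul_comm])

lemma bcDescAdd_bc {M : Bimod K B A} {N : Bimod K' (K' ⊗[K] B) (K' ⊗[K] A)} (φ : M →+ N) (h)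
    (t : K') (m : M) : bcDescAdd φ h (bc t m) = t • φ m := rfl

/-- The morphism `K' ⊗[K] M ⟶ N` that corresponds to a semilinear map `M → N`. -/
def bcDescAux {M : Bimod K B A} {N : Bimod K' (K' ⊗[K] B) (K' ⊗[K] A)} (φ : M →+ N)
    (h : ∀ (r : B ⊗[K] Aᵐᵒᵖ) (m : M), φ (r • m) = scalarsHom K K' B A r • φ m) :
    bcObj K' M ⟶ N :=
  bimodHomMk' (M := bcObj K' M) (N := N) (bcDescAdd φ h)
    (fun s s' b a x ↦ by
      induction x using bc_induction with
      | zero => rw [smul_zero, map_zero, smul_zero]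
      | add x y hx hy => rw [smul_add, map_add, map_add, smul_add, hx, hy]
      | tmul t m =>
        rw [smul_bc, bcDescAdd_bc, bcDescAdd_bc, h, tmul_tmul_op_eq_smul, smul_comm _ t,
          smul_assoc, smul_smul t, ← mul_assoc, mul_comm _ t])

lemma bcDescAux_bc {M : Bimod K B A} {N : Bimod K' (K' ⊗[K] B) (K' ⊗[K] A)} (φ : M →+ N) (h)
    (t : K') (m : M) : (bcDescAux φ h).hom (bc t m) = t • φ m := rfl

/-- The morphism `K' ⊗[K] M ⟶ N` that corresponds to `M ⟶ N`. -/
def bcDesc {M : Bimod K B A} {N : Bimod K' (K' ⊗[K] B) (K' ⊗[K] A)}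
    (f : M ⟶ (bcRestrict K K' B A).obj N) : bcObj K' M ⟶ N :=
  bcDescAux f.hom.toAddMonoidHom f.hom.map_smul

lemma bcDesc_bc {M : Bimod K B A} {N : Bimod K' (K' ⊗[K] B) (K' ⊗[K] A)}
    (f : M ⟶ (bcRestrict K K' B A).obj N) (t : K') (m : M) :
    (bcDesc f).hom (bc t m) = t • (show N from f.hom m) := rfl

lemma scalarsHom_smul_bc {M : Bimod K B A} (r : B ⊗[K] Aᵐᵒᵖ) (t : K') (m : M) :
    scalarsHom K K' B A r • bc t m = bc t (r • m) := by
  induction r using TensorProduct.induction_on with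
  | zero =>
    rw [map_zero]
    exact (zero_smul ((K' ⊗[K] B) ⊗[K'] (K' ⊗[K] A)ᵐᵒᵖ) _).trans
      ((congrArg (bc t) (zero_smul (B ⊗[K] Aᵐᵒᵖ) m)).trans (bc_zero_right t)).symm
  | add x y hx hy => rw [map_add, add_smul, hx, hy, add_smul, bc_add_right]
  | tmul b a =>
    obtain ⟨a, rfl⟩ := MulOpposite.op_surjective a
    rw [scalarsHom_tmul, smul_bc, one_mul, one_mul]

lemma smul_bc_left {M : Bimod K B A} (s t : K') (m : M) : s • bc t m = bc (s * t) m := by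
  rw [kModule_smul_eq_left, Algebra.TensorProduct.algebraMap_apply, left_smul_bc,
    ← Algebra.TensorProduct.one_def, one_smul]
  rfl

/-- The morphism `m ↦ 1 ⊗ m`. -/
def bcUnit (M : Bimod K B A) : M ⟶ (bcRestrict K K' B A).obj (bcObj K' M) :=
  ModuleCat.ofHom (Y := (bcRestrict K K' B A).obj (bcObj K' M))
    { toFun := fun m ↦ bc (1 : K') m
      map_add' := bc_add_right 1
      map_smul' := fun r m ↦ (scalarsHom_smul_bc r 1 m).symm }

variable (K K' B A) in
/-- The base change functor is left adjoint to the restriction of scalars. -/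
def bcAdjunction : baseChangeFunctor K K' B A ⊣ bcRestrict K K' B A :=
  Adjunction.mkOfHomEquiv
    { homEquiv := fun M N ↦
        { toFun := fun g ↦ bcUnit M ≫ (bcRestrict K K' B A).map g
          invFun := bcDesc
          left_inv := fun g ↦ bc_hom_ext fun t m ↦ by
            rw [bcDesc_bc]
            change t • g.hom (bc 1 m) = _
            rw [kModule_smul_eq_left, ← map_smul, ← kModule_smul_eq_left, smul_bc_left, mul_one]
          right_inv := fun f ↦ by
            ext m
            exact one_smul K' (show N from f.hom m) }
      homEquiv_naturality_left_symm := fun f g ↦ bc_hom_ext fun t m ↦ rfl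
      homEquiv_naturality_right := fun f g ↦ rfl }

instance : (baseChangeFunctor K K' B A).IsLeftAdjoint := (bcAdjunction K K' B A).isLeftAdjoint

/-- A left adjoint preserves projectives when its right adjoint, here restriction of scalars,
preserves epimorphisms. -/
instance (M : Bimod K B A) [Projective M] : Projective (bcObj K' M) :=
  have : (bcRestrict K K' B A).PreservesEpimorphisms := inferInstance
  (bcAdjunction K K' B A).map_projective M inferInstance

end BaseChangeAlgebra

/-! ### Base change of tensor products and of diagonal bimodules -/

section BaseChangeTensor

variable {K : Type u} [CommRing K] {K' : Type u} [CommRing K'] [Algebra K K']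
  {B A C : Type u} [Ring B] [Algebra K B] [Ring A] [Algebra K A] [Ring C] [Algebra K C]

lemma tensorProduct_induction {V W : Type*} [AddCommGroup V] [Module K V] [AddCommGroup W]
    [Module K W] {p : V ⊗[K] W → Prop} (x : V ⊗[K] W) (tmul : ∀ v w, p (v ⊗ₜ w))
    (add : ∀ x y, p x → p y → p (x + y)) : p x :=
  TensorProduct.induction_on x (by simpa using tmul 0 0) tmul add

lemma smul_tm_left {M : Bimod K B A} {N : Bimod K A C} (k : K) (m : M) (n : N) :
    tm (k • m) n = k • tm m n := by
  rw [kModule_smul_eq_left k, kModule_smul_eq_left k, smul_tm, ← Algebra.TensorProduct.one_def,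
    one_smul]

lemma smul_tm_right {M : Bimod K B A} {N : Bimod K A C} (k : K) (m : M) (n : N) :
    tm m (k • n) = k • tm m n := by
  rw [kModule_smul_eq_right k, kModule_smul_eq_right k, smul_tm, ← Algebra.TensorProduct.one_def,
    one_smul]

section

variable (M : Bimod K B A) (N : Bimod K A C)

/-- The additive map `m ⊗ n ↦ (1 ⊗ m) ⊗ (1 ⊗ n)`. -/
def bcTensorAux : tensorObj M N →+ tensorObj (bcObj K' M) (bcObj K' N) :=
  tensorLiftAdd
    (AddMonoidHom.mk' (fun m ↦ (tmHom (bcObj K' M) (bcObj K' N) (bc 1 m)).comp (bcHom N 1))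
      (fun m m' ↦ by rw [bc_add_right, map_add, AddMonoidHom.add_comp]))
    (fun a m n ↦ by
      change tm (bc 1 _) (bc 1 n) = tm (bc 1 m) (bc 1 _)
      have h₁ := right_smul_bc (1 : K') 1 a m
      have h₂ := left_smul_bc (1 : K') 1 a n
      rw [mul_one] at h₁ h₂
      rw [← h₁, ← h₂, tm_balanced])

lemma bcTensorAux_tm (m : M) (n : N) :
    bcTensorAux M N (tm m n) = tm (bc (1 : K') m) (bc (1 : K') n) := rfl

/-- The morphism `K' ⊗ (M ⊗_A N) ⟶ (K' ⊗ M) ⊗_{A'} (K' ⊗ N)`. -/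
def bcTensorHom : bcObj K' (tensorObj M N) ⟶ tensorObj (bcObj K' M) (bcObj K' N) :=
  bcDescAux (bcTensorAux M N) fun r x ↦ by
    induction x using tensorObj_induction with
    | zero => rw [smul_zero, map_zero, smul_zero]
    | add x y hx hy => rw [smul_add, map_add, map_add, smul_add, hx, hy]
    | tmul m n =>
      induction r using tensorProduct_induction with
      | add x y hx hy => rw [add_smul, map_add, hx, hy, map_add, add_smul]
      | tmul b c =>
        obtain ⟨c, rfl⟩ := MulOpposite.op_surjective c
        have h₁ := left_smul_bc (A := A) (1 : K') 1 b m
        have h₂ := right_smul_bc (B := A) (1 : K') 1 c n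
        rw [mul_one] at h₁ h₂
        rw [smul_tm, bcTensorAux_tm, bcTensorAux_tm, scalarsHom_tmul, smul_tm, h₁, h₂]

lemma bcTensorHom_bc (t : K') (m : M) (n : N) :
    (bcTensorHom M N).hom (bc t (tm m n)) = tm (bc t m) (bc 1 n) := by
  rw [bcTensorHom, bcDescAux_bc, bcTensorAux_tm, ← smul_tm_left, smul_bc_left, mul_one]

/-- The additive map `(t ⊗ m) ↦ (s ⊗ n) ↦ t s ⊗ (m ⊗ n)`. -/
def bcTensorInvAux : bcObj K' M →+ bcObj K' N →+ bcObj K' (tensorObj M N) :=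
  bcLiftAdd
    (AddMonoidHom.mk' (fun t ↦ AddMonoidHom.mk' (fun m ↦
        bcLiftAdd
          (AddMonoidHom.mk' (fun s ↦ (bcHom (tensorObj M N) (t * s)).comp (tmHom M N m))
            (fun s s' ↦ by rw [mul_add, map_add, AddMonoidHom.add_comp]))
          (fun k s n ↦ by
            change bc (t * k • s) (tm m n) = bc (t * s) (tm m (k • n))
            rw [smul_tm_right, ← bc_smul, mul_smul_comm]))
        (fun m m' ↦ bc_addHom_ext fun s n ↦ by
          change bc (t * s) (tm (m + m') n) = bc (t * s) (tm m n) + bc (t * s) (tm m' n)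
          rw [tm_add_left, bc_add_right]))
      (fun t t' ↦ by
        ext m : 1
        refine bc_addHom_ext fun s n ↦ ?_
        change bc ((t + t') * s) (tm m n) = bc (t * s) (tm m n) + bc (t' * s) (tm m n)
        rw [add_mul, bc_add_left]))
    (fun k t m ↦ bc_addHom_ext fun s n ↦ by
      change bc ((k • t) * s) (tm m n) = bc (t * s) (tm (k • m) n)
      rw [smul_tm_left, ← bc_smul, smul_mul_assoc])

lemma bcTensorInvAux_bc (t s : K') (m : M) (n : N) :
    bcTensorInvAux M N (bc t m) (bc s n) = bc (t * s) (tm m n) := rfl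

variable {M N} in
lemma bcTensorInvAux_balanced (a : K' ⊗[K] A) (x : bcObj K' M) (y : bcObj K' N) :
    bcTensorInvAux M N (((1 : K' ⊗[K] B) ⊗ₜ[K'] MulOpposite.op a) • x) y =
      bcTensorInvAux M N x ((a ⊗ₜ[K'] (1 : (K' ⊗[K] C)ᵐᵒᵖ)) • y) := by
  induction x using bc_induction with
  | zero => simp
  | add x y hx hy => simp only [smul_add, map_add, AddMonoidHom.add_apply, hx, hy]
  | tmul t m =>
    induction y using bc_induction with
    | zero => simp
    | add x y hx hy => simp only [smul_add, map_add, hx, hy]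
    | tmul s n =>
      induction a using tensorProduct_induction with
      | add x y hx hy =>
        rw [MulOpposite.op_add, TensorProduct.tmul_add, TensorProduct.add_tmul, add_smul,
          add_smul, map_add, map_add, AddMonoidHom.add_apply, hx, hy]
      | tmul r a =>
        rw [right_smul_bc, left_smul_bc, bcTensorInvAux_bc, bcTensorInvAux_bc, tm_balanced,
          mul_left_comm t r s, mul_assoc r t s]

variable {M N} in
lemma bcTensorInvAux_smul (b : K' ⊗[K] B) (c : (K' ⊗[K] C)ᵐᵒᵖ) (x : bcObj K' M)
    (y : bcObj K' N) :
    bcTensorInvAux M N ((b ⊗ₜ[K'] (1 : (K' ⊗[K] A)ᵐᵒᵖ)) • x) (((1 : K' ⊗[K] A) ⊗ₜ[K'] c) • y) =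
      (b ⊗ₜ[K'] c) • bcTensorInvAux M N x y := by
  obtain ⟨c, rfl⟩ := MulOpposite.op_surjective c
  induction x using bc_induction with
  | zero => simp
  | add x y hx hy => simp only [smul_add, map_add, AddMonoidHom.add_apply, hx, hy]
  | tmul t m =>
    induction y using bc_induction with
    | zero => simp
    | add x y hx hy => simp only [smul_add, map_add, hx, hy]
    | tmul s n =>
      induction b using tensorProduct_induction with
      | add x y hx hy =>
        rw [TensorProduct.add_tmul, TensorProduct.add_tmul, add_smul, add_smul, map_add,
          AddMonoidHom.add_apply, hx, hy]
      | tmul r b =>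
        induction c using tensorProduct_induction with
        | add x y hx hy =>
          rw [MulOpposite.op_add, TensorProduct.tmul_add, TensorProduct.tmul_add, add_smul,
            add_smul, map_add, hx, hy]
        | tmul r' c =>
          have h : r * t * (r' * s) = r * (r' * (t * s)) := by ring
          rw [left_smul_bc, right_smul_bc, bcTensorInvAux_bc, bcTensorInvAux_bc, smul_bc,
            smul_tm, h]

/-- The morphism `(K' ⊗ M) ⊗_{A'} (K' ⊗ N) ⟶ K' ⊗ (M ⊗_A N)`. -/
def bcTensorInv : tensorObj (bcObj K' M) (bcObj K' N) ⟶ bcObj K' (tensorObj M N) :=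
  tensorLift (bcTensorInvAux M N) bcTensorInvAux_balanced bcTensorInvAux_smul

lemma bcTensorInv_tm (t s : K') (m : M) (n : N) :
    (bcTensorInv M N).hom (tm (bc t m) (bc s n)) = bc (t * s) (tm m n) := by
  rw [bcTensorInv, tensorLift_tm, bcTensorInvAux_bc]

variable {M N} in
lemma bcTensor_hom_ext {P : Bimod K' (K' ⊗[K] B) (K' ⊗[K] C)}
    {f g : bcObj K' (tensorObj M N) ⟶ P}
    (h : ∀ t m n, f.hom (bc t (tm m n)) = g.hom (bc t (tm m n))) : f = g :=
  bc_hom_ext fun t x ↦ by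
    induction x using tensorObj_induction with
    | zero => rw [bc_zero_right, map_zero, map_zero]
    | add x y hx hy => rw [bc_add_right, map_add, map_add, hx, hy]
    | tmul m n => exact h t m n

/-- The isomorphism `K' ⊗ (M ⊗_A N) ≅ (K' ⊗ M) ⊗_{A'} (K' ⊗ N)`. -/
def bcTensorIso : bcObj K' (tensorObj M N) ≅ tensorObj (bcObj K' M) (bcObj K' N) where
  hom := bcTensorHom M N
  inv := bcTensorInv M N
  hom_inv_id := bcTensor_hom_ext fun t m n ↦ by
    rw [ModuleCat.comp_apply, bcTensorHom_bc, bcTensorInv_tm, mul_one]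
    rfl
  inv_hom_id := tensorObj_hom_ext fun x y ↦ by
    induction x using bc_induction with
    | zero => rw [tm_zero_left, map_zero, map_zero]
    | add x y hx hy => rw [tm_add_left, map_add, map_add, hx, hy]
    | tmul t m =>
      induction y using bc_induction with
      | zero => rw [tm_zero_right, map_zero, map_zero]
      | add x y hx hy => rw [tm_add_right, map_add, map_add, hx, hy]
      | tmul s n =>
        -- The composite puts the whole scalar `t * s` on the left factor; since `K'` is central,
        -- `s` can be moved back across the tensor sign.
        rw [ModuleCat.comp_apply, bcTensorInv_tm, bcTensorHom_bc, mul_comm, ← smul_bc_left, smul_tm_left, ← smul_tm_right, smul_bc_left, mul_one]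
        rfl

end

variable (K A) in
/-- The diagonal bimodule of `A` is `A` as a `K`-module. -/
def diagLinearEquiv : A ≃ₗ[K] diagonal K A :=
  { diag K with
    map_smul' := fun k a ↦ by
      change k • a = AlgHom.mulLeftRight K A (algebraMap K (A ⊗[K] Aᵐᵒᵖ) k) a
      rw [AlgHom.commutes]
      rfl }

lemma flat_diagonal [Module.Flat K A] : Module.Flat K (diagonal K A) :=
  Module.Flat.of_linearEquiv (diagLinearEquiv K A).symm

variable (K K' A) in
/-- The additive equivalence between `K' ⊗ A` and the diagonal bimodule of `A'`. -/
def bcDiagonalAddEquiv : bcObj K' (diagonal K A) ≃+ diagonal K' (K' ⊗[K] A) :=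
  (LinearEquiv.lTensor K' (diagLinearEquiv K A)).symm.toAddEquiv.trans (diag K')

lemma bcDiagonalAddEquiv_bc (t : K') (a : A) :
    bcDiagonalAddEquiv K K' A (bc t (diag K a)) = diag K' (t ⊗ₜ[K] a) := rfl

variable (K K' A) in
/-- The morphism from `K' ⊗ A` to the diagonal bimodule of `A'`. -/
def bcDiagonalHom : bcObj K' (diagonal K A) ⟶ diagonal K' (K' ⊗[K] A) :=
  bimodHomMk' (bcDiagonalAddEquiv K K' A).toAddMonoidHom fun s s' b a x ↦ by
    rw [AddEquiv.coe_toAddMonoidHom]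
    induction x using bc_induction with
    | zero => simp
    | add x y hx hy => rw [smul_add, map_add, map_add, smul_add, hx, hy]
    | tmul t m =>
      obtain ⟨m, rfl⟩ := (diag K).surjective m
      rw [smul_bc, smul_diag, bcDiagonalAddEquiv_bc, bcDiagonalAddEquiv_bc, smul_diag,
        MulOpposite.unop_op, MulOpposite.unop_op, Algebra.TensorProduct.tmul_mul_tmul,
        Algebra.TensorProduct.tmul_mul_tmul, mul_comm s' t, ← mul_assoc s t s', mul_assoc b m a]

instance : IsIso (bcDiagonalHom K K' A) :=
  (ConcreteCategory.isIso_iff_bijective _).2 (bcDiagonalAddEquiv K K' A).bijective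

end BaseChangeTensor

/-! ### Bounded above exact complexes of flat modules -/

section FlatExact

variable {K : Type u} [CommRing K]

/-- Flatness of `N` makes `ker f ⊗ V → M ⊗ V` injective for every `V`. Injectivity of `ker f ⊗ P →
ker f ⊗ Q` then follows from that of `M ⊗ P → M ⊗ Q`. -/
lemma flat_ker_of_surjective {M N : Type u} [AddCommGroup M] [Module K M] [AddCommGroup N]
    [Module K N] [Module.Flat K M] [Module.Flat K N] (f : M →ₗ[K] N)
    (hf : Function.Surjective f) : Module.Flat K (LinearMap.ker f) := by
  rw [Module.Flat.iff_lTensor_preserves_injective_linearMap]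
  intro P Q _ _ _ _ j hj
  have h₁ (V : Type u) [AddCommGroup V] [Module K V] :
      Function.Injective ((LinearMap.ker f).subtype.rTensor V) := by
    have := LinearMap.lTensor_injective_of_exact_of_flat f hf (LinearMap.ker f).subtype
      (LinearMap.ker f).injective_subtype (LinearMap.exact_subtype_ker_map f) V
    rwa [LinearMap.lTensor_inj_iff_rTensor_inj] at this
  have h₂ : Function.Injective ((j.lTensor M).comp ((LinearMap.ker f).subtype.rTensor P)) :=
    (Module.Flat.lTensor_preserves_injective_linearMap j hj).comp (h₁ P)
  rw [LinearMap.lTensor_comp_rTensor, ← LinearMap.rTensor_comp_lTensor] at h₂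
  exact Function.Injective.of_comp h₂

/-- An element of `(M × N) ⊗ P` is the sum of the contributions of its two projections, and each
projection vanishes by flatness of the corresponding factor. -/
lemma flat_prod (M N : Type u) [AddCommGroup M] [Module K M] [AddCommGroup N]
    [Module K N] [Module.Flat K M] [Module.Flat K N] : Module.Flat K (M × N) := by
  rw [Module.Flat.iff_lTensor_preserves_injective_linearMap]
  intro P Q _ _ _ _ j hj
  rw [injective_iff_map_eq_zero]
  intro x hx
  have h {L : Type u} [AddCommGroup L] [Module K L] [Module.Flat K L] (f : M × N →ₗ[K] L) :
      f.rTensor P x = 0 := by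
    have h₁ := congrArg (f.rTensor Q) hx
    rw [map_zero, ← LinearMap.comp_apply, LinearMap.rTensor_comp_lTensor,
      ← LinearMap.lTensor_comp_rTensor, LinearMap.comp_apply] at h₁
    exact (map_eq_zero_iff _ (Module.Flat.lTensor_preserves_injective_linearMap (M := L) j hj)).1 h₁
  have h₂ : (LinearMap.inl K M N ∘ₗ LinearMap.fst K M N) +
      (LinearMap.inr K M N ∘ₗ LinearMap.snd K M N) = LinearMap.id := by ext <;> simp
  have h₃ := congrArg (fun f : M × N →ₗ[K] M × N ↦ f.rTensor P x) h₂
  simpa [LinearMap.rTensor_add, LinearMap.rTensor_comp, h] using h₃.symm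

/-- Cut the complex into short exact sequences. Descending from the top, where everything vanishes,
each image is the kernel of a surjection between flat modules and so is flat. The short exact
sequences therefore remain exact after tensoring and can be spliced again. -/
lemma exact_lTensor_of_flat (X : ℤ → Type u) [∀ i, AddCommGroup (X i)] [∀ i, Module K (X i)]
    [∀ i, Module.Flat K (X i)] (d : ∀ i, X i →ₗ[K] X (i + 1))
    (hd : ∀ i, Function.Exact (d i) (d (i + 1))) (p : ℤ) (hp : ∀ i, p < i → Subsingleton (X i))
    (V : Type u) [AddCommGroup V] [Module K V] (i : ℤ) :
    Function.Exact ((d i).lTensor V) ((d (i + 1)).lTensor V) := by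
  -- Induction on the distance to the bound `p`; for `p ≤ i` the differential `d i` has zero target.
  have hflat (n : ℕ) : ∀ i, p ≤ i + n → Module.Flat K (LinearMap.range (d i)) := by
    induction n with
    | zero =>
      intro i hi
      have := hp (i + 1) (by push_cast at hi; lia)
      infer_instance
    | succ n ih =>
      intro i hi
      have := ih (i + 1) (by push_cast at hi; lia)
      have := flat_ker_of_surjective (d (i + 1)).rangeRestrict (d (i + 1)).surjective_rangeRestrict
      rwa [LinearMap.ker_rangeRestrict, (LinearMap.exact_iff.1 (hd i))] at this
  -- Flatness of the image two steps further is what keeps the inclusion of the image of `d (i + 1)`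
  -- injective after tensoring with `V`.
  have := hflat (p - (i + 1 + 1)).toNat (i + 1 + 1) (by lia)
  have h₁ : Function.Exact (d i) (d (i + 1)).rangeRestrict := by
    rw [LinearMap.exact_iff, LinearMap.ker_rangeRestrict]
    exact LinearMap.exact_iff.1 (hd i)
  have h₂ : Function.Exact (LinearMap.range (d (i + 1))).subtype
      (d (i + 1 + 1)).rangeRestrict := by
    rw [LinearMap.exact_iff, LinearMap.ker_rangeRestrict, Submodule.range_subtype]
    exact LinearMap.exact_iff.1 (hd (i + 1))
  have h₃ := LinearMap.lTensor_injective_of_exact_of_flat _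
    (d (i + 1 + 1)).surjective_rangeRestrict _ (Submodule.injective_subtype _) h₂ V
  have h₄ := lTensor_exact V h₁ (d (i + 1)).surjective_rangeRestrict
  have h₅ : (d (i + 1)).lTensor V =
      ((LinearMap.range (d (i + 1))).subtype.lTensor V).comp
        ((d (i + 1)).rangeRestrict.lTensor V) := by
    rw [← LinearMap.lTensor_comp]
    rfl
  rw [h₅]
  intro y
  rw [← h₄ y, LinearMap.comp_apply, map_eq_zero_iff _ h₃]

end FlatExact

/-! ### Base change of complexes of flat bimodules -/

section FlatBimodules

variable {K : Type u} [CommRing K] {K' : Type u} [CommRing K'] [Algebra K K']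
  {B A C : Type u} [Ring B] [Algebra K B] [Ring A] [Algebra K A] [Ring C] [Algebra K C]

lemma flat_of_bimod_retract {M N : Bimod K B A} [Module.Flat K N] (i : M ⟶ N) (r : N ⟶ M)
    (h : i ≫ r = 𝟙 M) : Module.Flat K M :=
  Module.Flat.of_retract (kHom i) (kHom r) (LinearMap.ext fun x ↦ congr($(h).hom x))

lemma flat_of_bimod_iso {M N : Bimod K B A} [Module.Flat K N] (e : M ≅ N) : Module.Flat K M :=
  flat_of_bimod_retract e.hom e.inv e.hom_inv_id

open DirectSum in
lemma flat_directSumBimod {J : Type} [DecidableEq J] (Z : J → Bimod K B A)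
    [∀ j, Module.Flat K (Z j)] : Module.Flat K (directSumBimod Z) :=
  let e : directSumBimod Z ≃ₗ[K] (⨁ j, Z j) :=
    { AddEquiv.refl (⨁ j, Z j) with
      map_smul' := fun _ _ ↦ rfl }
  Module.Flat.of_linearEquiv e

lemma flat_of_isColimit {J : Type} (Z : J → Bimod K B A) [∀ j, Module.Flat K (Z j)]
    (c : Cofan Z) (hc : IsColimit c) : Module.Flat K c.pt := by
  classical
  have : Module.Flat K (ModuleCat.coproductCocone Z).pt := flat_directSumBimod Z
  exact flat_of_bimod_iso (hc.coconePointUniqueUpToIso (ModuleCat.coproductCoconeIsColimit Z))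

lemma flat_of_isZero {M : Bimod K B A} (h : IsZero M) : Module.Flat K M := by
  have := ModuleCat.subsingleton_of_isZero h
  infer_instance

open ComplexShape

/-- Each degree is a coproduct of modules covered by `flat_tensorObj`. -/
lemma flat_tensorComplex [Module.Flat K B] (P : CochainComplex (Bimod K B A) ℤ)
    (Q : CochainComplex (Bimod K A C) ℤ) (hP : ∀ i, Projective (P.X i))
    (hQ : ∀ i, Module.Flat K (Q.X i)) (n : ℤ) : Module.Flat K ((tensorComplex P Q).X n) := by
  have (j : ComplexShape.π (up ℤ) (up ℤ) (up ℤ) ⁻¹' {n}) :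
      Module.Flat K (tensorObj (P.X j.1.1) (Q.X j.1.2)) := flat_tensorObj _ _
  exact flat_of_isColimit (fun j : ComplexShape.π (up ℤ) (up ℤ) (up ℤ) ⁻¹' {n} ↦
    tensorObj (P.X j.1.1) (Q.X j.1.2)) _ (GradedObject.isColimitCofanMapObj
    (((GradedObject.mapBifunctor (tensorFunctor K B A C) ℤ ℤ).obj P.X).obj Q.X)
    (ComplexShape.π (up ℤ) (up ℤ) (up ℤ)) n)

/-- The base change of complexes of bimodules. -/
abbrev bcComplex (K' : Type u) [CommRing K'] [Algebra K K'] (X : CochainComplex (Bimod K B A) ℤ) :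
    CochainComplex (Bimod K' (K' ⊗[K] B) (K' ⊗[K] A)) ℤ :=
  ((baseChangeFunctor K K' B A).mapHomologicalComplex (up ℤ)).obj X

/-- Exactness can be tested on underlying `K`-modules, where `exact_lTensor_of_flat` applies. -/
lemma acyclic_bcComplex (X : CochainComplex (Bimod K B A) ℤ) (p : ℤ) [X.IsStrictlyLE p]
    (hX : ∀ i, Module.Flat K (X.X i)) (h : X.Acyclic) : (bcComplex K' X).Acyclic := by
  intro n
  obtain ⟨i, rfl⟩ : ∃ i, i + 1 = n := ⟨n - 1, by simp⟩
  have h' (j : ℤ) : Function.Exact (kHom (X.d j (j + 1))) (kHom (X.d (j + 1) (j + 1 + 1))) := by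
    have := h (j + 1)
    rw [HomologicalComplex.exactAt_iff' _ j (j + 1) (j + 1 + 1) (by simp) (by simp),
      ShortComplex.moduleCat_exact_iff] at this
    exact fun y ↦ ⟨this y, by
      rintro ⟨x, rfl⟩
      exact congr($(X.d_comp_d j (j + 1) (j + 1 + 1)).hom x)⟩
  rw [HomologicalComplex.exactAt_iff' _ i (i + 1) (i + 1 + 1) (by simp) (by simp),
    ShortComplex.moduleCat_exact_iff]
  intro x hx
  exact (exact_lTensor_of_flat (fun i ↦ X.X i) (fun j ↦ kHom (X.d j (j + 1))) h' p
    (fun j hj ↦ ModuleCat.subsingleton_of_isZero (X.isZero_of_isStrictlyLE p j hj)) K' i x).1 hx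

/-- Base change commutes with mapping cones. The cone of `f` is acyclic and bounded above with terms
`X^(i+1) ⊕ Y^i`, which are flat, so its base change is acyclic. -/
lemma quasiIso_bcComplex_map {X Y : CochainComplex (Bimod K B A) ℤ} (f : X ⟶ Y) [QuasiIso f]
    (p : ℤ) [X.IsStrictlyLE p] [Y.IsStrictlyLE p]
    (hX : ∀ i, Module.Flat K (X.X i)) (hY : ∀ i, Module.Flat K (Y.X i)) :
    QuasiIso (((baseChangeFunctor K K' B A).mapHomologicalComplex (up ℤ)).map f) := by
  rw [quasiIso_iff_acyclic_mappingCone]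
  refine fun n ↦ HomologicalComplex.ExactAt.of_iso ?_
    (CochainComplex.mappingCone.mapHomologicalComplexIso f (baseChangeFunctor K K' B A))
  have : (CochainComplex.mappingCone f).IsStrictlyLE p := by
    rw [CochainComplex.isStrictlyLE_iff]
    intro i hi
    rw [CochainComplex.mappingCone.isZero_X_iff]
    exact ⟨X.isZero_of_isStrictlyLE p _ (by lia), Y.isZero_of_isStrictlyLE p _ hi⟩
  refine acyclic_bcComplex _ p (fun i ↦ ?_) ((quasiIso_iff_acyclic_mappingCone f).1 inferInstance) n
  have : Module.Flat K (ModuleCat.of (B ⊗[K] Aᵐᵒᵖ) (X.X (i + 1) × Y.X i)) := by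
    have := flat_prod (K := K) (X.X (i + 1)) (Y.X i)
    exact this
  exact flat_of_bimod_iso (HomologicalComplex.homotopyCofiber.XIsoBiprod f i (i + 1) rfl ≪≫
    ModuleCat.biprodIsoProd _ _)

end FlatBimodules

/-! ### Recognition of total complexes -/

section IsoMapBifunctor

universe v₁ v₂ v₃ w₁ w₂ w₃

open HomologicalComplex ComplexShape

variable {C₁ : Type w₁} {C₂ : Type w₂} {D : Type w₃} [Category.{v₁} C₁] [Category.{v₂} C₂]
  [Category.{v₃} D] [Abelian C₁] [Abelian C₂] [Abelian D]
  (F : C₁ ⥤ C₂ ⥤ D) [F.Additive] [∀ X, (F.obj X).Additive]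
  (X : CochainComplex C₁ ℤ) (Y : CochainComplex C₂ ℤ) [CochainComplex.HasMapBifunctor X Y F]
  (Z : CochainComplex D ℤ)

/-- The hypotheses `hext` and `hdesc` say that the `ψ i j n` exhibit `Z.X n` as the coproduct of the
`F(X^i, Y^j)`, and `hψ` says that the differential of `Z` is the total one. -/
lemma nonempty_mapBifunctor_iso
    (ψ : ∀ (i j n : ℤ), i + j = n → ((F.obj (X.X i)).obj (Y.X j) ⟶ Z.X n))
    (hψ : ∀ (i j n n' : ℤ) (h : i + j = n) (hn : n + 1 = n'), ψ i j n h ≫ Z.d n n' =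
      (F.map (X.d i (i + 1))).app (Y.X j) ≫ ψ (i + 1) j n' (by lia) +
        i.negOnePow • ((F.obj (X.X i)).map (Y.d j (j + 1)) ≫ ψ i (j + 1) n' (by lia)))
    (hext : ∀ (n : ℤ) {T : D} {f g : Z.X n ⟶ T}, (∀ i j h, ψ i j n h ≫ f = ψ i j n h ≫ g) → f = g)
    (hdesc : ∀ (n : ℤ) {T : D} (φ : ∀ (i j : ℤ), i + j = n → ((F.obj (X.X i)).obj (Y.X j) ⟶ T)),
      ∃ f : Z.X n ⟶ T, ∀ i j h, ψ i j n h ≫ f = φ i j h) :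
    Nonempty (mapBifunctor X Y F (up ℤ) ≅ Z) := by
  let α (n : ℤ) : (mapBifunctor X Y F (up ℤ)).X n ⟶ Z.X n :=
    mapBifunctorDesc fun i j h ↦ ψ i j n h
  have hα (i j n : ℤ) (h : i + j = n) : ιMapBifunctor X Y F (up ℤ) i j n h ≫ α n = ψ i j n h :=
    ι_mapBifunctorDesc _ _ _ _
  have (n : ℤ) : IsIso (α n) := by
    obtain ⟨β, hβ⟩ := hdesc n fun i j h ↦ ιMapBifunctor X Y F (up ℤ) i j n h
    refine ⟨β, mapBifunctor.hom_ext fun i j h ↦ ?_, hext n fun i j h ↦ ?_⟩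
    · rw [← Category.assoc, hα _ _ _ h, hβ _ _ h, Category.comp_id]
    · rw [← Category.assoc, hβ, hα, Category.comp_id]
  refine ⟨Hom.isoOfComponents (fun n ↦ asIso (α n)) fun n n' hn ↦
    mapBifunctor.hom_ext fun i j h ↦ ?_⟩
  rw [asIso_hom, asIso_hom, ← Category.assoc, hα _ _ _ h, ← Category.assoc,
    ι_mapBifunctor_d F X Y i j n h n' hn, hψ _ _ _ _ h hn, Preadditive.add_comp, Category.assoc,
    Linear.units_smul_comp, Category.assoc, hα, hα]

end IsoMapBifunctor

/-! ### Base change commutes with tensor products of complexes -/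

section BaseChangeTensorComplex

open HomologicalComplex ComplexShape

variable {K : Type u} [CommRing K] {K' : Type u} [CommRing K'] [Algebra K K']
  {B A C : Type u} [Ring B] [Algebra K B] [Ring A] [Algebra K A] [Ring C] [Algebra K C]

lemma bcTensorIso_inv_naturality_left {M M' : Bimod K B A} (N : Bimod K A C) (f : M ⟶ M') :
    ((tensorFunctor K' _ _ _).map ((baseChangeFunctor K K' B A).map f)).app (bcObj K' N) ≫
        (bcTensorIso M' N).inv =
      (bcTensorIso M N).inv ≫
        (baseChangeFunctor K K' B C).map (((tensorFunctor K B A C).map f).app N) := by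
  rw [Iso.comp_inv_eq, Category.assoc, Iso.eq_inv_comp]
  exact bcTensor_hom_ext fun t m n ↦ (congrArg
    (((tensorFunctor K' _ _ _).map ((baseChangeFunctor K K' B A).map f)).app (bcObj K' N)).hom
      (bcTensorHom_bc M N t m n)).trans (bcTensorHom_bc M' N t (f.hom m) n).symm

lemma bcTensorIso_inv_naturality_right (M : Bimod K B A) {N N' : Bimod K A C} (g : N ⟶ N') :
    ((tensorFunctor K' _ _ _).obj (bcObj K' M)).map ((baseChangeFunctor K K' A C).map g) ≫
        (bcTensorIso M N').inv =
      (bcTensorIso M N).inv ≫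
        (baseChangeFunctor K K' B C).map (((tensorFunctor K B A C).obj M).map g) := by
  rw [Iso.comp_inv_eq, Category.assoc, Iso.eq_inv_comp]
  exact bcTensor_hom_ext fun t m n ↦ (congrArg
    (((tensorFunctor K' _ _ _).obj (bcObj K' M)).map ((baseChangeFunctor K K' A C).map g)).hom
      (bcTensorHom_bc M N t m n)).trans (bcTensorHom_bc M N' t m (g.hom n)).symm

variable (K') (X : CochainComplex (Bimod K B A) ℤ) (Y : CochainComplex (Bimod K A C) ℤ)

/-- The base change of the total tensor product in degree `n` is a coproduct. -/
def isColimitBcTensorComplex (n : ℤ) :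
    IsColimit (Cofan.mk ((baseChangeFunctor K K' B C).obj ((tensorComplex X Y).X n))
      fun j : ComplexShape.π (up ℤ) (up ℤ) (up ℤ) ⁻¹' {n} ↦ (baseChangeFunctor K K' B C).map
        (ιMapBifunctor X Y (tensorFunctor K B A C) (up ℤ) j.1.1 j.1.2 n j.2)) :=
  isColimitCofanMkObjOfIsColimit (baseChangeFunctor K K' B C) _ _
    (GradedObject.isColimitCofanMapObj
      (((GradedObject.mapBifunctor (tensorFunctor K B A C) ℤ ℤ).obj X.X).obj Y.X)
      (ComplexShape.π (up ℤ) (up ℤ) (up ℤ)) n)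

/-- The inclusions `K' ⊗ X^i ⊗ Y^j ⟶ K' ⊗ (X ⊗ Y)^n`. -/
def ιBcTensorComplex (i j n : ℤ) (h : i + j = n) :
    tensorObj (bcObj K' (X.X i)) (bcObj K' (Y.X j)) ⟶
      (baseChangeFunctor K K' B C).obj ((tensorComplex X Y).X n) :=
  (bcTensorIso (X.X i) (Y.X j)).inv ≫
    (baseChangeFunctor K K' B C).map (ιMapBifunctor X Y (tensorFunctor K B A C) (up ℤ) i j n h)

lemma ιBcTensorComplex_d (i j n n' : ℤ) (h : i + j = n) (hn : n + 1 = n') :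
    ιBcTensorComplex K' X Y i j n h ≫
      (baseChangeFunctor K K' B C).map ((tensorComplex X Y).d n n') =
    ((tensorFunctor K' _ _ _).map ((baseChangeFunctor K K' B A).map (X.d i (i + 1)))).app
      (bcObj K' (Y.X j)) ≫ ιBcTensorComplex K' X Y (i + 1) j n' (by lia) +
    i.negOnePow • (((tensorFunctor K' _ _ _).obj (bcObj K' (X.X i))).map
      ((baseChangeFunctor K K' A C).map (Y.d j (j + 1))) ≫
        ιBcTensorComplex K' X Y i (j + 1) n' (by lia)) := by
  simp only [ιBcTensorComplex, Category.assoc]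
  rw [← Functor.map_comp, ι_mapBifunctor_d _ X Y i j n h n' hn, Functor.map_add,
    Functor.map_units_smul, Functor.map_comp, Functor.map_comp, Preadditive.comp_add,
    Linear.comp_units_smul, ← Category.assoc, ← Category.assoc,
    ← bcTensorIso_inv_naturality_left, ← bcTensorIso_inv_naturality_right, Category.assoc,
    Category.assoc]

/-- The tensor product of the base changes of two complexes of bimodules is the base change of
their tensor product. -/
lemma nonempty_bcTensorComplexIso :
    Nonempty (tensorComplex (bcComplex K' X) (bcComplex K' Y) ≅
      bcComplex K' (tensorComplex X Y)) := by
  refine nonempty_mapBifunctor_iso _ _ _ _ (ιBcTensorComplex K' X Y)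
    (ιBcTensorComplex_d K' X Y) (fun n T f g hfg ↦ ?_) (fun n T φ ↦ ?_)
  · refine Cofan.IsColimit.hom_ext (isColimitBcTensorComplex K' X Y n) _ _ fun ⟨⟨i, j⟩, h⟩ ↦ ?_
    have := hfg i j h
    exact (cancel_epi (bcTensorIso (X.X i) (Y.X j)).inv).1
      ((Category.assoc _ _ _).symm.trans (this.trans (Category.assoc _ _ _)))
  · refine ⟨Cofan.IsColimit.desc (isColimitBcTensorComplex K' X Y n)
      fun j ↦ (bcTensorIso (X.X j.1.1) (Y.X j.1.2)).hom ≫ φ j.1.1 j.1.2 j.2, fun i j h ↦ ?_⟩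
    have := Cofan.IsColimit.fac (isColimitBcTensorComplex K' X Y n)
      (fun j ↦ (bcTensorIso (X.X j.1.1) (Y.X j.1.2)).hom ≫ φ j.1.1 j.1.2 j.2) ⟨(i, j), h⟩
    exact (Category.assoc _ _ _).trans ((congrArg (_ ≫ ·) this).trans
      (Iso.inv_hom_id_assoc _ _))

end BaseChangeTensorComplex

/-! ### Invertibility forces bounded cohomology -/

section Bounded

open HomologicalComplex ComplexShape

variable {K B A C : Type u} [CommRing K] [Ring B] [Algebra K B] [Ring A] [Algebra K A]
  [Ring C] [Algebra K C]

/-- The morphism `f ⊗ g` of tensor products of complexes of bimodules. -/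
abbrev tensorComplexMap {P P' : CochainComplex (Bimod K B A) ℤ}
    {Q Q' : CochainComplex (Bimod K A C) ℤ} (f : P ⟶ P') (g : Q ⟶ Q') :
    tensorComplex P Q ⟶ tensorComplex P' Q' :=
  mapBifunctorMap f g (tensorFunctor K B A C) (up ℤ)

lemma quasiIso_tensorComplexMap_right [Module.Flat K B] (P : CochainComplex (Bimod K B A) ℤ)
    (p : ℤ) [P.IsStrictlyLE p] (hP : ∀ i, Projective (P.X i))
    {Q Q' : CochainComplex (Bimod K A C) ℤ} (g : Q ⟶ Q') (hg : QuasiIso g) :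
    QuasiIso (tensorComplexMap (𝟙 P) g) :=
  quasiIso_mapBifunctorMap_right (tensorFunctor K B A C) P p
    (fun i S hS ↦ exact_map_tensorFunctor_obj (P.X i) S hS) g hg

lemma quasiIso_tensorComplexMap_left [Module.Flat K C] {P P' : CochainComplex (Bimod K B A) ℤ}
    (f : P ⟶ P') (hf : QuasiIso f) (Q : CochainComplex (Bimod K A C) ℤ)
    (q : ℤ) [Q.IsStrictlyLE q] (hQ : ∀ i, Projective (Q.X i)) :
    QuasiIso (tensorComplexMap f (𝟙 Q)) :=
  quasiIso_mapBifunctorMap_left (tensorFunctor K B A C) f hf Q q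
    (fun i S hS ↦ exact_map_tensorFunctor_flip_obj (Q.X i) S hS)

lemma tensorComplexMap_interchange {P P' : CochainComplex (Bimod K B A) ℤ}
    {Q Q' : CochainComplex (Bimod K A C) ℤ} (f : P ⟶ P') (g : Q ⟶ Q') :
    tensorComplexMap f (𝟙 Q) ≫ tensorComplexMap (𝟙 P') g =
      tensorComplexMap (𝟙 P) g ≫ tensorComplexMap f (𝟙 Q') := by
  ext n : 1
  refine mapBifunctor.hom_ext fun i j h ↦ ?_
  simp

lemma tensorComplexMap_id_comp (P : CochainComplex (Bimod K B A) ℤ)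
    {Q Q' Q'' : CochainComplex (Bimod K A C) ℤ} (g : Q ⟶ Q') (g' : Q' ⟶ Q'') :
    tensorComplexMap (𝟙 P) (g ≫ g') = tensorComplexMap (𝟙 P) g ≫ tensorComplexMap (𝟙 P) g' := by
  ext n : 1
  refine mapBifunctor.hom_ext fun i j h ↦ ?_
  simp

lemma tensorComplexMap_zero (P : CochainComplex (Bimod K B A) ℤ)
    (Q Q' : CochainComplex (Bimod K A C) ℤ) :
    tensorComplexMap (𝟙 P) (0 : Q ⟶ Q') = 0 := by
  ext n : 1
  refine mapBifunctor.hom_ext fun i j h ↦ ?_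
  simp

/-- The unit isomorphism for complexes. -/
def unitComplexIso (X : CochainComplex (Bimod K B C) ℤ) :
    (((tensorFunctor K B B C).obj (diagonal K B)).mapHomologicalComplex (up ℤ)).obj X ≅ X :=
  Hom.isoOfComponents (fun n ↦ unitIso (X.X n))
    fun n n' _ ↦ ((tensorUnitor K B C).hom.naturality (X.d n n')).symm

lemma unitComplexIso_hom_naturality {X Y : CochainComplex (Bimod K B C) ℤ} (g : X ⟶ Y) :
    (((tensorFunctor K B B C).obj (diagonal K B)).mapHomologicalComplex (up ℤ)).map g ≫
      (unitComplexIso Y).hom = (unitComplexIso X).hom ≫ g := by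
  ext n : 1
  exact (tensorUnitor K B C).hom.naturality (g.f n)

/-- Tensoring with `B` in degree `0` is naturally isomorphic to the identity, by way of `B ⊗_B -`
applied termwise. -/
lemma homologyMap_eq_zero_of_unit {X Y : CochainComplex (Bimod K B C) ℤ} (g : X ⟶ Y) (n : ℤ)
    (h : homologyMap (tensorComplexMap (𝟙 ((single _ (up ℤ) 0).obj (diagonal K B))) g) n = 0) :
    homologyMap g n = 0 := by
  have h₁ : homologyMap ((((tensorFunctor K B B C).obj
      (diagonal K B)).mapHomologicalComplex (up ℤ)).map g) n = 0 :=
    homologyMap_eq_zero_of_comm_left _ _ inferInstance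
      (mapBifunctorSingleIso_hom_naturality (tensorFunctor K B B C) (diagonal K B) g) n h
  exact homologyMap_eq_zero_of_comm_right (unitComplexIso X).hom (unitComplexIso Y).hom
    inferInstance (unitComplexIso_hom_naturality g).symm n h₁

/-- If `P ⊗ Q` is the diagonal bimodule, then `(P ⊗ Q) ⊗ -` detects morphisms that vanish in
homology. -/
lemma homologyMap_eq_zero_of_tensorComplexMap [Module.Flat K B] [Module.Flat K C]
    (V : CochainComplex (Bimod K B B) ℤ) (v : ℤ) [V.IsStrictlyLE v]
    (e : DerivedCategory.Q.obj V ≅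
      DerivedCategory.Q.obj ((single _ (up ℤ) 0).obj (diagonal K B)))
    {X Y : CochainComplex (Bimod K B C) ℤ} (p : ℤ) [X.IsStrictlyLE p] [Y.IsStrictlyLE p]
    (hX : ∀ i, Projective (X.X i)) (hY : ∀ i, Projective (Y.X i)) (g : X ⟶ Y) (n : ℤ)
    (h : homologyMap (tensorComplexMap (𝟙 V) g) n = 0) : homologyMap g n = 0 := by
  -- `X` and `Y` are bounded above and projective, so tensoring with them preserves the
  -- quasi-isomorphisms `V ← R → B`. The vanishing is transported from `V` to `R` and then to `B`.
  obtain ⟨R, r, s, hr, hs, hR, hR'⟩ := exists_projective_zigzag v e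
  apply homologyMap_eq_zero_of_unit
  refine homologyMap_eq_zero_of_comm_right _ _ (quasiIso_tensorComplexMap_left s hs X p hX)
    (tensorComplexMap_interchange s g) n ?_
  exact homologyMap_eq_zero_of_comm_left _ _ (quasiIso_tensorComplexMap_left r hr Y p hY)
    (tensorComplexMap_interchange r g) n h

lemma comp_eq_zero_of_strict {𝒞 : Type*} [Category 𝒞] [Abelian 𝒞] {X Y : CochainComplex 𝒞 ℤ}
    (p q : ℤ) (hpq : p < q) [X.IsStrictlyLE p] [Y.IsStrictlyGE q] (f : X ⟶ Y) : f = 0 := by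
  ext i
  by_cases hi : p < i
  · exact (X.isZero_of_isStrictlyLE p i hi).eq_of_src _ _
  · exact (Y.isZero_of_isStrictlyGE q i (by lia)).eq_of_tgt _ _

/-- A map from a projective in degree `n` becomes zero after `Q ⊗ -`, up to quasi-isomorphism, for
reasons of degree. The functor `P ⊗ (Q ⊗ -) ≅ (P ⊗ Q) ⊗ -` detects vanishing in homology because `P
⊗ Q ≅ B`. -/
theorem exists_exactAt_of_tensorComplex_iso [Module.Flat K B] [Module.Flat K A]
    (P : CochainComplex (Bimod K B A) ℤ) (Q : CochainComplex (Bimod K A B) ℤ) (p q : ℤ)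
    [P.IsStrictlyLE p] [Q.IsStrictlyLE q] (hP : ∀ i, Projective (P.X i))
    (e₁ : DerivedCategory.Q.obj (tensorComplex Q P) ≅
      DerivedCategory.Q.obj ((single _ (up ℤ) 0).obj (diagonal K A)))
    (e₂ : DerivedCategory.Q.obj (tensorComplex P Q) ≅
      DerivedCategory.Q.obj ((single _ (up ℤ) 0).obj (diagonal K B))) (n : ℤ) (hn : n < -q)
    (hn' : n ≤ p) : P.ExactAt n := by
  refine exactAt_of_projective_test P n fun M _ g ↦ ?_
  let X : CochainComplex (Bimod K B A) ℤ := (single (Bimod K B A) (up ℤ) n).obj M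
  have : X.IsStrictlyLE n := inferInstance
  -- `n ≤ p` gives `X` and `P` the common bound that the detection lemma asks for.
  have : X.IsStrictlyLE p := CochainComplex.isStrictlyLE_of_le X n p hn'
  have hX (i : ℤ) : Projective (X.X i) := by
    by_cases hi : i = n
    · subst hi
      exact Projective.of_iso (singleObjXSelf (up ℤ) i M).symm inferInstance
    · exact (isZero_single_obj_X _ _ _ _ hi).projective
  have := tensorComplex_isStrictlyLE P Q p q
  refine homologyMap_eq_zero_of_tensorComplexMap (tensorComplex P Q) (p + q) e₂ p hX hP g n ?_
  have hV : (tensorComplex Q P).IsGE 0 := by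
    rw [← DerivedCategory.isGE_Q_obj_iff]
    have : (DerivedCategory.Q.obj ((single _ (up ℤ) 0).obj (diagonal K A))).IsGE 0 := inferInstance
    exact DerivedCategory.TStructure.t.isGE_of_iso e₁.symm 0
  -- The source lives in degrees `≤ q + n < 0` and the truncation in degrees `≥ 0`, so the composite
  -- is zero already as a map of complexes.
  have h₁ : tensorComplexMap (𝟙 Q) g ≫ (tensorComplex Q P).πTruncGE 0 = 0 := by
    have := tensorComplex_isStrictlyLE Q X q n
    exact comp_eq_zero_of_strict (q + n) 0 (by lia) _
  have h₂ : homologyMap (tensorComplexMap (𝟙 P) (tensorComplexMap (𝟙 Q) g)) n = 0 := by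
    -- By `hV` the truncation map is a quasi-isomorphism, and it remains one after tensoring with
    -- the projective complex `P`.
    have := quasiIso_tensorComplexMap_right P p hP ((tensorComplex Q P).πTruncGE 0) inferInstance
    refine homologyMap_eq_zero_of_comm_left (𝟙 _) _ this
      (f' := tensorComplexMap (𝟙 P) (tensorComplexMap (𝟙 Q) g ≫ (tensorComplex Q P).πTruncGE 0))
      (by rw [Category.id_comp, tensorComplexMap_id_comp]) n ?_
    rw [h₁, tensorComplexMap_zero, homologyMap_zero]
  exact homologyMap_eq_zero_of_comm_left _ _ inferInstance
    (mapBifunctorAssociator_hom_naturality (tensorAssociator K B A B A) P Q g).symm n h₂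

end Bounded

/-! ### Base change of two-sided tilting complexes -/

section Main

open HomologicalComplex ComplexShape

variable {K : Type u} [CommRing K] {K' : Type u} [CommRing K'] [Algebra K K']
  {B A C : Type u} [Ring B] [Algebra K B] [Ring A] [Algebra K A] [Ring C] [Algebra K C]

/-- The zigzag is `X ⊗ Y ← R ⊗ Y → X' ⊗ Y ← X' ⊗ L → X' ⊗ Y'`. At each arrow the factor that stays
fixed is termwise projective, so `X` and `Y'` may be arbitrary bounded above complexes. -/
lemma nonempty_Q_tensorComplex_iso [Module.Flat K B] [Module.Flat K C]
    {X X' : CochainComplex (Bimod K B A) ℤ} {Y Y' : CochainComplex (Bimod K A C) ℤ} (x y : ℤ)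
    [X.IsStrictlyLE x] [X'.IsStrictlyLE x] [Y.IsStrictlyLE y] [Y'.IsStrictlyLE y]
    (hX' : ∀ i, Projective (X'.X i)) (hY : ∀ i, Projective (Y.X i))
    (e : DerivedCategory.Q.obj X ≅ DerivedCategory.Q.obj X')
    (e' : DerivedCategory.Q.obj Y ≅ DerivedCategory.Q.obj Y') :
    Nonempty (DerivedCategory.Q.obj (tensorComplex X Y) ≅
      DerivedCategory.Q.obj (tensorComplex X' Y')) := by
  obtain ⟨R, r, s, hr, hs, hR, hR'⟩ := exists_projective_zigzag x e
  obtain ⟨L, l, m, hl, hm, hL, hL'⟩ := exists_projective_zigzag y e'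
  obtain ⟨e₁⟩ := nonempty_Q_iso_of_zigzag (tensorComplexMap r (𝟙 Y)) (tensorComplexMap s (𝟙 Y))
    (quasiIso_tensorComplexMap_left r hr Y y hY) (quasiIso_tensorComplexMap_left s hs Y y hY)
  obtain ⟨e₂⟩ := nonempty_Q_iso_of_zigzag (tensorComplexMap (𝟙 X') l) (tensorComplexMap (𝟙 X') m)
    (quasiIso_tensorComplexMap_right X' x hX' l hl) (quasiIso_tensorComplexMap_right X' x hX' m hm)
  exact ⟨e₁ ≪≫ e₂⟩

/-- The derived tensor product is computed by arbitrary bounded above complexes of projectives. -/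
lemma nonempty_derivedTensor_iso [Module.Flat K B] [Module.Flat K C]
    (M : DerivedCategory.Minus (Bimod K B A)) (N : DerivedCategory.Minus (Bimod K A C))
    (X : CochainComplex (Bimod K B A) ℤ) (Y : CochainComplex (Bimod K A C) ℤ) (x y : ℤ)
    [X.IsStrictlyLE x] [Y.IsStrictlyLE y] (hX : ∀ i, Projective (X.X i))
    (e : DerivedCategory.Q.obj X ≅ M.obj) (e' : DerivedCategory.Q.obj Y ≅ N.obj) :
    Nonempty ((derivedTensor M N).obj ≅ DerivedCategory.Q.obj (tensorComplex X Y)) := by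
  have := (projRes M).isStrictlyLE
  have := (projRes N).isStrictlyLE
  have := CochainComplex.isStrictlyLE_of_le (projRes M).complex (projRes M).bound
    (max (projRes M).bound x) (le_max_left _ _)
  have := CochainComplex.isStrictlyLE_of_le X x (max (projRes M).bound x) (le_max_right _ _)
  have := CochainComplex.isStrictlyLE_of_le (projRes N).complex (projRes N).bound
    (max (projRes N).bound y) (le_max_left _ _)
  have := CochainComplex.isStrictlyLE_of_le Y y (max (projRes N).bound y) (le_max_right _ _)
  exact nonempty_Q_tensorComplex_iso (max (projRes M).bound x) (max (projRes N).bound y)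
    hX (projRes N).projective ((projRes M).iso ≪≫ e.symm) ((projRes N).iso ≪≫ e'.symm)

variable (K' A) in
lemma nonempty_bcComplex_single_iso :
    Nonempty (bcComplex K' ((single _ (up ℤ) 0).obj (diagonal K A)) ≅
      (single _ (up ℤ) 0).obj (diagonal K' (K' ⊗[K] A))) :=
  ⟨(singleMapHomologicalComplex (baseChangeFunctor K K' A A) (up ℤ) 0).app (diagonal K A) ≪≫
    (single _ (up ℤ) 0).mapIso (asIso (bcDiagonalHom K K' A))⟩

/-- A derived isomorphism cannot be base changed directly. It is realised by quasi-isomorphisms `X ⊗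
Y ← R → A` in which all three complexes are bounded above and termwise flat over `K`, and these
survive base change. -/
lemma nonempty_Q_bc_tensorComplex_iso [Module.Flat K A] [Module.Flat K B]
    (X : CochainComplex (Bimod K A B) ℤ) (Y : CochainComplex (Bimod K B A) ℤ) (x y : ℤ)
    [X.IsStrictlyLE x] [Y.IsStrictlyLE y] (hX : ∀ i, Projective (X.X i))
    (hY : ∀ i, Projective (Y.X i))
    (e : DerivedCategory.Q.obj (tensorComplex X Y) ≅
      DerivedCategory.Q.obj ((single _ (up ℤ) 0).obj (diagonal K A))) :
    Nonempty (DerivedCategory.Q.obj (tensorComplex (bcComplex K' X) (bcComplex K' Y)) ≅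
      DerivedCategory.Q.obj ((single _ (up ℤ) 0).obj (diagonal K' (K' ⊗[K] A)))) := by
  have := tensorComplex_isStrictlyLE X Y x y
  obtain ⟨R, r, s, hr, hs, hR, hR'⟩ := exists_projective_zigzag (x + y) e
  have hRf (i : ℤ) : Module.Flat K (R.X i) := flat_of_projective _
  have hYf (i : ℤ) : Module.Flat K (Y.X i) := flat_of_projective _
  let S : CochainComplex (Bimod K A A) ℤ := (single _ (up ℤ) 0).obj (diagonal K A)
  have hS : S.IsStrictlyLE 0 := inferInstance
  have hSf (i : ℤ) : Module.Flat K (S.X i) := by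
    by_cases hi : i = 0
    · subst hi
      have := flat_diagonal (K := K) (A := A)
      exact flat_of_bimod_iso (singleObjXSelf (up ℤ) 0 (diagonal K A))
    · exact flat_of_isZero (isZero_single_obj_X _ _ _ _ hi)
  have := CochainComplex.isStrictlyLE_of_le S 0 (max (x + y) 0) (le_max_right _ _)
  have := CochainComplex.isStrictlyLE_of_le R (x + y) (max (x + y) 0) (le_max_left _ _)
  obtain ⟨e₁⟩ := nonempty_Q_iso_of_zigzag _ _
    (quasiIso_bcComplex_map (K' := K') r (x + y) hRf (flat_tensorComplex X Y hX hYf))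
    (quasiIso_bcComplex_map (K' := K') (Y := S) s (max (x + y) 0) hRf hSf)
  obtain ⟨e₂⟩ := nonempty_bcTensorComplexIso K' X Y
  obtain ⟨e₃⟩ := nonempty_bcComplex_single_iso K' (K := K) A
  exact ⟨DerivedCategory.Q.mapIso e₂ ≪≫ e₁ ≪≫ DerivedCategory.Q.mapIso e₃⟩

lemma isStrictlyLE_bcComplex (X : CochainComplex (Bimod K B A) ℤ) (x : ℤ) [X.IsStrictlyLE x] :
    (bcComplex K' X).IsStrictlyLE x := by
  rw [CochainComplex.isStrictlyLE_iff]
  intro i hi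
  exact (baseChangeFunctor K K' B A).map_isZero (X.isZero_of_isStrictlyLE x i hi)

lemma bounded_of_exactAt (X : CochainComplex (Bimod K B A) ℤ) (x k : ℤ) [X.IsStrictlyLE x]
    (h : ∀ i < k, X.ExactAt i) :
    DerivedCategory.TStructure.t.bounded (DerivedCategory.Q.obj X) := by
  refine ⟨⟨k, ?_⟩, ⟨x, inferInstance⟩⟩
  change (DerivedCategory.Q.obj X).IsGE k
  rw [DerivedCategory.isGE_Q_obj_iff, CochainComplex.isGE_iff]
  exact h

variable (K A) in
/-- The diagonal bimodule in the derived category, as the image of a single complex. -/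
def diagonalDIso :
    (diagonalD K A).obj ≅ DerivedCategory.Q.obj ((single _ (up ℤ) 0).obj (diagonal K A)) :=
  (DerivedCategory.singleFunctorIsoCompQ (Bimod K A A) 0).app (diagonal K A)

theorem isInverse_derivedBaseChange [Module.Flat K A] [Module.Flat K B]
    (T : DBounded K B A) (S : DBounded K A B) (h : IsInverse T S) :
    ∃ (hT' : DerivedCategory.TStructure.t.bounded (derivedBaseChange K' (toMinus T)).obj)
      (hS' : DerivedCategory.TStructure.t.bounded (derivedBaseChange K' (toMinus S)).obj),
      IsInverse (⟨_, hT'⟩ : DBounded K' (K' ⊗[K] B) (K' ⊗[K] A))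
        (⟨_, hS'⟩ : DBounded K' (K' ⊗[K] A) (K' ⊗[K] B)) := by
  obtain ⟨⟨e₁⟩, ⟨e₂⟩⟩ := h
  let P := (projRes (toMinus T)).complex
  let Q := (projRes (toMinus S)).complex
  let p := (projRes (toMinus T)).bound
  let q := (projRes (toMinus S)).bound
  have : P.IsStrictlyLE p := (projRes (toMinus T)).isStrictlyLE
  have : Q.IsStrictlyLE q := (projRes (toMinus S)).isStrictlyLE
  have hP : ∀ i, Projective (P.X i) := (projRes (toMinus T)).projective
  have hQ : ∀ i, Projective (Q.X i) := (projRes (toMinus S)).projective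
  let P' := bcComplex K' P
  let Q' := bcComplex K' Q
  have hP' (i : ℤ) : Projective (P'.X i) := inferInstanceAs (Projective (bcObj K' (P.X i)))
  have hQ' (i : ℤ) : Projective (Q'.X i) := inferInstanceAs (Projective (bcObj K' (Q.X i)))
  have : P'.IsStrictlyLE p := isStrictlyLE_bcComplex P p
  have : Q'.IsStrictlyLE q := isStrictlyLE_bcComplex Q q
  obtain ⟨f₁⟩ := nonempty_Q_bc_tensorComplex_iso (K' := K') Q P q p hQ hP
    (e₁ ≪≫ diagonalDIso _ _)
  obtain ⟨f₂⟩ := nonempty_Q_bc_tensorComplex_iso (K' := K') P Q p q hP hQ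
    (e₂ ≪≫ diagonalDIso _ _)
  -- The bound `-q` comes from the degree argument; the minimum with `p` supplies the side condition
  -- `i ≤ p`.
  have hT' := bounded_of_exactAt P' p (min (-q) p) fun i hi ↦
    exists_exactAt_of_tensorComplex_iso P' Q' p q hP' f₁ f₂ i (by lia) (by lia)
  have hS' := bounded_of_exactAt Q' q (min (-p) q) fun i hi ↦
    exists_exactAt_of_tensorComplex_iso Q' P' q p hQ' f₂ f₁ i (by lia) (by lia)
  refine ⟨hT', hS', ?_, ?_⟩
  -- `Q'` and `P'` are by definition the complexes that represent the derived base changes, whence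
  -- the identity isomorphisms.
  · obtain ⟨g⟩ := nonempty_derivedTensor_iso (derivedBaseChange K' (toMinus S))
      (derivedBaseChange K' (toMinus T)) Q' P' q p hQ' (Iso.refl _) (Iso.refl _)
    exact ⟨g ≪≫ f₁ ≪≫ (diagonalDIso _ _).symm⟩
  · obtain ⟨g⟩ := nonempty_derivedTensor_iso (derivedBaseChange K' (toMinus T))
      (derivedBaseChange K' (toMinus S)) P' Q' p q hP' (Iso.refl _) (Iso.refl _)
    exact ⟨g ≪≫ f₂ ≪≫ (diagonalDIso _ _).symm⟩

end Main

end TwoSidedTilting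

end

theorem mainTheorem7 {K : Type u} [CommRing K] {A B : Type u} [Ring A] [Algebra K A]
    [Ring B] [Algebra K B] [Module.Flat K A] [Module.Flat K B]
    (K' : Type u) [CommRing K'] [Algebra K K']
    (T : TwoSidedTilting.DBounded K B A) (S : TwoSidedTilting.DBounded K A B)
    (_hT : TwoSidedTilting.IsTwoSidedTilting T) (hTS : TwoSidedTilting.IsInverse T S) :
    ∃ (hT' : DerivedCategory.TStructure.t.bounded
        (TwoSidedTilting.derivedBaseChange K' (TwoSidedTilting.toMinus T)).obj)
      (hS' : DerivedCategory.TStructure.t.bounded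
        (TwoSidedTilting.derivedBaseChange K' (TwoSidedTilting.toMinus S)).obj),
      TwoSidedTilting.IsTwoSidedTilting
        (⟨_, hT'⟩ : TwoSidedTilting.DBounded K' (K' ⊗[K] B) (K' ⊗[K] A)) ∧
      TwoSidedTilting.IsInverse
        (⟨_, hT'⟩ : TwoSidedTilting.DBounded K' (K' ⊗[K] B) (K' ⊗[K] A))
        (⟨_, hS'⟩ : TwoSidedTilting.DBounded K' (K' ⊗[K] A) (K' ⊗[K] B)) := by
  obtain ⟨hT', hS', h⟩ := TwoSidedTilting.isInverse_derivedBaseChange (K' := K') T S hTS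
  exact ⟨hT', hS', ⟨_, h⟩, h⟩
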